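/- Let $f:[-1,1]\to\mathbb R$ be continuous, $f(\pm1)=0$, real analytic on $(-1,1)$ with $f''<0$ there, and suppose that $f^2$ extends real analytically to a neighbourhood of $[-1,1]$ with $(f^2)'(\pm1)\neq0$. Then $M=\{(r,f(r)\cos\theta,f(r)\sin\theta): r\in[-1,1],\ \theta\in\mathbb R\}$ is a compact, strictly convex, real analytic surface of revolution; let $g=(1+f'(r)^2)\,dr^2+f(r)^2\,d\theta^2$ be its induced metric and $\Delta_g$ its Laplace operator. Let $V=V(r)$ be real analytic on a neighbourhood of $[-1,1]$, regarded as a rotation-invariant potential on $M$, and let $\min V<E<\max V$ be a regular value of $p(x,\xi)=|\xi|_g^2+V(x)$ on $T^*M$. For $-1<r_0<1$ let $H_{r_0}=\{r=r_0\}\subset M$ be the parallel circle, and for a function $\phi$ on $M$ put $Z_\phi=\phi^{-1}(0)$. (a) The number $c_0:=\big(\max_{r\in[-1,1]} f(r)^2(E-V(r))\big)^{1/2}$ is well defined and positive. Let $0<c\le c_0$, and let $h_k>0$ be any sequence with $h_k\to0$ and $c/h_k\in\mathbb N$ for all $k$. Then there are smooth, real valued, $L^2$-normalized functions $$\phi_{h_k}(r,\theta)=\mathrm{Re}\big(e^{ic\theta/h_k}\,v_{h_k}(r)\big),\qquad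 v_{h_k}\ \text{real valued},$$ on $M$ and numbers $E(h_k)=E+o(1)$ as $k\to\infty$ with $(-h_k^2\Delta_g+V)\phi_{h_k}=E(h_k)\phi_{h_k}$ on $M$, such that for every $k$ and every $r_0\in(-1,1)$ with $V(r_0)>E$ (that is, $H_{r_0}$ lies in the forbidden region $\Omega_E=\{V>E\}$) $$\#\{Z_{\phi_{h_k}}\cap H_{r_0}\}\ \ge\ 2c/h_k ,$$ with equality for all sufficiently large $k$ if $H_{r_0}$ bounds a region inside $\Omega_E$ (that is, $V>E$ on $[-1,r_0]$ or on $[r_0,1]$). In particular, if $c_0\ge1$ one may take $c=1$: then $1/h_k\in\mathbb N$, $\phi_{h_k}=\mathrm{Re}(e^{i\theta/h_k}v_{h_k}(r))$, and there are at least $2/h_k$ zeros on $H_{r_0}$. (b) Consequently the bound $\#\{Z_{\phi_h}\cap H\}\le C_H/h$, which holds for real valued eigenfunctions with $E(h)=E+o(1)$ of $-h^2\Delta_g+V$ on a compact real analytic surface, with $V$ real analytic and $H$ a simple closed real analytic curve that bounds a region inside $\Omega_E$, is sharp: there are $f$, $V$, $E$ as above and $r_0\in(-1,1)$ with $V>E$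 on $[r_0,1]$, so that $H_{r_0}$ bounds a region inside $\Omega_E$, a strictly decreasing sequence $h_k\to0^+$, and smooth real valued $L^2$-normalized eigenfunctions $\phi_{h_k}=\mathrm{Re}(e^{i\theta/h_k}v_{h_k}(r))$ of $-h_k^2\Delta_g+V$ on $M$ with eigenvalues $E(h_k)=E+o(1)$, such that for every $k$ $$2/h_k\ \le\ \#\{Z_{\phi_{h_k}}\cap H_{r_0}\}\ <\ \infty .$$ -/

import Mathlib

open Set Filter Topology
open scoped ContDiff

noncomputable section

/-- Euclidean three-space. -/
abbrev E3 : Type := EuclideanSpace ℝ (Fin 3)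

/-- `f` is the profile on `[-1, 1]` of a strictly convex, real analytic surface of revolution.
The last field says that the closed surface is analytic, with positive curvature, at its two poles
also: there `r` is an analytic function, with non-zero derivative, of the squared distance
`f r ^ 2` to the axis. (A profile which is itself analytic up to `r = 1` or `r = -1` with
`f r = 0`, `f' r ≠ 0` would produce a conical point.) For the round sphere, `f r ^ 2 = 1 - r ^ 2`. -/
structure IsConvexProfile (f : ℝ → ℝ) : Prop where
  continuousOn : ContinuousOn f (Icc (-1) 1)
  left_zero : f (-1) = 0
  right_zero : f 1 = 0
  analytic : AnalyticOnNhd ℝ f (Ioo (-1) 1)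
  concave : ∀ r ∈ Ioo (-1 : ℝ) 1, deriv (deriv f) r < 0
  analytic_poles : ∃ F : ℝ → ℝ, AnalyticOnNhd ℝ F (Icc (-1) 1) ∧
    (∀ r ∈ Icc (-1 : ℝ) 1, F r = f r ^ 2) ∧ deriv F (-1) ≠ 0 ∧ deriv F 1 ≠ 0

/-- The parametrization `(r, θ) ↦ (r, f(r) cos θ, f(r) sin θ)`. -/
def revPoint (f : ℝ → ℝ) (r θ : ℝ) : E3 :=
  !₂[r, f r * Real.cos θ, f r * Real.sin θ]

/-- The surface of revolution, as a subset of three-space. -/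
def revSurface (f : ℝ → ℝ) : Set E3 :=
  {p | ∃ r ∈ Icc (-1 : ℝ) 1, ∃ θ : ℝ, p = revPoint f r θ}

/-- The parallel circle at height `r₀`. -/
def parallel (f : ℝ → ℝ) (r₀ : ℝ) : Set E3 :=
  range (revPoint f r₀)

/-- `w(r) = √(1 + f'(r)²)`; the induced metric is `w(r)² dr² + f(r)² dθ²`. -/
def profileSpeed (f : ℝ → ℝ) (r : ℝ) : ℝ :=
  √(1 + deriv f r ^ 2)

/-- The Laplace-Beltrami operator of `w(r)² dr² + f(r)² dθ²` in the coordinates `(r, θ)`,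
`-1 < r < 1`:
`Δ u = (w f)⁻¹ ∂_r ((f / w) ∂_r u) + f⁻² ∂_θ² u`. -/
def laplaceBeltrami (f : ℝ → ℝ) (u : ℝ → ℝ → ℝ) (r θ : ℝ) : ℝ :=
  1 / (profileSpeed f r * f r) *
      deriv (fun s => f s / profileSpeed f s * deriv (fun t => u t θ) s) r +
    1 / f r ^ 2 * deriv (deriv (fun t => u r t)) θ

/-- `φ`, of which only the values on the surface matter, is a smooth, real valued,
`L²`-normalized function on the surface with `(-h² Δ + V) φ = e φ`. A function on the surface is
smooth if it is near each point of the surface, the poles included, the restriction of a smooth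
function on three-space. As `φ` is smooth at the poles, the equation holds there as soon as it
holds away from them. The area element is `f(r) w(r) dr dθ`. -/
structure IsNormalizedEigenfunction (f V : ℝ → ℝ) (h e : ℝ) (φ : E3 → ℝ) : Prop where
  smooth : ∀ p ∈ revSurface f, ContDiffAt ℝ ∞ φ p
  equation : ∀ r ∈ Ioo (-1 : ℝ) 1, ∀ θ : ℝ,
    -h ^ 2 * laplaceBeltrami f (fun s t => φ (revPoint f s t)) r θ
      + V r * φ (revPoint f r θ) = e * φ (revPoint f r θ)
  normalized : ∫ r in (-1 : ℝ)..1, ∫ θ in (0 : ℝ)..(2 * Real.pi),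
    φ (revPoint f r θ) ^ 2 * (f r * profileSpeed f r) = 1

/-- Pairs `(x, ξ)` of a point `x` of the surface and a tangent vector `ξ` there (the velocity of
some curve in the surface). The metric identifies this with the cotangent bundle. -/
def revTangentBundle (f : ℝ → ℝ) : Set (E3 × E3) :=
  {q | ∃ γ : ℝ → E3, (∀ t, γ t ∈ revSurface f) ∧ γ 0 = q.1 ∧ HasDerivAt γ q.2 0}

/-- The total energy `p(x, ξ) = |ξ|² + V(x)` for a potential that depends only on the coordinate
`r` of `x`. -/
def totalEnergy (V : ℝ → ℝ) (q : E3 × E3) : ℝ :=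
  ‖q.2‖ ^ 2 + V (q.1 0)

/-- `E` is a regular value of the total energy: at each point of the energy surface the derivative
of the energy along some curve in the tangent bundle is non-zero. -/
def IsRegularEnergy (f V : ℝ → ℝ) (E : ℝ) : Prop :=
  ∀ q ∈ revTangentBundle f, totalEnergy V q = E →
    ∃ Γ : ℝ → E3 × E3, (∀ t, Γ t ∈ revTangentBundle f) ∧ Γ 0 = q ∧ DifferentiableAt ℝ Γ 0 ∧
      deriv (fun t => totalEnergy V (Γ t)) 0 ≠ 0

/-- The number of zeros of `φ` on the parallel circle at height `r₀` (possibly infinite). -/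
def zerosOnParallel (f : ℝ → ℝ) (r₀ : ℝ) (φ : E3 → ℝ) : ENNReal :=
  ((parallel f r₀ ∩ {p | φ p = 0}).encard : ENNReal)

end

/-!
Write a function of angular momentum `m = c / h` on the surface as `cos (m θ) v(r)`. It satisfies
`(-h² Δ + V) φ = e φ` if and only if `-h² ρ⁻¹ (F ρ⁻¹ v')' + (c² / F + V) v = e v`, where `F = f²`, and
`ρ dr dθ` is the area element. Both `F` and `ρ` continue smoothly across the poles `r = ±1`, where `F`
has simple zeros (`exists_models`). The substitution `v = f ^ m * G` turns the singular term
`m² / F` into a smooth potential and leaves a Sturm-Liouville operator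
`G ↦ (ρ Fᵐ)⁻¹ (Fᵐ⁺¹ ρ⁻¹ G')'`, degenerate at the poles (`Models.hasDerivAt_flux_pow_mul`). As
`f ^ m cos (m θ)` is the real part of `(y + i z) ^ m`, every `G` which is smooth on a neighbourhood of
`[-1, 1]` gives a smooth function on the surface (`contDiffAt_angularFun`).

*Existence of eigenvalues near `E`.* The regular solutions of the degenerate equation are obtained
by integrating twice, from a pole; written with means over segments (`radialMean`), the integrals
show no singularity, so that solutions are smooth across the poles (`IsSol.contDiffOn`). Hence the
solution operator on continuous functions on `[-2, 2]` is compact, and if `lam₀` is not an eigenvalue,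
the Fredholm alternative supplies a compact resolvent. It is symmetric for the inner product with
weight `ρ Fᵐ` on `[-1, 1]`, which is weaker than the norm. Such an operator is bounded for the weak
norm by its operator norm, and has an eigenvalue at least as large as any of its expansion factors
(`exists_eigenvalue_of_compact_symm`), so an approximate eigenfunction with relative error less
than `δ` has an eigenvalue within `δ` (`PolarWeight.exists_eigenfunction`). For `0 < c ≤ c₀` the
effective potential `c² / f² + V` takes the value `E` at some `r₁` between the poles
(`exists_effective_eq`), and a fixed bump function near `r₁` is an approximate eigenfunction: the
kinetic term is `O(h²)`, and the potential differs from `E` by little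
(`PolarWeight.exists_isMode_near`).

*Zeros.* On the parallel at height `r₀` the eigenfunction is `v(r₀) cos (m θ)`, which has `2 m` zeros
if `v(r₀) ≠ 0` and vanishes identically if not. If `r₀` bounds a cap in the forbidden region, then
`v(r₀) ≠ 0` as soon as the eigenvalue is less than the minimum of `V` on the cap: the product of `v`
and its flux `F ρ⁻¹ v'` vanishes at the pole, and increases strictly as long as `v ≠ 0`
(`IsMode.false_of_forbidden`).

Sharpness is seen on the round sphere, with `V = 3 r`, `E = 0` and `r₀ = 1 / 2`: there
`c₀² ≥ 9 / 8`, so `c = 1` is allowed.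
-/

namespace RevolutionSurface

/-! ### Symmetric compact operators for a weak inner product -/

section WeakInner

variable {X : Type*} [NormedAddCommGroup X] [NormedSpace ℝ X]

/-- The Cauchy-Schwarz inequality for a positive semidefinite symmetric bilinear form. -/
theorem bilin_sq_le (b : X →ₗ[ℝ] X →ₗ[ℝ] ℝ) (hs : ∀ x y, b x y = b y x)
    (hp : ∀ x, 0 ≤ b x x) (x y : X) : b x y ^ 2 ≤ b x x * b y y := by
  have h : ∀ t : ℝ, 0 ≤ b y y * (t * t) + (2 * b x y) * t + b x x := by
    intro t
    have := hp (x + t • y)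
    simp only [map_add, map_smul, LinearMap.add_apply, LinearMap.smul_apply, smul_eq_mul] at this
    rw [hs y x] at this
    linarith
  have := discrim_le_zero h
  unfold discrim at this
  nlinarith

/-- An operator which is bounded for the norm and symmetric for a weaker inner product is bounded
for the weaker inner product too, with the same constant. -/
theorem bilin_apply_le_of_symm (b : X →ₗ[ℝ] X →ₗ[ℝ] ℝ) (hs : ∀ x y, b x y = b y x)
    (hp : ∀ x, 0 ≤ b x x) {C : ℝ} (hC : ∀ x, b x x ≤ C * ‖x‖ ^ 2)
    (T : X →L[ℝ] X) (hT : ∀ x y, b (T x) y = b x (T y)) (x : X) :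
    b (T x) (T x) ≤ ‖T‖ ^ 2 * b x x := by
  have hpow : ∀ (n : ℕ) (y z : X), b ((T ^ n) y) z = b y ((T ^ n) z) := by
    intro n
    induction n with
    | zero => simp
    | succ n ih =>
      intro y z
      rw [pow_succ, mul_apply_eq_comp, ih, hT, ← mul_apply_eq_comp,
        ← pow_succ']
      simp [pow_succ]
  set a : ℕ → ℝ := fun n => b ((T ^ n) x) ((T ^ n) x) with ha
  have hstep : ∀ n, a n ^ 2 ≤ a 0 * a (2 * n) := by
    intro n
    have h1 : a n = b x ((T ^ (2 * n)) x) := by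
      simp only [ha]
      rw [hpow, ← mul_apply_eq_comp, ← pow_add, two_mul]
    rw [h1]
    simpa [ha] using bilin_sq_le b hs hp x ((T ^ (2 * n)) x)
  have ha0 : a 0 = b x x := by simp [ha]
  have ha1 : a 1 = b (T x) (T x) := by simp [ha]
  rw [← ha1, ← ha0]
  have hnn : ∀ n, 0 ≤ a n := fun n => hp _
  rcases (hnn 0).eq_or_lt with h0 | h0
  · have := hstep 1
    rw [← h0] at this ⊢
    nlinarith [sq_nonneg (a 1)]
  -- the ratios `a n / a 0` at the powers of two dominate the powers of `a 1 / a 0`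
  have hr : ∀ j : ℕ, (a 1 / a 0) ^ (2 ^ j) ≤ a (2 ^ j) / a 0 := by
    intro j
    induction j with
    | zero => simp
    | succ j ih =>
      have h1 : (a (2 ^ j) / a 0) ^ 2 ≤ a (2 ^ (j + 1)) / a 0 := by
        rw [div_pow, div_le_div_iff₀ (by positivity) h0, pow_succ' 2 j]
        nlinarith [hstep (2 ^ j)]
      calc (a 1 / a 0) ^ (2 ^ (j + 1)) = ((a 1 / a 0) ^ (2 ^ j)) ^ 2 := by rw [pow_succ, pow_mul]
        _ ≤ (a (2 ^ j) / a 0) ^ 2 :=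
            pow_le_pow_left₀ (pow_nonneg (div_nonneg (hnn 1) h0.le) _) ih 2
        _ ≤ _ := h1
  have hbd : ∀ j : ℕ, (a 1 / a 0) ^ (2 ^ j) ≤ (|C| * ‖x‖ ^ 2 / a 0) * (‖T‖ ^ 2) ^ (2 ^ j) := by
    intro j
    refine (hr j).trans ?_
    have h1 : a (2 ^ j) ≤ |C| * (‖T‖ ^ (2 ^ j) * ‖x‖) ^ 2 := by
      refine (hC _).trans ?_
      have h2 : ‖(T ^ (2 ^ j)) x‖ ≤ ‖T‖ ^ (2 ^ j) * ‖x‖ :=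
        ((T ^ (2 ^ j)).le_opNorm x).trans
          (mul_le_mul_of_nonneg_right (norm_pow_le' T (by positivity)) (norm_nonneg _))
      exact mul_le_mul (le_abs_self C) (pow_le_pow_left₀ (norm_nonneg _) h2 2) (by positivity)
        (abs_nonneg _)
    rw [div_mul_eq_mul_div]
    refine div_le_div_of_nonneg_right (h1.trans_eq ?_) h0.le
    rw [mul_pow, ← pow_mul, ← pow_mul, mul_comm (2 ^ j) 2]
    ring
  have key : a 1 / a 0 ≤ ‖T‖ ^ 2 := by
    by_contra hcon
    push Not at hcon
    set s := a 1 / a 0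
    set t := ‖T‖ ^ 2 with ht
    have ht0 : 0 ≤ t := by positivity
    have hs0 : 0 < s := lt_of_le_of_lt ht0 hcon
    have hlim : Tendsto (fun j : ℕ => (|C| * ‖x‖ ^ 2 / a 0) * (t / s) ^ (2 ^ j)) atTop (𝓝 0) := by
      have h1 : Tendsto (fun n : ℕ => (t / s) ^ n) atTop (𝓝 0) :=
        tendsto_pow_atTop_nhds_zero_of_lt_one (div_nonneg ht0 hs0.le) ((div_lt_one hs0).2 hcon)
      have h2 : Tendsto (fun j : ℕ => 2 ^ j) atTop atTop :=
        tendsto_pow_atTop_atTop_of_one_lt (by norm_num : (1 : ℕ) < 2)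
      simpa using (h1.comp h2).const_mul (|C| * ‖x‖ ^ 2 / a 0)
    obtain ⟨j, hj⟩ := (hlim.eventually (gt_mem_nhds one_pos)).exists
    have := hbd j
    rw [div_pow, ← mul_div_assoc, div_lt_one (by positivity)] at hj
    linarith
  rwa [div_le_iff₀ h0] at key

variable [CompleteSpace X]

/-- A compact operator which is symmetric for a weaker inner product has an eigenvalue at least as
large as any of its expansion factors in the weak norm. -/
theorem exists_eigenvalue_of_compact_symm (b : X →ₗ[ℝ] X →ₗ[ℝ] ℝ) (hs : ∀ x y, b x y = b y x)
    (hp : ∀ x, 0 ≤ b x x) {C : ℝ} (hC : ∀ x, b x x ≤ C * ‖x‖ ^ 2)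
    (T : X →L[ℝ] X) (hT : ∀ x y, b (T x) y = b x (T y)) (hc : IsCompactOperator T)
    {M : ℝ} (hM : 0 ≤ M) {x₀ : X} (hx₀ : M ^ 2 * b x₀ x₀ < b (T x₀) (T x₀)) :
    ∃ μ : ℝ, M < |μ| ∧ ∃ x : X, x ≠ 0 ∧ T x = μ • x := by
  have hbd := bilin_apply_le_of_symm b hs hp hC T hT
  set S : Set ℝ := {t | ∃ x, b x x ≤ 1 ∧ b (T x) (T x) = t} with hS
  have hSbdd : BddAbove S := by
    refine ⟨‖T‖ ^ 2, ?_⟩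
    rintro t ⟨x, hx, rfl⟩
    exact (hbd x).trans (mul_le_of_le_one_right (by positivity) hx)
  have hS0 : (0 : ℝ) ∈ S := ⟨0, by simp, by simp⟩
  set L2 := sSup S with hL2
  have hL20 : 0 ≤ L2 := le_csSup hSbdd hS0
  have hL : ∀ x, b (T x) (T x) ≤ L2 * b x x := by
    intro x
    rcases (hp x).eq_or_lt with h0 | h0
    · have := hbd x
      rw [← h0] at this ⊢
      simpa using this
    · have hmem : b (T x) (T x) / b x x ∈ S := by
        refine ⟨(√(b x x))⁻¹ • x, ?_, ?_⟩
        · simp only [map_smul, LinearMap.smul_apply, smul_eq_mul]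
          rw [← mul_assoc, ← mul_inv, Real.mul_self_sqrt h0.le, inv_mul_cancel₀ h0.ne']
        · simp only [map_smul, LinearMap.smul_apply, smul_eq_mul]
          rw [← mul_assoc, ← mul_inv, Real.mul_self_sqrt h0.le]
          field_simp
      have := le_csSup hSbdd hmem
      rwa [div_le_iff₀ h0] at this
  have hML : M ^ 2 < L2 := by
    by_contra hcon
    push Not at hcon
    have := (hL x₀).trans (mul_le_mul_of_nonneg_right hcon (hp x₀))
    linarith
  set l := √L2 with hl
  have hl2 : l ^ 2 = L2 := Real.sq_sqrt hL20
  have hMl : M < l := Real.lt_sqrt_of_sq_lt hML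
  have hl0 : 0 < l := hM.trans_lt hMl
  -- each of `l`, `-l` is an eigenvalue, or `T` minus it is boundedly invertible
  have alt : ∀ μ : ℝ, |μ| = l → (∃ μ : ℝ, M < |μ| ∧ ∃ x : X, x ≠ 0 ∧ T x = μ • x) ∨
      ∃ K : ℝ, 0 ≤ K ∧ ∀ x, b x x ≤ K * b (T x - μ • x) (T x - μ • x) := by
    intro μ hμ
    have hμ0 : μ ≠ 0 := by rintro rfl; simp at hμ; linarith
    rcases hc.hasEigenvalue_or_mem_resolventSet hμ0 with h | h
    · left
      obtain ⟨x, hx⟩ := h.exists_hasEigenvector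
      exact ⟨μ, hμ ▸ hMl, x, hx.2, by simpa using hx.apply_eq_smul⟩
    · right
      rw [spectrum.mem_resolventSet_iff] at h
      obtain ⟨u, hu⟩ := h
      have huv : ∀ x, (u : X →L[ℝ] X) x = μ • x - T x := by
        intro x; rw [hu]; simp [Algebra.algebraMap_eq_smul_one]
      set R : X →L[ℝ] X := ((u⁻¹ : (X →L[ℝ] X)ˣ) : X →L[ℝ] X) with hR
      have hRu : ∀ x, R ((u : X →L[ℝ] X) x) = x := by
        intro x
        rw [← mul_apply_eq_comp, hR, u.inv_mul]; rfl
      have huR : ∀ x, (u : X →L[ℝ] X) (R x) = x := by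
        intro x
        rw [← mul_apply_eq_comp, hR, u.mul_inv]; rfl
      have hus : ∀ x y, b ((u : X →L[ℝ] X) x) y = b x ((u : X →L[ℝ] X) y) := by
        intro x y
        rw [huv, huv]
        simp [hT]
      have hRs : ∀ x y, b (R x) y = b x (R y) := by
        intro x y
        conv_lhs => rw [← huR y]
        rw [← hus, huR]
      refine ⟨‖R‖ ^ 2, by positivity, fun x => ?_⟩
      have h1 := bilin_apply_le_of_symm b hs hp hC R hRs ((u : X →L[ℝ] X) x)
      rw [hRu, huv] at h1
      have h2 : b (T x - μ • x) (T x - μ • x) = b (μ • x - T x) (μ • x - T x) := by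
        rw [← neg_sub (T x) (μ • x)]
        simp only [map_neg, LinearMap.neg_apply, neg_neg]
      rw [h2]; exact h1
  rcases alt l (abs_of_pos hl0) with h | ⟨K₁, hK₁, h₁⟩
  · exact h
  rcases alt (-l) (by rw [abs_neg, abs_of_pos hl0]) with h | ⟨K₂, hK₂, h₂⟩
  · exact h
  exfalso
  -- `T ^ 2 - l ^ 2` is bounded below, which an almost maximizing vector contradicts
  have hlow : ∀ x, b x x ≤ K₂ * K₁ * (b (T (T x)) (T (T x)) - 2 * L2 * b (T x) (T x)
      + L2 ^ 2 * b x x) := by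
    intro x
    have e1 := h₂ x
    have e2 := h₁ (T x - (-l) • x)
    have e3 : T (T x - (-l) • x) - l • (T x - (-l) • x) = T (T x) - L2 • x := by
      rw [← hl2, pow_two, mul_smul]
      simp only [map_sub, map_smul, neg_smul, map_neg, smul_sub, smul_neg]
      abel
    rw [e3] at e2
    have e4 : b (T (T x) - L2 • x) (T (T x) - L2 • x) = b (T (T x)) (T (T x))
        - 2 * L2 * b (T x) (T x) + L2 ^ 2 * b x x := by
      have e5 : b (T (T x)) x = b (T x) (T x) := hT _ _
      have e6 : b x (T (T x)) = b (T x) (T x) := by rw [hs, e5]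
      simp only [map_sub, map_smul, LinearMap.sub_apply, LinearMap.smul_apply, smul_eq_mul, e5, e6]
      ring
    rw [e4] at e2
    calc b x x ≤ K₂ * _ := e1
      _ ≤ K₂ * (K₁ * _) := mul_le_mul_of_nonneg_left e2 hK₂
      _ = _ := by ring
  have hL2pos : 0 < L2 := lt_of_le_of_lt (by positivity) hML
  set ε := L2 / (2 * (1 + L2 * (K₂ * K₁ * L2))) with hε
  have hK : 0 ≤ L2 * (K₂ * K₁ * L2) := by positivity
  have hεpos : 0 < ε := by positivity
  obtain ⟨t, ⟨x, hx1, rfl⟩, hx2⟩ := exists_lt_of_lt_csSup ⟨0, hS0⟩ (sub_lt_self L2 hεpos)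
  have e1 := hlow x
  have e2 := hL (T x)
  have e3 := hL x
  have e4 : b (T (T x)) (T (T x)) - 2 * L2 * b (T x) (T x) + L2 ^ 2 * b x x ≤ L2 * ε := by
    nlinarith
  have e5 : b x x ≤ K₂ * K₁ * (L2 * ε) := e1.trans (mul_le_mul_of_nonneg_left e4 (by positivity))
  have e6 : L2 - ε < L2 * (K₂ * K₁ * (L2 * ε)) :=
    hx2.trans_le (e3.trans (mul_le_mul_of_nonneg_left e5 hL20))
  have e7 : ε * (2 * (1 + L2 * (K₂ * K₁ * L2))) = L2 := by
    rw [hε]; field_simp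
  nlinarith

end WeakInner

/-- An operator on continuous functions on an interval whose values are Lipschitz, with constants
controlled by the norm of the argument, is compact. -/
theorem isCompactOperator_of_lipschitz {a b : ℝ} (T : C(Icc a b, ℝ) →L[ℝ] C(Icc a b, ℝ)) {C : ℝ}
    (hT : ∀ g x y, |T g x - T g y| ≤ C * ‖g‖ * |(x : ℝ) - y|) : IsCompactOperator T := by
  rw [isCompactOperator_iff_exists_mem_nhds_isCompact_closure_image]
  refine ⟨Metric.ball 0 1, Metric.ball_mem_nhds _ one_pos, ?_⟩
  set A : Set C(Icc a b, ℝ) := T '' Metric.ball 0 1 with hA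
  let e' : C(Icc a b, ℝ) ≃ᵢ BoundedContinuousFunction (Icc a b) ℝ :=
    ContinuousMap.isometryEquivBoundedOfCompact (Icc a b) ℝ
  have hcomp : IsCompact (closure (e' '' A)) := by
    refine BoundedContinuousFunction.arzela_ascoli (Metric.closedBall (0 : ℝ) ‖T‖)
      (isCompact_closedBall _ _) _ ?_ ?_
    · rintro _ x ⟨_, ⟨g, hg, rfl⟩, rfl⟩
      rw [mem_closedBall_zero_iff]
      have h1 : ‖(T g) x‖ ≤ ‖T g‖ := (T g).norm_coe_le_norm x
      have h2 : ‖g‖ ≤ 1 := by simpa using (mem_ball_zero_iff.1 hg).le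
      exact h1.trans ((T.le_opNorm g).trans (mul_le_of_le_one_right (norm_nonneg _) h2))
    · refine Metric.equicontinuous_of_continuity_modulus (fun t => |C| * t) ?_ _ ?_
      · have : Tendsto (fun t : ℝ => |C| * t) (𝓝 0) (𝓝 (|C| * 0)) :=
          (continuous_const.mul continuous_id).tendsto 0
        simpa using this
      · rintro x y ⟨_, ⟨_, ⟨g, hg, rfl⟩, rfl⟩⟩
        have h2 : ‖g‖ ≤ 1 := by simpa using (mem_ball_zero_iff.1 hg).le
        have h3 := hT g x y
        rw [Subtype.dist_eq, Real.dist_eq]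
        change dist (T g x) (T g y) ≤ _
        rw [Real.dist_eq]
        refine h3.trans (mul_le_mul_of_nonneg_right ?_ (abs_nonneg _))
        calc C * ‖g‖ ≤ |C| * ‖g‖ := mul_le_mul_of_nonneg_right (le_abs_self C) (norm_nonneg _)
          _ ≤ |C| := mul_le_of_le_one_right (abs_nonneg _) h2
  have h := e'.toHomeomorph.image_closure A
  change e' '' closure A = closure (e' '' A) at h
  rw [← h] at hcomp
  exact e'.toHomeomorph.isInducing.isCompact_iff.2 hcomp

/-! ### Weighted means along segments from a pole -/

/-- The mean `∫₀¹ uᵐ g(p + u (r - p)) du`. Up to the factor `(r - p) ^ (m + 1)` it is the integral of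
`(s - p) ^ m * g s` over the segment from `p` to `r`; dividing by that factor costs no
regularity at `r = p`. -/
noncomputable def radialMean (m : ℕ) (p : ℝ) (g : ℝ → ℝ) (r : ℝ) : ℝ :=
  ∫ u in (0 : ℝ)..1, u ^ m * g (p + u * (r - p))

theorem pow_mul_radialMean (m : ℕ) (p : ℝ) (g : ℝ → ℝ) (r : ℝ) :
    (r - p) ^ (m + 1) * radialMean m p g r = ∫ s in p..r, (s - p) ^ m * g s := by
  have h := intervalIntegral.mul_integral_comp_add_mul (a := 0) (b := 1)
    (f := fun s => (s - p) ^ m * g s) (r - p) p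
  simp only [mul_zero, add_zero, mul_one, add_sub_cancel, add_sub_cancel_left] at h
  rw [← h, radialMean, pow_succ', mul_assoc, ← intervalIntegral.integral_const_mul]
  congr 1
  refine intervalIntegral.integral_congr fun u _ => ?_
  simp only [mul_comm u (r - p), mul_pow]
  ring

theorem radialMean_self (m : ℕ) (p : ℝ) (g : ℝ → ℝ) : radialMean m p g p = g p / (m + 1) := by
  simp [radialMean, integral_pow]
  ring

theorem mem_uIcc_of_unit {p r u : ℝ} (hu : u ∈ Icc (0 : ℝ) 1) :
    p + u * (r - p) ∈ uIcc p r := by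
  have := (convex_uIcc p r).add_smul_sub_mem left_mem_uIcc right_mem_uIcc hu
  simpa using this

theorem abs_radialMean_le {m : ℕ} {p r : ℝ} {g : ℝ → ℝ} {M : ℝ}
    (h : ∀ s ∈ uIcc p r, |g s| ≤ M) : |radialMean m p g r| ≤ M := by
  have := intervalIntegral.norm_integral_le_of_norm_le_const (a := (0 : ℝ)) (b := 1)
    (f := fun u => u ^ m * g (p + u * (r - p))) (C := M) (fun u hu => by
      rw [uIoc_of_le zero_le_one] at hu
      have hu' : u ∈ Icc (0 : ℝ) 1 := ⟨hu.1.le, hu.2⟩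
      rw [norm_mul, norm_pow, Real.norm_eq_abs, Real.norm_eq_abs, abs_of_nonneg hu'.1]
      calc u ^ m * |g (p + u * (r - p))| ≤ 1 * |g (p + u * (r - p))| :=
            mul_le_mul_of_nonneg_right (pow_le_one₀ hu'.1 hu'.2) (abs_nonneg _)
        _ ≤ M := by rw [one_mul]; exact h _ (mem_uIcc_of_unit hu'))
  simpa [radialMean] using this

theorem radialMean_congr {m : ℕ} {p r : ℝ} {g g' : ℝ → ℝ} (h : ∀ s ∈ uIcc p r, g s = g' s) :
    radialMean m p g r = radialMean m p g' r := by
  refine intervalIntegral.integral_congr fun u hu => ?_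
  rw [uIcc_of_le zero_le_one] at hu
  simp only [h _ (mem_uIcc_of_unit hu)]

theorem radialMean_linear {m : ℕ} {p r : ℝ} {g g' : ℝ → ℝ} (hg : Continuous g)
    (hg' : Continuous g') (c : ℝ) :
    radialMean m p (fun s => c * g s + g' s) r = c * radialMean m p g r + radialMean m p g' r := by
  unfold radialMean
  rw [← intervalIntegral.integral_const_mul, ← intervalIntegral.integral_add]
  · exact intervalIntegral.integral_congr fun u _ => by ring
  · exact Continuous.intervalIntegrable (by fun_prop) _ _
  · exact Continuous.intervalIntegrable (by fun_prop) _ _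

/-- A compact interval in an open one, around a given pair of points. -/
theorem exists_Icc_subset_Ioo {a b p r : ℝ} (hp : p ∈ Ioo a b) (hr : r ∈ Ioo a b) :
    ∃ c d, Icc c d ⊆ Ioo a b ∧ p ∈ Ioo c d ∧ r ∈ Ioo c d := by
  refine ⟨(a + min p r) / 2, (max p r + b) / 2, ?_, ?_, ?_⟩
  · intro s hs
    have h1 : a < min p r := lt_min hp.1 hr.1
    have h2 : max p r < b := max_lt hp.2 hr.2
    exact ⟨by linarith [hs.1], by linarith [hs.2]⟩
  all_goals
    have h1 : a < min p r := lt_min hp.1 hr.1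
    have h2 : max p r < b := max_lt hp.2 hr.2
    constructor
    · linarith [min_le_left p r, min_le_right p r]
    · linarith [le_max_left p r, le_max_right p r]

theorem continuousOn_radialMean {m : ℕ} {p a b : ℝ} (hp : p ∈ Ioo a b) {g : ℝ → ℝ}
    (hg : ContinuousOn g (Ioo a b)) : ContinuousOn (radialMean m p g) (Ioo a b) := by
  intro r hr
  obtain ⟨c, d, hcd, hpc, hrc⟩ := exists_Icc_subset_Ioo hp hr
  have hle : c ≤ d := (hpc.1.trans hpc.2).le
  set g' : ℝ → ℝ := IccExtend hle ((Icc c d).domRestrict g) with hg'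
  have hg'c : Continuous g' := (hg.mono hcd).domRestrict.Icc_extend'
  have h1 : Continuous (radialMean m p g') := by
    unfold radialMean
    fun_prop
  have h2 : radialMean m p g =ᶠ[𝓝 r] radialMean m p g' := by
    filter_upwards [Ioo_mem_nhds hrc.1 hrc.2] with t ht
    refine radialMean_congr fun s hs => ?_
    have hsc : s ∈ Icc c d :=
      (uIcc_subset_Icc (Ioo_subset_Icc_self hpc) (Ioo_subset_Icc_self ht)) hs
    rw [hg', IccExtend_of_mem _ _ hsc]
    rfl
  exact (h1.continuousAt.congr h2.symm).continuousWithinAt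

theorem hasDerivAt_radialMean {m : ℕ} {p a b r : ℝ} (hp : p ∈ Ioo a b) (hr : r ∈ Ioo a b)
    {g g' : ℝ → ℝ} (hg : ∀ s ∈ Ioo a b, HasDerivAt g (g' s) s)
    (hg' : ContinuousOn g' (Ioo a b)) :
    HasDerivAt (radialMean m p g) (radialMean (m + 1) p g' r) r := by
  obtain ⟨c, d, hcd, hpc, hrc⟩ := exists_Icc_subset_Ioo hp hr
  obtain ⟨M, hM⟩ := isCompact_Icc.exists_bound_of_continuousOn (hg'.mono hcd)
  have hseg : ∀ t ∈ Ioo c d, ∀ u ∈ Icc (0 : ℝ) 1, p + u * (t - p) ∈ Icc c d := fun t ht u hu =>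
    (uIcc_subset_Icc (Ioo_subset_Icc_self hpc) (Ioo_subset_Icc_self ht)) (mem_uIcc_of_unit hu)
  have hcont : ∀ {φ : ℝ → ℝ} (n : ℕ), ContinuousOn φ (Ioo a b) → ∀ t ∈ Ioo c d,
      ContinuousOn (fun u => u ^ n * φ (p + u * (t - p))) (Icc 0 1) := by
    intro φ n hφ t ht
    refine (by fun_prop : ContinuousOn (fun u : ℝ => u ^ n) _).mul
      (hφ.comp (by fun_prop) fun u hu => hcd (hseg t ht u hu))
  have hgc : ContinuousOn g (Ioo a b) := fun s hs => (hg s hs).continuousAt.continuousWithinAt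
  have hM0 : 0 ≤ M := (norm_nonneg _).trans (hM r (Ioo_subset_Icc_self hrc))
  refine (intervalIntegral.hasDerivAt_integral_of_dominated_loc_of_deriv_le
    (F := fun t u => u ^ m * g (p + u * (t - p)))
    (F' := fun t u => u ^ (m + 1) * g' (p + u * (t - p)))
    (bound := fun _ => M) (s := Ioo c d) (Ioo_mem_nhds hrc.1 hrc.2) ?_ ?_ ?_ ?_ ?_ ?_).2
  · filter_upwards [Ioo_mem_nhds hrc.1 hrc.2] with t ht
    rw [uIoc_of_le zero_le_one]
    exact ((hcont m hgc t ht).mono Ioc_subset_Icc_self).aestronglyMeasurable measurableSet_Ioc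
  · refine ContinuousOn.intervalIntegrable ?_
    rw [uIcc_of_le zero_le_one]
    exact hcont m hgc r hrc
  · rw [uIoc_of_le zero_le_one]
    exact ((hcont (m + 1) hg' r hrc).mono Ioc_subset_Icc_self).aestronglyMeasurable
      measurableSet_Ioc
  · refine Eventually.of_forall fun u hu t ht => ?_
    rw [uIoc_of_le zero_le_one] at hu
    have hu' : u ∈ Icc (0 : ℝ) 1 := ⟨hu.1.le, hu.2⟩
    rw [norm_mul, norm_pow, Real.norm_of_nonneg hu'.1]
    calc u ^ (m + 1) * ‖g' (p + u * (t - p))‖ ≤ 1 * M :=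
          mul_le_mul (pow_le_one₀ hu'.1 hu'.2) (hM _ (hseg t ht u hu')) (norm_nonneg _) zero_le_one
      _ = M := one_mul M
  · exact intervalIntegrable_const
  · refine Eventually.of_forall fun u hu t ht => ?_
    rw [uIoc_of_le zero_le_one] at hu
    have hu' : u ∈ Icc (0 : ℝ) 1 := ⟨hu.1.le, hu.2⟩
    have h1 : HasDerivAt (fun t => p + u * (t - p)) u t := by
      simpa using (((hasDerivAt_id t).sub_const p).const_mul u).const_add p
    have h2 := ((hg _ (hcd (hseg t ht u hu'))).comp t h1).const_mul (u ^ m)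
    refine h2.congr_deriv ?_
    ring

theorem contDiffOn_radialMean {p a b : ℝ} (hp : p ∈ Ioo a b) (k : ℕ) :
    ∀ {m : ℕ} {g : ℝ → ℝ}, ContDiffOn ℝ k g (Ioo a b) →
      ContDiffOn ℝ k (radialMean m p g) (Ioo a b) := by
  induction k with
  | zero =>
    intro m g hg
    rw [Nat.cast_zero, contDiffOn_zero] at hg ⊢
    exact continuousOn_radialMean hp hg
  | succ k ih =>
    intro m g hg
    rw [Nat.cast_succ, contDiffOn_succ_iff_deriv_of_isOpen isOpen_Ioo] at hg ⊢
    have hd : ∀ s ∈ Ioo a b, HasDerivAt g (deriv g s) s := fun s hs =>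
      (hg.1.differentiableAt (isOpen_Ioo.mem_nhds hs)).hasDerivAt
    have hd' : ∀ r ∈ Ioo a b, HasDerivAt (radialMean m p g) (radialMean (m + 1) p (deriv g) r) r :=
      fun r hr => hasDerivAt_radialMean hp hr hd hg.2.2.continuousOn
    refine ⟨fun r hr => (hd' r hr).differentiableAt.differentiableWithinAt, by simp, ?_⟩
    exact (ih hg.2.2).congr fun r hr => (hd' r hr).deriv

theorem contDiff_radialMean {m : ℕ} {p : ℝ} {g : ℝ → ℝ} (hg : ContDiff ℝ ∞ g) :
    ContDiff ℝ ∞ (radialMean m p g) := by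
  rw [contDiff_infty]
  intro k
  rw [contDiff_iff_contDiffAt]
  intro r
  have hp : p ∈ Ioo (min p r - 1) (max p r + 1) :=
    ⟨by linarith [min_le_left p r], by linarith [le_max_left p r]⟩
  have hr : r ∈ Ioo (min p r - 1) (max p r + 1) :=
    ⟨by linarith [min_le_right p r], by linarith [le_max_right p r]⟩
  exact (contDiffOn_radialMean hp k (hg.of_le (by exact_mod_cast le_top)).contDiffOn).contDiffAt
    (isOpen_Ioo.mem_nhds hr)

/-! ### The singular Sturm-Liouville operator -/

/-- Coefficients of the operator `G ↦ (ρ Fᵐ)⁻¹ (Fᵐ⁺¹ ρ⁻¹ G')'`: smooth functions on the line, where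
`ρ > 0`, and `F` has simple zeros at `-1` and `1`, is positive between them and has no others. For a
surface of revolution with profile `f`, the function `F` is `f²` on `[-1, 1]`, continued across the
poles, and `ρ dr dθ` is the area element. -/
structure PolarWeight where
  /-- the squared distance to the axis -/
  F : ℝ → ℝ
  /-- the area density -/
  ρ : ℝ → ℝ
  contDiff_F : ContDiff ℝ ∞ F
  contDiff_ρ : ContDiff ℝ ∞ ρ
  ρ_pos : ∀ r, 0 < ρ r
  F_pos : ∀ r ∈ Ioo (-1 : ℝ) 1, 0 < F r
  F_eq_zero : ∀ r, F r = 0 ↔ r = -1 ∨ r = 1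
  deriv_ne_zero : ∀ r, F r = 0 → deriv F r ≠ 0

namespace PolarWeight

variable (w : PolarWeight) (m : ℕ)

theorem F_neg_one : w.F (-1) = 0 := (w.F_eq_zero _).2 (Or.inl rfl)

theorem F_one : w.F 1 = 0 := (w.F_eq_zero _).2 (Or.inr rfl)

/-- The quotient `F r / (r - p)`, smooth at `r = p` when `F p = 0`. -/
noncomputable def quot (p : ℝ) : ℝ → ℝ := radialMean 0 p (deriv w.F)

theorem contDiff_deriv_F : ContDiff ℝ ∞ (deriv w.F) :=
  (contDiff_infty_iff_deriv.1 w.contDiff_F).2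

theorem contDiff_quot (p : ℝ) : ContDiff ℝ ∞ (w.quot p) := contDiff_radialMean w.contDiff_deriv_F

theorem hasDerivAt_F (r : ℝ) : HasDerivAt w.F (deriv w.F r) r :=
  (w.contDiff_F.differentiable (by simp)).differentiableAt.hasDerivAt

theorem F_eq_mul_quot {p : ℝ} (hp : w.F p = 0) (r : ℝ) : w.F r = (r - p) * w.quot p r := by
  have h := pow_mul_radialMean 0 p (deriv w.F) r
  simp only [zero_add, pow_one, pow_zero, one_mul] at h
  rw [quot, h, intervalIntegral.integral_eq_sub_of_hasDerivAt (fun x _ => w.hasDerivAt_F x)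
    (w.contDiff_deriv_F.continuous.intervalIntegrable _ _), hp, sub_zero]

theorem quot_ne_zero {p : ℝ} (hp : w.F p = 0) {r : ℝ} (hr : r ≠ -p) : w.quot p r ≠ 0 := by
  rcases eq_or_ne r p with rfl | h
  · rw [quot, radialMean_self]
    simpa using w.deriv_ne_zero r hp
  · intro h0
    have h1 : w.F r = 0 := by rw [w.F_eq_mul_quot hp, h0, mul_zero]
    rcases (w.F_eq_zero p).1 hp with rfl | rfl <;> rcases (w.F_eq_zero r).1 h1 with rfl | rfl <;>
      simp at hr h

/-- The function `ρ F⁻ᵐ⁻¹ ∫ₚ ρ Fᵐ g`, without a singularity at the pole `p`: the derivative of the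
solution, regular at `p`, of `(ρ Fᵐ)⁻¹ (Fᵐ⁺¹ ρ⁻¹ G')' = g`. -/
noncomputable def slope (p : ℝ) (g : ℝ → ℝ) (r : ℝ) : ℝ :=
  w.ρ r / w.quot p r ^ (m + 1) * radialMean m p (fun s => w.ρ s * w.quot p s ^ m * g s) r

theorem pow_mul_slope {p : ℝ} (hp : w.F p = 0) {r : ℝ} (hr : r ≠ -p) (g : ℝ → ℝ) :
    w.F r ^ (m + 1) * w.slope m p g r = w.ρ r * ∫ s in p..r, w.ρ s * w.F s ^ m * g s := by
  have h := pow_mul_radialMean m p (fun s => w.ρ s * w.quot p s ^ m * g s) r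
  have h2 : ∫ s in p..r, (s - p) ^ m * (w.ρ s * w.quot p s ^ m * g s) =
      ∫ s in p..r, w.ρ s * w.F s ^ m * g s := by
    refine intervalIntegral.integral_congr fun s _ => ?_
    simp only [w.F_eq_mul_quot hp s, mul_pow]
    ring
  have hq := w.quot_ne_zero hp hr
  rw [← h2, ← h, slope, w.F_eq_mul_quot hp r, mul_pow]
  field_simp

theorem continuousOn_slope {p : ℝ} (hp : w.F p = 0) {g : ℝ → ℝ} (hg : Continuous g) :
    ContinuousOn (w.slope m p g) {r | r ≠ -p} := by
  have h1 : Continuous (radialMean m p (fun s => w.ρ s * w.quot p s ^ m * g s)) := by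
    have := w.contDiff_ρ.continuous
    have := (w.contDiff_quot p).continuous
    unfold radialMean
    fun_prop
  refine ContinuousOn.mul (ContinuousOn.div w.contDiff_ρ.continuous.continuousOn
    ((w.contDiff_quot p).continuous.pow _).continuousOn fun r hr => ?_) h1.continuousOn
  exact pow_ne_zero _ (w.quot_ne_zero hp hr)

theorem slope_linear {p : ℝ} {g g' : ℝ → ℝ} (hg : Continuous g) (hg' : Continuous g') (c r : ℝ) :
    w.slope m p (fun s => c * g s + g' s) r = c * w.slope m p g r + w.slope m p g' r := by
  have := w.contDiff_ρ.continuous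
  have := (w.contDiff_quot p).continuous
  have h := radialMean_linear (m := m) (p := p) (r := r)
    (g := fun s => w.ρ s * w.quot p s ^ m * g s) (g' := fun s => w.ρ s * w.quot p s ^ m * g' s)
    (by fun_prop) (by fun_prop) c
  have h2 : (fun s => w.ρ s * w.quot p s ^ m * (c * g s + g' s)) =
      fun s => c * (w.ρ s * w.quot p s ^ m * g s) + w.ρ s * w.quot p s ^ m * g' s := by
    ext s; ring
  rw [slope, h2, h, slope, slope]
  ring

theorem exists_abs_slope_le {p : ℝ} (hp : w.F p = 0) {c d : ℝ} (hpc : p ∈ Icc c d)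
    (hn : -p ∉ Icc c d) : ∃ C, 0 ≤ C ∧ ∀ (g : ℝ → ℝ) (M : ℝ), ∀ r ∈ Icc c d,
      (∀ s ∈ uIcc p r, |g s| ≤ M) → |w.slope m p g r| ≤ C * M := by
  have hρ := w.contDiff_ρ.continuous
  have hq := (w.contDiff_quot p).continuous
  have hc1 : ContinuousOn (fun r => w.ρ r / w.quot p r ^ (m + 1)) (Icc c d) :=
    hρ.continuousOn.div (hq.pow _).continuousOn fun r hr =>
      pow_ne_zero _ (w.quot_ne_zero hp fun h => hn (h ▸ hr))
  obtain ⟨C₁, hC₁⟩ := isCompact_Icc.exists_bound_of_continuousOn hc1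
  obtain ⟨C₂, hC₂⟩ := (isCompact_Icc (a := c) (b := d)).exists_bound_of_continuousOn
    (f := fun s => w.ρ s * w.quot p s ^ m) (by fun_prop)
  have h1 : 0 ≤ C₁ := (norm_nonneg _).trans (hC₁ p hpc)
  have h2 : 0 ≤ C₂ := (norm_nonneg _).trans (hC₂ p hpc)
  refine ⟨C₁ * C₂, by positivity, fun g M r hr hM => ?_⟩
  have h3 : |radialMean m p (fun s => w.ρ s * w.quot p s ^ m * g s) r| ≤ C₂ * M := by
    refine abs_radialMean_le fun s hs => ?_
    rw [abs_mul]
    exact mul_le_mul (hC₂ s (uIcc_subset_Icc hpc hr hs)) (hM s hs) (abs_nonneg _) h2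
  rw [slope, abs_mul, mul_assoc]
  exact mul_le_mul (hC₁ r hr) h3 (abs_nonneg _) h1

/-- The integral of `g` with respect to the weight `ρ Fᵐ` on `[-1, 1]`. -/
noncomputable def total (g : ℝ → ℝ) : ℝ := ∫ s in (-1 : ℝ)..1, w.ρ s * w.F s ^ m * g s

/-- The primitive, zero at `0`, of the slope regular at `-1` on the left of `0`, and of the slope
regular at `1` on the right. -/
noncomputable def prim (g : ℝ → ℝ) (r : ℝ) : ℝ :=
  (∫ s in (0 : ℝ)..min r 0, w.slope m (-1) g s) + ∫ s in (0 : ℝ)..max r 0, w.slope m 1 g s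

theorem prim_zero (g : ℝ → ℝ) : w.prim m g 0 = 0 := by simp [prim]

theorem continuous_weight : Continuous fun s => w.ρ s * w.F s ^ m := by
  have := w.contDiff_ρ.continuous
  have := w.contDiff_F.continuous
  fun_prop

theorem slope_eq_slope {g : ℝ → ℝ} (hg : Continuous g) (h0 : w.total m g = 0) {r : ℝ}
    (h1 : r ≠ 1) (h2 : r ≠ -1) : w.slope m (-1) g r = w.slope m 1 g r := by
  have hF : w.F r ≠ 0 := by
    rw [Ne, w.F_eq_zero]; tauto
  have e1 := w.pow_mul_slope m w.F_neg_one (r := r) (by simpa using h1) g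
  have e2 := w.pow_mul_slope m w.F_one (r := r) (by simpa using h2) g
  have hi : ∀ a b, IntervalIntegrable (fun s => w.ρ s * w.F s ^ m * g s) MeasureTheory.volume a b :=
    fun a b => ((w.continuous_weight m).mul hg).intervalIntegrable a b
  have e3 := intervalIntegral.integral_add_adjacent_intervals (hi (-1) 1) (hi 1 r)
  have e4 : (∫ s in (-1 : ℝ)..1, w.ρ s * w.F s ^ m * g s) = 0 := h0
  rw [e4, zero_add] at e3
  rw [← e3, ← e2] at e1
  exact mul_left_cancel₀ (pow_ne_zero _ hF) e1

theorem intervalIntegrable_slope_left {g : ℝ → ℝ} (hg : Continuous g) {a b : ℝ} (ha : a < 1)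
    (hb : b < 1) : IntervalIntegrable (w.slope m (-1) g) MeasureTheory.volume a b := by
  refine ((w.continuousOn_slope m w.F_neg_one hg).mono fun r hr => ?_).intervalIntegrable
  have := hr.2.trans_lt (max_lt ha hb)
  simpa using this.ne

theorem intervalIntegrable_slope_right {g : ℝ → ℝ} (hg : Continuous g) {a b : ℝ} (ha : -1 < a)
    (hb : -1 < b) : IntervalIntegrable (w.slope m 1 g) MeasureTheory.volume a b := by
  refine ((w.continuousOn_slope m w.F_one hg).mono fun r hr => ?_).intervalIntegrable
  exact ((lt_min ha hb).trans_le hr.1).ne'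

theorem prim_eq_left {g : ℝ → ℝ} (hg : Continuous g) (h0 : w.total m g = 0) {r : ℝ} (hr : r < 1) :
    w.prim m g r = ∫ s in (0 : ℝ)..r, w.slope m (-1) g s := by
  rcases le_total r 0 with h | h
  · simp [prim, h]
  · simp only [prim, h, min_eq_right, max_eq_left, intervalIntegral.integral_same, zero_add]
    refine intervalIntegral.integral_congr fun s hs => ?_
    rw [uIcc_of_le h] at hs
    exact (w.slope_eq_slope m hg h0 (by linarith [hs.2]) (by linarith [hs.1])).symm

theorem prim_eq_right {g : ℝ → ℝ} (hg : Continuous g) (h0 : w.total m g = 0) {r : ℝ}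
    (hr : -1 < r) : w.prim m g r = ∫ s in (0 : ℝ)..r, w.slope m 1 g s := by
  rcases le_total 0 r with h | h
  · simp [prim, h]
  · simp only [prim, h, min_eq_left, max_eq_right, intervalIntegral.integral_same, add_zero]
    refine intervalIntegral.integral_congr fun s hs => ?_
    rw [uIcc_of_ge h] at hs
    exact w.slope_eq_slope m hg h0 (by linarith [hs.2]) (by linarith [hs.1])

theorem hasDerivAt_prim_left {g : ℝ → ℝ} (hg : Continuous g) (h0 : w.total m g = 0) {r : ℝ}
    (hr : r < 1) : HasDerivAt (w.prim m g) (w.slope m (-1) g r) r := by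
  have hc : ContinuousOn (w.slope m (-1) g) (Iio 1) :=
    (w.continuousOn_slope m w.F_neg_one hg).mono fun s hs => by
      simpa using (show s < 1 from hs).ne
  have h := intervalIntegral.integral_hasDerivAt_right
    (w.intervalIntegrable_slope_left m hg zero_lt_one hr)
    (hc.stronglyMeasurableAtFilter isOpen_Iio r hr) (hc.continuousAt (Iio_mem_nhds hr))
  refine h.congr_of_eventuallyEq ?_
  filter_upwards [Iio_mem_nhds hr] with t ht using w.prim_eq_left m hg h0 ht

theorem hasDerivAt_prim_right {g : ℝ → ℝ} (hg : Continuous g) (h0 : w.total m g = 0) {r : ℝ}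
    (hr : -1 < r) : HasDerivAt (w.prim m g) (w.slope m 1 g r) r := by
  have hc : ContinuousOn (w.slope m 1 g) (Ioi (-1)) :=
    (w.continuousOn_slope m w.F_one hg).mono fun s hs => (show -1 < s from hs).ne'
  have h := intervalIntegral.integral_hasDerivAt_right
    (w.intervalIntegrable_slope_right m hg (by norm_num : (-1 : ℝ) < 0) hr)
    (hc.stronglyMeasurableAtFilter isOpen_Ioi r hr) (hc.continuousAt (Ioi_mem_nhds hr))
  refine h.congr_of_eventuallyEq ?_
  filter_upwards [Ioi_mem_nhds hr] with t ht using w.prim_eq_right m hg h0 ht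

theorem prim_linear {g g' : ℝ → ℝ} (hg : Continuous g) (hg' : Continuous g') (c r : ℝ) :
    w.prim m (fun s => c * g s + g' s) r = c * w.prim m g r + w.prim m g' r := by
  have h1 : ∀ g, Continuous g → IntervalIntegrable (w.slope m (-1) g) MeasureTheory.volume 0
      (min r 0) := fun g hg => w.intervalIntegrable_slope_left m hg zero_lt_one
    ((min_le_right _ _).trans_lt zero_lt_one)
  have h2 : ∀ g, Continuous g → IntervalIntegrable (w.slope m 1 g) MeasureTheory.volume 0
      (max r 0) := fun g hg => w.intervalIntegrable_slope_right m hg (by norm_num)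
    (lt_of_lt_of_le (by norm_num) (le_max_right _ _))
  simp only [prim, w.slope_linear m hg hg' c]
  rw [intervalIntegral.integral_add ((h1 g hg).const_mul c) (h1 g' hg'),
    intervalIntegral.integral_add ((h2 g hg).const_mul c) (h2 g' hg'),
    intervalIntegral.integral_const_mul, intervalIntegral.integral_const_mul]
  ring

theorem total_linear {g g' : ℝ → ℝ} (hg : Continuous g) (hg' : Continuous g') (c : ℝ) :
    w.total m (fun s => c * g s + g' s) = c * w.total m g + w.total m g' := by
  have hi : ∀ g, Continuous g → IntervalIntegrable (fun s => w.ρ s * w.F s ^ m * g s)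
      MeasureTheory.volume (-1) 1 :=
    fun g hg => ((w.continuous_weight m).mul hg).intervalIntegrable _ _
  simp only [total]
  rw [← intervalIntegral.integral_const_mul, ← intervalIntegral.integral_add
    ((hi g hg).const_mul c) (hi g' hg')]
  exact intervalIntegral.integral_congr fun s _ => by ring

theorem exists_abs_prim_sub_le : ∃ C, 0 ≤ C ∧ ∀ g : ℝ → ℝ, Continuous g → ∀ M,
    (∀ s ∈ Icc (-2 : ℝ) 2, |g s| ≤ M) → ∀ x ∈ Icc (-2 : ℝ) 2, ∀ y ∈ Icc (-2 : ℝ) 2,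
      |w.prim m g x - w.prim m g y| ≤ C * M * |x - y| := by
  obtain ⟨C₁, hC₁0, hC₁⟩ := w.exists_abs_slope_le m w.F_neg_one (c := -2) (d := 0)
    (by norm_num) (by norm_num)
  obtain ⟨C₂, hC₂0, hC₂⟩ := w.exists_abs_slope_le m w.F_one (c := 0) (d := 2)
    (by norm_num) (by norm_num)
  refine ⟨max C₁ C₂, le_max_of_le_left hC₁0, fun g hg M hM x hx y hy => ?_⟩
  have hM0 : 0 ≤ M := (abs_nonneg _).trans (hM 0 (by norm_num))
  have i1 : ∀ x, IntervalIntegrable (w.slope m (-1) g) MeasureTheory.volume 0 (min x 0) := fun x =>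
    w.intervalIntegrable_slope_left m hg zero_lt_one ((min_le_right _ _).trans_lt zero_lt_one)
  have i2 : ∀ x, IntervalIntegrable (w.slope m 1 g) MeasureTheory.volume 0 (max x 0) := fun x =>
    w.intervalIntegrable_slope_right m hg (by norm_num)
      (lt_of_lt_of_le (by norm_num) (le_max_right _ _))
  have e : w.prim m g x - w.prim m g y = (∫ s in min y 0..min x 0, w.slope m (-1) g s) +
      ∫ s in max y 0..max x 0, w.slope m 1 g s := by
    rw [← intervalIntegral.integral_interval_sub_left (i1 x) (i1 y),
      ← intervalIntegral.integral_interval_sub_left (i2 x) (i2 y)]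
    simp only [prim]
    ring
  have b1 : |∫ s in min y 0..min x 0, w.slope m (-1) g s| ≤
      max C₁ C₂ * M * |min x 0 - min y 0| := by
    rw [← Real.norm_eq_abs]
    refine intervalIntegral.norm_integral_le_of_norm_le_const fun s hs => ?_
    have hs' : s ∈ Icc (-2 : ℝ) 0 := uIcc_subset_Icc
      ⟨le_min hy.1 (by norm_num), min_le_right _ _⟩ ⟨le_min hx.1 (by norm_num), min_le_right _ _⟩
      (uIoc_subset_uIcc hs)
    refine (hC₁ g M s hs' fun t ht => hM t ?_).trans
      (mul_le_mul_of_nonneg_right (le_max_left _ _) hM0)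
    exact uIcc_subset_Icc (by norm_num) ⟨hs'.1, hs'.2.trans (by norm_num)⟩ ht
  have b2 : |∫ s in max y 0..max x 0, w.slope m 1 g s| ≤
      max C₁ C₂ * M * |max x 0 - max y 0| := by
    rw [← Real.norm_eq_abs]
    refine intervalIntegral.norm_integral_le_of_norm_le_const fun s hs => ?_
    have hs' : s ∈ Icc (0 : ℝ) 2 := uIcc_subset_Icc
      ⟨le_max_right _ _, max_le hy.2 (by norm_num)⟩ ⟨le_max_right _ _, max_le hx.2 (by norm_num)⟩
      (uIoc_subset_uIcc hs)
    refine (hC₂ g M s hs' fun t ht => hM t ?_).trans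
      (mul_le_mul_of_nonneg_right (le_max_right _ _) hM0)
    exact uIcc_subset_Icc (by norm_num) ⟨(by norm_num : (-2 : ℝ) ≤ 0).trans hs'.1, hs'.2⟩ ht
  have b3 : |min x 0 - min y 0| + |max x 0 - max y 0| = |x - y| := by
    rcases le_total x 0 with h | h <;> rcases le_total y 0 with h' | h' <;> simp [h, h']
    · rw [abs_of_nonpos h, abs_of_nonneg h', abs_of_nonpos (by linarith)]; ring
    · rw [abs_of_nonneg h, abs_of_nonpos h', abs_of_nonneg (by linarith)]; ring
  calc |w.prim m g x - w.prim m g y| ≤ _ + _ := by rw [e]; exact abs_add_le _ _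
    _ ≤ _ + _ := add_le_add b1 b2
    _ = max C₁ C₂ * M * |x - y| := by rw [← mul_add, b3]

end PolarWeight

/-- A differentiable function which is zero at `0`, and whose derivative is at each time bounded by
a multiple of the maximum of the function so far, vanishes: iterating the bound gives
`|ξ t| ≤ S (C t)ⁿ / n!` for all `n`. -/
theorem eq_zero_of_abs_deriv_le {ξ ξ' : ℝ → ℝ} {C T : ℝ} (hC : 0 ≤ C) (h0 : ξ 0 = 0)
    (hd : ∀ t ∈ Icc 0 T, HasDerivAt ξ (ξ' t) t)
    (hb : ∀ t ∈ Icc 0 T, ∀ M, (∀ s ∈ Icc 0 t, |ξ s| ≤ M) → |ξ' t| ≤ C * M) :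
    ∀ t ∈ Icc 0 T, ξ t = 0 := by
  have hcont : ContinuousOn ξ (Icc 0 T) := fun t ht => (hd t ht).continuousAt.continuousWithinAt
  obtain ⟨S, hS⟩ := isCompact_Icc.exists_bound_of_continuousOn hcont
  intro t ht
  have hS0 : 0 ≤ S := (norm_nonneg _).trans (hS t ht)
  have key : ∀ n : ℕ, ∀ s ∈ Icc 0 T, |ξ s| ≤ S * ((C * s) ^ n / n.factorial) := by
    intro n
    induction n with
    | zero => simpa using hS
    | succ n ih =>
      have hB : ∀ x : ℝ, HasDerivAt (fun s : ℝ => S * ((C * s) ^ (n + 1) / (n + 1).factorial))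
          (C * (S * ((C * x) ^ n / n.factorial))) x := by
        intro x
        have h1 : HasDerivAt (fun s : ℝ => (C * s) ^ (n + 1))
            ((n + 1 : ℕ) * (C * x) ^ n * C) x := by
          simpa using HasDerivAt.fun_pow ((hasDerivAt_id x).const_mul C) (n + 1)
        refine ((h1.div_const _).const_mul S).congr_deriv ?_
        rw [Nat.factorial_succ]
        push_cast
        field_simp
      intro s hs
      exact image_norm_le_of_norm_deriv_right_le_deriv_boundary (f := ξ) (f' := ξ') hcont
        (fun x hx => (hd x (Ico_subset_Icc_self hx)).hasDerivWithinAt) (by simp [h0]) hB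
        (fun x hx => hb x (Ico_subset_Icc_self hx) _ fun u hu =>
          (ih u ⟨hu.1, hu.2.trans hx.2.le⟩).trans (by
            have := hu.1
            have := hu.2
            gcongr)) hs
  have hlim : Tendsto (fun n : ℕ => S * ((C * t) ^ n / n.factorial)) atTop (𝓝 0) := by
    simpa using (FloorSemiring.tendsto_pow_div_factorial_atTop (C * t)).const_mul S
  have : |ξ t| ≤ 0 := ge_of_tendsto' hlim fun n => key n t ht
  exact abs_nonpos_iff.1 this

namespace PolarWeight

variable (w : PolarWeight) (m : ℕ)

/-! ### Regular solutions -/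

/-- The derivative of `prim`, for a function of total `0`: the slopes regular at the two poles agree
between the poles. -/
noncomputable def dprim (g : ℝ → ℝ) (r : ℝ) : ℝ :=
  if r ≤ 0 then w.slope m (-1) g r else w.slope m 1 g r

theorem dprim_eq_left {g : ℝ → ℝ} (hg : Continuous g) (h0 : w.total m g = 0) {r : ℝ} (hr : r < 1) :
    w.dprim m g r = w.slope m (-1) g r := by
  unfold dprim
  split_ifs with h
  · rfl
  · exact (w.slope_eq_slope m hg h0 hr.ne (by linarith)).symm

theorem dprim_eq_right {g : ℝ → ℝ} (hg : Continuous g) (h0 : w.total m g = 0) {r : ℝ}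
    (hr : -1 < r) : w.dprim m g r = w.slope m 1 g r := by
  unfold dprim
  split_ifs with h
  · exact w.slope_eq_slope m hg h0 (by linarith) hr.ne'
  · rfl

theorem hasDerivAt_prim {g : ℝ → ℝ} (hg : Continuous g) (h0 : w.total m g = 0) (r : ℝ) :
    HasDerivAt (w.prim m g) (w.dprim m g r) r := by
  rcases lt_or_ge r 1 with h | h
  · rw [w.dprim_eq_left m hg h0 h]; exact w.hasDerivAt_prim_left m hg h0 h
  · have h' : -1 < r := by linarith
    rw [w.dprim_eq_right m hg h0 h']; exact w.hasDerivAt_prim_right m hg h0 h'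

theorem contDiffOn_dprim {g : ℝ → ℝ} (hg : Continuous g) (h0 : w.total m g = 0) (k : ℕ)
    (hk : ContDiffOn ℝ k g (Ioo (-2) 2)) : ContDiffOn ℝ k (w.dprim m g) (Ioo (-2) 2) := by
  have hs : ∀ p a b, w.F p = 0 → p ∈ Ioo a b → Ioo a b ⊆ Ioo (-2) 2 → (∀ r ∈ Ioo a b, r ≠ -p) →
      ContDiffOn ℝ k (w.slope m p g) (Ioo a b) := by
    intro p a b hp hpab hab hne
    have hk' : ((k : ℕ∞) : WithTop ℕ∞) ≤ ∞ := by exact_mod_cast le_top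
    have h1 := (w.contDiff_ρ.of_le hk').contDiffOn (s := Ioo a b)
    have h2 := ((w.contDiff_quot p).of_le hk').contDiffOn (s := Ioo a b)
    exact (h1.div (h2.pow _) fun r hr => pow_ne_zero _ (w.quot_ne_zero hp (hne r hr))).mul
      (contDiffOn_radialMean hpab k ((h1.mul (h2.pow _)).mul (hk.mono hab)))
  have hl := hs (-1) (-2) 1 w.F_neg_one (by norm_num) (Ioo_subset_Ioo_right (by norm_num))
    fun r hr => by simpa using hr.2.ne
  have hr := hs 1 (-1) 2 w.F_one (by norm_num) (Ioo_subset_Ioo_left (by norm_num))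
    fun r hr => hr.1.ne'
  intro r hr'
  refine ContDiffAt.contDiffWithinAt ?_
  rcases lt_or_ge r 1 with h | h
  · refine (hl.contDiffAt (Ioo_mem_nhds hr'.1 h)).congr_of_eventuallyEq ?_
    filter_upwards [Iio_mem_nhds h] with t ht using w.dprim_eq_left m hg h0 ht
  · have h' : -1 < r := by linarith
    refine (hr.contDiffAt (Ioo_mem_nhds h' hr'.2)).congr_of_eventuallyEq ?_
    filter_upwards [Ioi_mem_nhds h'] with t ht using w.dprim_eq_right m hg h0 ht

theorem continuousOn_dprim {g : ℝ → ℝ} (hg : Continuous g) (h0 : w.total m g = 0) :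
    ContinuousOn (w.dprim m g) (Ioo (-2) 2) :=
  (w.contDiffOn_dprim m hg h0 0 (by
    rw [Nat.cast_zero, contDiffOn_zero]; exact hg.continuousOn)).continuousOn

/-- The integral from the pole `-1` with respect to the weight; it vanishes at both poles when the
total is zero. -/
noncomputable def flux (g : ℝ → ℝ) (r : ℝ) : ℝ := ∫ s in (-1 : ℝ)..r, w.ρ s * w.F s ^ m * g s

theorem hasDerivAt_flux {g : ℝ → ℝ} (hg : Continuous g) (r : ℝ) :
    HasDerivAt (w.flux m g) (w.ρ r * w.F r ^ m * g r) r :=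
  (((w.continuous_weight m).mul hg).integral_hasStrictDerivAt _ _).hasDerivAt

theorem pow_mul_dprim {g : ℝ → ℝ} (hg : Continuous g) (h0 : w.total m g = 0) (r : ℝ) :
    w.F r ^ (m + 1) * w.dprim m g r = w.ρ r * w.flux m g r := by
  rcases lt_or_ge r 1 with h | h
  · rw [w.dprim_eq_left m hg h0 h]
    exact w.pow_mul_slope m w.F_neg_one (by simpa using h.ne) g
  · have h' : -1 < r := by linarith
    have hi : ∀ a b, IntervalIntegrable (fun s => w.ρ s * w.F s ^ m * g s)
        MeasureTheory.volume a b :=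
      fun a b => ((w.continuous_weight m).mul hg).intervalIntegrable a b
    have e3 := intervalIntegral.integral_add_adjacent_intervals (hi (-1) 1) (hi 1 r)
    have e4 : (∫ s in (-1 : ℝ)..1, w.ρ s * w.F s ^ m * g s) = 0 := h0
    rw [e4, zero_add] at e3
    rw [w.dprim_eq_right m hg h0 h', flux, ← e3]
    exact w.pow_mul_slope m w.F_one h'.ne' g

/-- `ξ` is, on `[-2, 2]`, a solution of `(ρ Fᵐ)⁻¹ (Fᵐ⁺¹ ρ⁻¹ ξ')' = g` which is regular at both
poles. -/
structure IsSol (ξ g : ℝ → ℝ) : Prop where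
  continuous : Continuous g
  total_eq : w.total m g = 0
  eq_prim : ∀ r ∈ Icc (-2 : ℝ) 2, ξ r = ξ 0 + w.prim m g r

variable {w m}

theorem IsSol.hasDerivAt {ξ g : ℝ → ℝ} (h : w.IsSol m ξ g) {r : ℝ} (hr : r ∈ Ioo (-2 : ℝ) 2) :
    HasDerivAt ξ (w.dprim m g r) r := by
  refine ((w.hasDerivAt_prim m h.continuous h.total_eq r).const_add (ξ 0)).congr_of_eventuallyEq ?_
  filter_upwards [Ioo_mem_nhds hr.1 hr.2] with t ht using h.eq_prim t (Ioo_subset_Icc_self ht)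

theorem IsSol.hasDerivAt_flux {ξ g : ℝ → ℝ} (h : w.IsSol m ξ g) {r : ℝ}
    (hr : r ∈ Ioo (-2 : ℝ) 2) :
    HasDerivAt (fun s => w.F s ^ (m + 1) / w.ρ s * deriv ξ s) (w.ρ r * w.F r ^ m * g r) r := by
  refine (w.hasDerivAt_flux m h.continuous r).congr_of_eventuallyEq ?_
  filter_upwards [Ioo_mem_nhds hr.1 hr.2] with t ht
  have := w.pow_mul_dprim m h.continuous h.total_eq t
  have hρ := (w.ρ_pos t).ne'
  rw [(h.hasDerivAt ht).deriv, div_mul_eq_mul_div, this]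
  field_simp

theorem IsSol.contDiffOn {ξ g q : ℝ → ℝ} (h : w.IsSol m ξ g) (hq : ContDiff ℝ ∞ q)
    (hg : ∀ r ∈ Ioo (-2 : ℝ) 2, g r = q r * ξ r) : ContDiffOn ℝ ∞ ξ (Ioo (-2) 2) := by
  rw [contDiffOn_infty]
  intro k
  induction k with
  | zero =>
    rw [Nat.cast_zero, contDiffOn_zero]
    exact fun r hr => (h.hasDerivAt hr).continuousAt.continuousWithinAt
  | succ k ih =>
    rw [Nat.cast_succ, contDiffOn_succ_iff_deriv_of_isOpen isOpen_Ioo]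
    refine ⟨fun r hr => (h.hasDerivAt hr).differentiableAt.differentiableWithinAt, by simp, ?_⟩
    have hk' : ((k : ℕ∞) : WithTop ℕ∞) ≤ ∞ := by exact_mod_cast le_top
    exact (w.contDiffOn_dprim m h.continuous h.total_eq k
      (((hq.of_le hk').contDiffOn.mul ih).congr hg)).congr fun r hr => (h.hasDerivAt hr).deriv

/-- The singular Sturm-Liouville operator is symmetric: integrate by parts, the boundary terms
vanish as `F` does at the poles. -/
theorem IsSol.symm {ξ₁ ξ₂ g₁ g₂ : ℝ → ℝ} (h₁ : w.IsSol m ξ₁ g₁) (h₂ : w.IsSol m ξ₂ g₂) :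
    w.total m (fun s => g₁ s * ξ₂ s) = w.total m (fun s => ξ₁ s * g₂ s) := by
  have hsub : uIcc (-1 : ℝ) 1 ⊆ Ioo (-2) 2 := by
    rw [uIcc_of_le (by norm_num)]
    exact fun r hr => ⟨by linarith [hr.1], by linarith [hr.2]⟩
  have hmain : ∀ {ξ ξ' g g' : ℝ → ℝ}, w.IsSol m ξ g → w.IsSol m ξ' g' →
      w.total m (fun s => g s * ξ' s) = -∫ s in (-1 : ℝ)..1, w.flux m g s * w.dprim m g' s := by
    intro ξ ξ' g g' h h'
    have hi := intervalIntegral.integral_deriv_mul_eq_sub (a := -1) (b := 1)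
      (u := w.flux m g) (v := ξ') (u' := fun s => w.ρ s * w.F s ^ m * g s) (v' := w.dprim m g')
      (fun x _ => w.hasDerivAt_flux m h.continuous x) (fun x hx => h'.hasDerivAt (hsub hx))
      (((w.continuous_weight m).mul h.continuous).intervalIntegrable _ _)
      ((w.continuousOn_dprim m h'.continuous h'.total_eq).mono hsub).intervalIntegrable
    have e1 : w.flux m g 1 = 0 := h.total_eq
    have e2 : w.flux m g (-1) = 0 := by simp [flux]
    have hc1 : ContinuousOn ξ' (uIcc (-1) 1) := fun s hs =>
      (h'.hasDerivAt (hsub hs)).continuousAt.continuousWithinAt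
    have hc2 : ContinuousOn (w.flux m g) (uIcc (-1) 1) := fun s _ =>
      (w.hasDerivAt_flux m h.continuous s).continuousAt.continuousWithinAt
    rw [e1, e2, intervalIntegral.integral_add] at hi
    · rw [total]
      simp only [mul_assoc] at hi ⊢
      linarith
    · exact ((((w.continuous_weight m).mul h.continuous).continuousOn).mul hc1).intervalIntegrable
    · exact (hc2.mul ((w.continuousOn_dprim m h'.continuous h'.total_eq).mono
        hsub)).intervalIntegrable
  have e : w.total m (fun s => ξ₁ s * g₂ s) = w.total m (fun s => g₂ s * ξ₁ s) := by
    simp only [mul_comm]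
  rw [e, hmain h₁ h₂, hmain h₂ h₁]
  congr 1
  refine intervalIntegral.integral_congr fun s hs => ?_
  have hz : ∀ {ξ g : ℝ → ℝ}, w.IsSol m ξ g → w.F s = 0 → w.flux m g s = 0 := by
    intro ξ g h hF
    have := w.pow_mul_dprim m h.continuous h.total_eq s
    rw [hF, zero_pow (Nat.succ_ne_zero m), zero_mul, zero_eq_mul] at this
    exact this.resolve_left (w.ρ_pos s).ne'
  by_cases hF : w.F s = 0
  · simp only [hz h₁ hF, hz h₂ hF, zero_mul]
  · have e1 := w.pow_mul_dprim m h₁.continuous h₁.total_eq s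
    have e2 := w.pow_mul_dprim m h₂.continuous h₂.total_eq s
    refine mul_left_cancel₀ (mul_ne_zero (pow_ne_zero (m + 1) hF) (w.ρ_pos s).ne') ?_
    linear_combination w.ρ s * w.flux m g₁ s * e2 - w.ρ s * w.flux m g₂ s * e1

/-- A regular solution of `(ρ Fᵐ)⁻¹ (Fᵐ⁺¹ ρ⁻¹ ξ')' = q ξ` which vanishes between the poles vanishes
beyond them too. -/
theorem IsSol.eq_zero {ξ q : ℝ → ℝ} (hq : Continuous q) (h : w.IsSol m ξ (fun s => q s * ξ s))
    (hξ : ∀ r ∈ Icc (-1 : ℝ) 1, ξ r = 0) : ∀ r ∈ Icc (-2 : ℝ) 2, ξ r = 0 := by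
  obtain ⟨Q, hQ⟩ := isCompact_Icc.exists_bound_of_continuousOn (s := Icc (-2 : ℝ) 2) hq.continuousOn
  have hQ0 : 0 ≤ Q := (norm_nonneg _).trans (hQ 0 (by norm_num))
  set g := fun s => q s * ξ s with hg
  -- the argument at either pole `p`, for the direction `p t`, `t ≥ 0`, away from the other pole
  have main : ∀ p : ℝ, |p| = 1 → ∀ t ∈ Icc (0 : ℝ) 1, ξ (p + p * t) = 0 := by
    intro p hp
    have hp' : p = 1 ∨ p = -1 := by
      rcases abs_choice p with h | h
      · left; linarith
      · right; linarith
    have hF : w.F p = 0 := (w.F_eq_zero p).2 hp'.symm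
    set a := min p (2 * p) with ha
    set b := max p (2 * p) with hb
    have hseg : ∀ t ∈ Icc (0 : ℝ) 1, p + p * t ∈ Icc a b ∧ p + p * t ∈ Icc (-2 : ℝ) 2 := by
      intro t ht
      obtain ⟨h1, h2⟩ := ht
      rcases hp' with rfl | rfl
      · norm_num [ha, hb]; exact ⟨⟨h1, by linarith⟩, by linarith, by linarith⟩
      · norm_num [ha, hb]; exact ⟨⟨by linarith, h1⟩, by linarith, by linarith⟩
    obtain ⟨C, hC0, hC⟩ := w.exists_abs_slope_le m hF (c := a) (d := b)
      ⟨min_le_left _ _, le_max_left _ _⟩ (by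
        rcases hp' with rfl | rfl <;> norm_num [ha, hb])
    have hdp : ∀ t ∈ Icc (0 : ℝ) 1, w.dprim m g (p + p * t) = w.slope m p g (p + p * t) := by
      intro t ht
      rcases hp' with rfl | rfl
      · exact w.dprim_eq_right m h.continuous h.total_eq (by linarith [ht.1])
      · exact w.dprim_eq_left m h.continuous h.total_eq (by linarith [ht.1])
    have heq : ∀ t ∈ Icc (0 : ℝ) 1, ξ (p + p * t) = ξ 0 + w.prim m g (p + p * t) := fun t ht =>
      h.eq_prim _ (hseg t ht).2
    have hz := eq_zero_of_abs_deriv_le (ξ := fun t => ξ 0 + w.prim m g (p + p * t))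
      (ξ' := fun t => w.dprim m g (p + p * t) * p) (C := C * Q) (T := 1) (by positivity)
      (by
        rw [← heq 0 (by norm_num)]
        refine hξ _ ?_
        rw [mul_zero, add_zero]
        exact abs_le.1 hp.le)
      (fun t _ => by
        have h1 : HasDerivAt (fun t => p + p * t) p t := by
          simpa using ((hasDerivAt_id t).const_mul p).const_add p
        exact ((w.hasDerivAt_prim m h.continuous h.total_eq _).comp t h1).const_add _)
      (fun t ht M hM => by
        rw [abs_mul, hp, mul_one, hdp t ht, mul_assoc]
        refine hC g (Q * M) _ (hseg t ht).1 fun s hs => ?_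
        obtain ⟨u, hu, rfl⟩ : ∃ u ∈ Icc (0 : ℝ) t, p + p * u = s := by
          refine ⟨p * (s - p), ?_, ?_⟩
          · rcases hp' with rfl | rfl
            · rw [uIcc_of_le (by linarith [ht.1])] at hs
              exact ⟨by linarith [hs.1], by linarith [hs.2]⟩
            · rw [uIcc_of_ge (by linarith [ht.1])] at hs
              exact ⟨by linarith [hs.2], by linarith [hs.1]⟩
          · rcases hp' with rfl | rfl <;> ring
        have hu1 : u ∈ Icc (0 : ℝ) 1 := ⟨hu.1, hu.2.trans ht.2⟩
        have h1 := hM u hu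
        rw [← heq u hu1] at h1
        rw [hg, abs_mul]
        exact mul_le_mul (hQ _ (hseg u hu1).2) h1 (abs_nonneg _) hQ0)
    intro t ht
    rw [heq t ht]
    exact hz t ht
  intro r hr
  rcases lt_or_ge r (-1) with h1 | h1
  · have := main (-1) (by norm_num) (-1 - r) ⟨by linarith, by linarith [hr.1]⟩
    rwa [show -1 + -1 * (-1 - r) = r by ring] at this
  rcases lt_or_ge 1 r with h2 | h2
  · have := main 1 (by norm_num) (r - 1) ⟨by linarith, by linarith [hr.2]⟩
    rwa [show 1 + 1 * (r - 1) = r by ring] at this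
  exact hξ r ⟨h1, h2⟩

end PolarWeight

/-! ### Eigenvalues near a quasimode -/

/-- Continuous functions on `[-2, 2]`, a neighbourhood of the two poles. -/
abbrev CFun : Type := C(Icc (-2 : ℝ) 2, ℝ)

namespace CFun

/-- The extension of a function on `[-2, 2]` to the line, constant on either side. -/
noncomputable def ext (x : CFun) : ℝ → ℝ := IccExtend (by norm_num : (-2 : ℝ) ≤ 2) x

/-- The restriction of a continuous function on the line. -/
def ofCont (g : ℝ → ℝ) (hg : Continuous g) : CFun := ⟨fun r => g r, by fun_prop⟩

theorem continuous_ext (x : CFun) : Continuous x.ext := x.continuous.Icc_extend'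

theorem ext_of_mem (x : CFun) {r : ℝ} (hr : r ∈ Icc (-2 : ℝ) 2) : x.ext r = x ⟨r, hr⟩ :=
  IccExtend_of_mem _ _ hr

theorem ext_ofCont {g : ℝ → ℝ} (hg : Continuous g) {r : ℝ} (hr : r ∈ Icc (-2 : ℝ) 2) :
    (ofCont g hg).ext r = g r := ext_of_mem _ hr

theorem abs_ext_le (x : CFun) (r : ℝ) : |x.ext r| ≤ ‖x‖ := x.norm_coe_le_norm _

theorem ext_inj {x y : CFun} (h : ∀ r ∈ Icc (-2 : ℝ) 2, x.ext r = y.ext r) : x = y := by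
  ext ⟨r, hr⟩
  rw [← ext_of_mem x hr, ← ext_of_mem y hr, h r hr]

end CFun

namespace PolarWeight

variable (w : PolarWeight) (m : ℕ)

theorem total_congr {g g' : ℝ → ℝ} (h : ∀ r ∈ Icc (-1 : ℝ) 1, g r = g' r) :
    w.total m g = w.total m g' := by
  refine intervalIntegral.integral_congr fun r hr => ?_
  rw [uIcc_of_le (by norm_num)] at hr
  simp only [h r hr]

theorem slope_congr {p r : ℝ} {g g' : ℝ → ℝ} (h : ∀ s ∈ uIcc p r, g s = g' s) :
    w.slope m p g r = w.slope m p g' r := by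
  rw [slope, slope, radialMean_congr fun s hs => by rw [h s hs]]

theorem prim_congr {g g' : ℝ → ℝ} (h : ∀ s ∈ Icc (-2 : ℝ) 2, g s = g' s) {r : ℝ}
    (hr : r ∈ Icc (-2 : ℝ) 2) : w.prim m g r = w.prim m g' r := by
  unfold prim
  congr 1
  · refine intervalIntegral.integral_congr fun s hs => w.slope_congr m fun t ht => h t ?_
    have hs' : s ∈ Icc (-2 : ℝ) 2 := uIcc_subset_Icc (by norm_num)
      ⟨le_min hr.1 (by norm_num), (min_le_right _ _).trans (by norm_num)⟩ hs
    exact uIcc_subset_Icc (by norm_num) hs' ht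
  · refine intervalIntegral.integral_congr fun s hs => w.slope_congr m fun t ht => h t ?_
    have hs' : s ∈ Icc (-2 : ℝ) 2 := uIcc_subset_Icc (by norm_num)
      ⟨(by norm_num : (-2 : ℝ) ≤ 0).trans (le_max_right _ _), max_le hr.2 (by norm_num)⟩ hs
    exact uIcc_subset_Icc (by norm_num) hs' ht

theorem weight_nonneg {r : ℝ} (hr : r ∈ Icc (-1 : ℝ) 1) : 0 ≤ w.ρ r * w.F r ^ m := by
  refine mul_nonneg (w.ρ_pos r).le (pow_nonneg ?_ _)
  rcases hr.1.eq_or_lt with h | h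
  · rw [← h, w.F_neg_one]
  rcases hr.2.eq_or_lt with h' | h'
  · rw [h', w.F_one]
  exact (w.F_pos r ⟨h, h'⟩).le

theorem exists_total_le : ∃ C, 0 ≤ C ∧ ∀ (g : ℝ → ℝ) (M : ℝ),
    (∀ s ∈ Icc (-1 : ℝ) 1, |g s| ≤ M) → |w.total m g| ≤ C * M := by
  obtain ⟨C, hC⟩ := isCompact_Icc.exists_bound_of_continuousOn (s := Icc (-1 : ℝ) 1)
    (w.continuous_weight m).continuousOn
  have hC0 : 0 ≤ C := (norm_nonneg _).trans (hC 0 (by norm_num))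
  refine ⟨2 * C, by positivity, fun g M hM => ?_⟩
  have := intervalIntegral.norm_integral_le_of_norm_le_const (a := (-1 : ℝ)) (b := 1)
    (f := fun s => w.ρ s * w.F s ^ m * g s) (C := C * M) (fun s hs => by
      rw [uIoc_of_le (by norm_num)] at hs
      have hs' : s ∈ Icc (-1 : ℝ) 1 := Ioc_subset_Icc_self hs
      rw [norm_mul]
      exact mul_le_mul (hC s hs') (hM s hs') (abs_nonneg _) hC0)
  refine this.trans (le_of_eq ?_)
  norm_num
  ring

theorem total_sq_nonneg (g : ℝ → ℝ) : 0 ≤ w.total m (fun s => g s * g s) :=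
  intervalIntegral.integral_nonneg (by norm_num) fun r hr =>
    mul_nonneg (w.weight_nonneg m hr) (mul_self_nonneg _)

theorem total_sq_pos {g : ℝ → ℝ} (hg : Continuous g) {r : ℝ} (hr : r ∈ Icc (-1 : ℝ) 1)
    (h : g r ≠ 0) : 0 < w.total m (fun s => g s * g s) := by
  obtain ⟨c, hc, hgc⟩ : ∃ c ∈ Ioo (-1 : ℝ) 1, g c ≠ 0 := by
    by_contra hcon
    push Not at hcon
    have h1 : closure (Ioo (-1 : ℝ) 1) ⊆ {r | g r = 0} :=
      closure_minimal hcon (isClosed_eq hg continuous_const)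
    rw [closure_Ioo (by norm_num)] at h1
    exact h (h1 hr)
  refine intervalIntegral.integral_pos (by norm_num) ?_ ?_ ⟨c, Ioo_subset_Icc_self hc, ?_⟩
  · exact ((w.continuous_weight m).mul (hg.mul hg)).continuousOn
  · exact fun r hr => mul_nonneg (w.weight_nonneg m (Ioc_subset_Icc_self hr)) (mul_self_nonneg _)
  · exact mul_pos (mul_pos (w.ρ_pos c) (pow_pos (w.F_pos c hc) _)) (mul_self_pos.2 hgc)

theorem total_add {g g' : ℝ → ℝ} (hg : Continuous g) (hg' : Continuous g') :
    w.total m (fun s => g s + g' s) = w.total m g + w.total m g' := by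
  simpa using w.total_linear m hg hg' 1

theorem total_const_mul (c : ℝ) (g : ℝ → ℝ) : w.total m (fun s => c * g s) = c * w.total m g := by
  simp only [total, ← intervalIntegral.integral_const_mul]
  exact intervalIntegral.integral_congr fun s _ => by ring

theorem prim_add {g g' : ℝ → ℝ} (hg : Continuous g) (hg' : Continuous g') (r : ℝ) :
    w.prim m (fun s => g s + g' s) r = w.prim m g r + w.prim m g' r := by
  simpa using w.prim_linear m hg hg' 1 r

theorem prim_const_mul {g : ℝ → ℝ} (hg : Continuous g) (c r : ℝ) :
    w.prim m (fun s => c * g s) r = c * w.prim m g r := by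
  have h : w.prim m (fun _ => 0) r = 0 := by simp [prim, slope, radialMean]
  simpa [h] using w.prim_linear m hg (continuous_const (y := (0 : ℝ))) c r

/-- The inner product with weight `ρ Fᵐ` on `[-1, 1]`. -/
noncomputable def form : CFun →ₗ[ℝ] CFun →ₗ[ℝ] ℝ :=
  LinearMap.mk₂ ℝ (fun x y => w.total m (fun s => x.ext s * y.ext s))
    (fun x x' y => by
      refine .trans ?_ (w.total_add m (x.continuous_ext.mul y.continuous_ext)
        (x'.continuous_ext.mul y.continuous_ext))
      exact w.total_congr m fun s _ => add_mul _ _ _)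
    (fun c x y => by
      rw [smul_eq_mul, ← w.total_const_mul]
      exact w.total_congr m fun s _ => mul_assoc c _ _)
    (fun x y y' => by
      refine .trans ?_ (w.total_add m (x.continuous_ext.mul y.continuous_ext)
        (x.continuous_ext.mul y'.continuous_ext))
      exact w.total_congr m fun s _ => mul_add _ _ _)
    (fun c x y => by
      rw [smul_eq_mul, ← w.total_const_mul]
      exact w.total_congr m fun s _ => mul_left_comm _ c _)

theorem form_apply (x y : CFun) : w.form m x y = w.total m (fun s => x.ext s * y.ext s) := rfl

/-- The operator that integrates the equation `(ρ Fᵐ)⁻¹ (Fᵐ⁺¹ ρ⁻¹ ξ')' = y`. The total of `y`, which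
is zero if there is a regular solution, is added so that the fixed point equation in `isSol_iff`
contains this condition: `prim` vanishes at `0`. -/
theorem exists_solOp : ∃ (N : CFun →L[ℝ] CFun) (C : ℝ),
    (∀ y (r : Icc (-2 : ℝ) 2), N y r = w.prim m y.ext r + w.total m y.ext) ∧
    ∀ g x y, |N g x - N g y| ≤ C * ‖g‖ * |(x : ℝ) - y| := by
  obtain ⟨C, hC0, hC⟩ := w.exists_abs_prim_sub_le m
  obtain ⟨D, hD0, hD⟩ := w.exists_total_le m
  have hlip : ∀ (g : CFun) (x y : Icc (-2 : ℝ) 2),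
      |w.prim m g.ext x - w.prim m g.ext y| ≤ C * ‖g‖ * |(x : ℝ) - y| := fun g x y =>
    hC _ g.continuous_ext _ (fun s _ => g.abs_ext_le s) x x.2 y y.2
  have hcont : ∀ y : CFun, Continuous fun r : Icc (-2 : ℝ) 2 => w.prim m y.ext r := by
    intro y
    refine (LipschitzWith.of_dist_le_mul (K := ⟨C * ‖y‖, by positivity⟩) fun a b => ?_).continuous
    rw [Real.dist_eq, Subtype.dist_eq, Real.dist_eq]
    exact hlip y a b
  let N₀ : CFun →ₗ[ℝ] CFun :=
    { toFun := fun y => ⟨fun r => w.prim m y.ext r + w.total m y.ext, by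
        have := hcont y; fun_prop⟩
      map_add' := fun y y' => by
        ext r
        have e1 : w.prim m (y + y').ext r = w.prim m y.ext r + w.prim m y'.ext r :=
          w.prim_add m y.continuous_ext y'.continuous_ext r
        have e2 : w.total m (y + y').ext = w.total m y.ext + w.total m y'.ext :=
          w.total_add m y.continuous_ext y'.continuous_ext
        simp only [ContinuousMap.coe_mk, ContinuousMap.add_apply, e1, e2]
        ring
      map_smul' := fun c y => by
        ext r
        have e1 : w.prim m (c • y).ext r = c * w.prim m y.ext r :=
          w.prim_const_mul m y.continuous_ext c r
        have e2 : w.total m (c • y).ext = c * w.total m y.ext := w.total_const_mul m c y.ext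
        simp only [ContinuousMap.coe_mk, ContinuousMap.smul_apply, e1, e2, RingHom.id_apply,
          smul_eq_mul]
        ring }
  refine ⟨N₀.mkContinuous (C * 2 + D) fun y => ?_, C, fun y r => rfl, fun g x y => ?_⟩
  · rw [ContinuousMap.norm_le _ (by positivity)]
    intro r
    change |w.prim m y.ext r + w.total m y.ext| ≤ _
    have h1 := hlip y r ⟨0, by norm_num⟩
    rw [w.prim_zero, sub_zero, sub_zero] at h1
    have h2 := hD y.ext ‖y‖ fun s _ => y.abs_ext_le s
    have h3 : |(r : ℝ)| ≤ 2 := abs_le.2 ⟨r.2.1, r.2.2⟩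
    calc _ ≤ _ := abs_add_le _ _
      _ ≤ C * ‖y‖ * 2 + D * ‖y‖ :=
          add_le_add (h1.trans (mul_le_mul_of_nonneg_left h3 (by positivity))) h2
      _ = _ := by ring
  · change |w.prim m g.ext x + w.total m g.ext - (w.prim m g.ext y + w.total m g.ext)| ≤ _
    rw [add_sub_add_right_eq_sub]
    exact hlip g x y

variable {w m}

theorem IsSol.congr {ξ ξ' g g' : ℝ → ℝ} (h : w.IsSol m ξ g) (hg' : Continuous g')
    (h1 : ∀ r ∈ Icc (-2 : ℝ) 2, ξ r = ξ' r) (h2 : ∀ r ∈ Icc (-2 : ℝ) 2, g r = g' r) :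
    w.IsSol m ξ' g' where
  continuous := hg'
  total_eq := by
    rw [← h.total_eq]
    exact (w.total_congr m fun r hr => h2 r ⟨by linarith [hr.1], by linarith [hr.2]⟩).symm
  eq_prim r hr := by
    rw [← h1 r hr, ← h1 0 (by norm_num), ← w.prim_congr m h2 hr]
    exact h.eq_prim r hr

theorem isSol_iff {x y : CFun} : w.IsSol m x.ext y.ext ↔
    ∀ r : Icc (-2 : ℝ) 2, x r = x.ext 0 + (w.prim m y.ext r + w.total m y.ext) := by
  constructor
  · intro h r
    rw [h.total_eq, add_zero, ← h.eq_prim r r.2, x.ext_of_mem r.2]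
  · intro h
    have h0 : w.total m y.ext = 0 := by
      have := h ⟨0, by norm_num⟩
      rw [← x.ext_of_mem, w.prim_zero] at this
      linarith
    refine ⟨y.continuous_ext, h0, fun r hr => ?_⟩
    have := h ⟨r, hr⟩
    rwa [← x.ext_of_mem, h0, add_zero] at this

/-- If `χ` is an approximate eigenfunction of `-(ρ Fᵐ)⁻¹ (Fᵐ⁺¹ ρ⁻¹ ξ')' + q ξ` at `lam₀`, with
relative error less than `δ`, there is an exact eigenvalue at distance less than `δ`, with a smooth
eigenfunction across the poles. Unless `lam₀` is itself an eigenvalue, the resolvent at `lam₀` is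
by the Fredholm alternative a compact operator on continuous functions; it is symmetric for the
weighted inner product, and `χ` shows that it expands some vector by more than `δ⁻¹`. -/
theorem exists_eigenfunction {q : ℝ → ℝ} (hq : ContDiff ℝ ∞ q) {lam₀ δ : ℝ} (hδ : 0 < δ)
    {χ y : ℝ → ℝ} (hχ : Continuous χ) (hy : Continuous y)
    (hsol : w.IsSol m χ (fun r => (q r - lam₀) * χ r + y r))
    (hlt : w.total m (fun s => y s * y s) < δ ^ 2 * w.total m (fun s => χ s * χ s)) :
    ∃ lam, |lam - lam₀| < δ ∧ ∃ G : ℝ → ℝ, ContDiffOn ℝ ∞ G (Ioo (-2) 2) ∧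
      (∀ r ∈ Ioo (-2 : ℝ) 2, HasDerivAt (fun s => w.F s ^ (m + 1) / w.ρ s * deriv G s)
        (w.ρ r * w.F r ^ m * ((q r - lam) * G r)) r) ∧ 0 < w.total m (fun s => G s * G s) := by
  -- it suffices to find a nonzero continuous solution
  suffices hsuff : ∃ lam, |lam - lam₀| < δ ∧ ∃ x : CFun, x ≠ 0 ∧
      w.IsSol m x.ext (fun r => (q r - lam) * x.ext r) by
    obtain ⟨lam, hlam, x, hx0, hx⟩ := hsuff
    refine ⟨lam, hlam, x.ext, hx.contDiffOn (hq.sub contDiff_const) fun r _ => rfl,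
      fun r hr => hx.hasDerivAt_flux hr, ?_⟩
    obtain ⟨r, hr, hne⟩ : ∃ r ∈ Icc (-1 : ℝ) 1, x.ext r ≠ 0 := by
      by_contra hcon
      push Not at hcon
      exact hx0 (CFun.ext_inj fun r hr => hx.eq_zero (hq.continuous.sub continuous_const) hcon r hr)
    exact w.total_sq_pos m x.continuous_ext hr hne
  obtain ⟨N, C, hN, hlip⟩ := w.exists_solOp m
  have hNc : IsCompactOperator N := isCompactOperator_of_lipschitz N hlip
  let Q : CFun := CFun.ofCont (fun r => q r - lam₀) (hq.continuous.sub continuous_const)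
  have hQ : ∀ (x y : CFun) r, r ∈ Icc (-2 : ℝ) 2 →
      (Q * x + y).ext r = (q r - lam₀) * x.ext r + y.ext r := by
    intro x y r hr
    rw [CFun.ext_of_mem _ hr, CFun.ext_of_mem _ hr, CFun.ext_of_mem _ hr]
    rfl
  let e₀ : CFun →L[ℝ] CFun :=
    (ContinuousMap.evalCLM ℝ (⟨0, by norm_num⟩ : Icc (-2 : ℝ) 2)).smulRight (1 : CFun)
  have he₀ : ∀ (x : CFun) r, e₀ x r = x.ext 0 := by
    intro x r
    rw [CFun.ext_of_mem x (by norm_num : (0 : ℝ) ∈ Icc (-2 : ℝ) 2)]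
    simp [e₀]
  have he₀c : IsCompactOperator e₀ := isCompactOperator_of_lipschitz (C := 0) e₀ fun g x y => by
    rw [he₀, he₀]; simp
  let B : CFun →L[ℝ] CFun := e₀ + N.comp (ContinuousLinearMap.mul ℝ CFun Q)
  have hBc : IsCompactOperator B := he₀c.add (hNc.comp_clm _)
  -- `x = B x + N y` says that `x` solves the inhomogeneous equation at `lam₀`
  have hB : ∀ x y : CFun, x = B x + N y ↔
      w.IsSol m x.ext (fun r => (q r - lam₀) * x.ext r + y.ext r) := by
    intro x y
    have h1 : B x + N y = e₀ x + N (Q * x + y) := by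
      rw [map_add, ← add_assoc]; rfl
    have hc : Continuous fun r => (q r - lam₀) * x.ext r + y.ext r := by
      have := hq.continuous
      have := x.continuous_ext
      have := y.continuous_ext
      fun_prop
    have h2 : w.IsSol m x.ext (fun r => (q r - lam₀) * x.ext r + y.ext r) ↔
        w.IsSol m x.ext (Q * x + y).ext :=
      ⟨fun h => h.congr (CFun.continuous_ext _) (fun _ _ => rfl) fun r hr => (hQ x y r hr).symm,
        fun h => h.congr hc (fun _ _ => rfl) (hQ x y)⟩
    rw [h1, h2, isSol_iff]
    constructor
    · intro h r
      conv_lhs => rw [h]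
      rw [ContinuousMap.add_apply, he₀, hN]
    · intro h
      ext r
      rw [ContinuousMap.add_apply, he₀, hN, h r]
  rcases hBc.hasEigenvalue_or_mem_resolventSet one_ne_zero with h | h
  · obtain ⟨x, hx⟩ := h.exists_hasEigenvector
    refine ⟨lam₀, by simpa using hδ, x, hx.2, ?_⟩
    have h1 : B x = x := by simpa using hx.apply_eq_smul
    have h2 := (hB x 0).1 (by rw [h1, map_zero, add_zero])
    exact h2.congr ((hq.continuous.sub continuous_const).mul x.continuous_ext)
      (fun _ _ => rfl) fun r _ => add_zero _
  · rw [spectrum.mem_resolventSet_iff, map_one] at h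
    obtain ⟨u, hu⟩ := h
    set R : CFun →L[ℝ] CFun := ((u⁻¹ : (CFun →L[ℝ] CFun)ˣ) : CFun →L[ℝ] CFun) with hR
    have hRu : ∀ x, R (x - B x) = x := by
      intro x
      have e : x - B x = (u : CFun →L[ℝ] CFun) x := by rw [hu]; rfl
      rw [e, ← mul_apply_eq_comp, hR, u.inv_mul]; rfl
    have huR : ∀ x, R x - B (R x) = x := by
      intro x
      have e : R x - B (R x) = (u : CFun →L[ℝ] CFun) (R x) := by rw [hu]; rfl
      rw [e, ← mul_apply_eq_comp, hR, u.mul_inv]; rfl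
    let T : CFun →L[ℝ] CFun := R.comp N
    have hTc : IsCompactOperator T := hNc.clm_comp R
    have hTsol : ∀ y : CFun,
        w.IsSol m (T y).ext (fun r => (q r - lam₀) * (T y).ext r + y.ext r) := by
      intro y
      rw [← hB]
      have := huR (N y)
      rw [sub_eq_iff_eq_add] at this
      rw [add_comm]
      exact this
    have hTsymm : ∀ x y, w.form m (T x) y = w.form m x (T y) := by
      intro x y
      have h1 := (hTsol x).symm (hTsol y)
      have c1 := (T x).continuous_ext
      have c2 := (T y).continuous_ext
      have c3 := x.continuous_ext
      have c4 := y.continuous_ext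
      have c5 := hq.continuous
      have h2 := w.total_add m (g := fun s => (q s - lam₀) * (T x).ext s * (T y).ext s)
        (g' := fun s => x.ext s * (T y).ext s) (by fun_prop) (by fun_prop)
      have h3 := w.total_add m (g := fun s => (q s - lam₀) * (T x).ext s * (T y).ext s)
        (g' := fun s => (T x).ext s * y.ext s) (by fun_prop) (by fun_prop)
      have h4 : w.total m (fun s => ((q s - lam₀) * (T x).ext s + x.ext s) * (T y).ext s) =
          w.total m (fun s => (q s - lam₀) * (T x).ext s * (T y).ext s +
            x.ext s * (T y).ext s) := w.total_congr m fun r _ => by ring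
      have h5 : w.total m (fun s => (T x).ext s * ((q s - lam₀) * (T y).ext s + y.ext s)) =
          w.total m (fun s => (q s - lam₀) * (T x).ext s * (T y).ext s +
            (T x).ext s * y.ext s) := w.total_congr m fun r _ => by ring
      rw [form_apply, form_apply]
      linarith
    have hT : T (CFun.ofCont y hy) = CFun.ofCont χ hχ := by
      have h1 := (hB (CFun.ofCont χ hχ) (CFun.ofCont y hy)).2 (hsol.congr (by
        have := hq.continuous
        have := (CFun.ofCont χ hχ).continuous_ext
        have := (CFun.ofCont y hy).continuous_ext
        fun_prop) (fun r hr => (CFun.ext_ofCont hχ hr).symm) fun r hr => by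
          rw [CFun.ext_ofCont hχ hr, CFun.ext_ofCont hy hr])
      have h2 : N (CFun.ofCont y hy) = CFun.ofCont χ hχ - B (CFun.ofCont χ hχ) :=
        (sub_eq_of_eq_add' h1).symm
      change R (N _) = _
      rw [h2, hRu]
    obtain ⟨D, hD0, hD⟩ := w.exists_total_le m
    have hsub : ∀ r ∈ Icc (-1 : ℝ) 1, r ∈ Icc (-2 : ℝ) 2 := fun r hr =>
      ⟨by linarith [hr.1], by linarith [hr.2]⟩
    obtain ⟨μ, hμ, x, hx0, hx⟩ := exists_eigenvalue_of_compact_symm (w.form m)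
      (fun x y => by simp only [form_apply, mul_comm]) (fun x => w.total_sq_nonneg m _)
      (C := D) (fun x => by
        rw [form_apply]
        refine (le_abs_self _).trans (hD _ _ fun s _ => ?_)
        rw [abs_mul, pow_two]
        exact mul_le_mul (x.abs_ext_le s) (x.abs_ext_le s) (abs_nonneg _) (norm_nonneg _))
      T hTsymm hTc (M := δ⁻¹) (by positivity) (x₀ := CFun.ofCont y hy) (by
        have e1 : w.form m (CFun.ofCont y hy) (CFun.ofCont y hy) =
            w.total m (fun s => y s * y s) := w.total_congr m fun r hr => by
          rw [CFun.ext_ofCont hy (hsub r hr)]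
        have e2 : w.form m (CFun.ofCont χ hχ) (CFun.ofCont χ hχ) =
            w.total m (fun s => χ s * χ s) := w.total_congr m fun r hr => by
          rw [CFun.ext_ofCont hχ (hsub r hr)]
        rw [hT, e1, e2, inv_pow, inv_mul_lt_iff₀ (by positivity)]
        exact hlt)
    have hμ0 : μ ≠ 0 := by
      rintro rfl
      rw [abs_zero] at hμ
      exact absurd hμ (not_lt.2 (by positivity))
    refine ⟨lam₀ - μ⁻¹, ?_, x, hx0, ?_⟩
    · rw [sub_sub_cancel_left, abs_neg, abs_inv]
      exact inv_lt_of_inv_lt₀ hδ hμ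
    · have h1 := hTsol (μ⁻¹ • x)
      rw [map_smul, hx, smul_smul, inv_mul_cancel₀ hμ0, one_smul] at h1
      refine h1.congr ((hq.continuous.sub continuous_const).mul x.continuous_ext)
        (fun _ _ => rfl) fun r _ => ?_
      change (q r - lam₀) * x.ext r + μ⁻¹ * x.ext r = _
      ring

end PolarWeight

/-! ### From a profile to a polar weight -/

theorem exists_Icc_subset_of_nhds {P : ℝ → Prop} (h : ∀ r ∈ Icc (-1 : ℝ) 1, ∀ᶠ s in 𝓝 r, P s) :
    ∃ ε > 0, ∀ r ∈ Icc (-1 - ε : ℝ) (1 + ε), P r := by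
  have h1 : {s | P s} ∈ 𝓝ˢ (Icc (-1 : ℝ) 1) := mem_nhdsSet_iff_forall.2 h
  obtain ⟨δ, hδ, hsub⟩ := (isCompact_Icc (a := (-1 : ℝ)) (b := 1)).exists_cthickening_subset_open
    isOpen_interior (subset_interior_iff_mem_nhdsSet.2 h1)
  refine ⟨δ, hδ, fun r hr => interior_subset (hsub ?_)⟩
  refine Metric.mem_cthickening_of_dist_le r (max (-1) (min r 1)) δ _
    ⟨le_max_left _ _, max_le (by norm_num) (min_le_right _ _)⟩ ?_
  rw [Real.dist_eq, abs_le]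
  rcases le_total r 1 with h | h
  · rcases le_total (-1) r with h' | h'
    · simp [h, h', hδ.le]
    · simp only [h, min_eq_left, h', max_eq_left]
      constructor <;> linarith [hr.1]
  · simp only [h, min_eq_right]
    rw [max_eq_right (by norm_num)]
    constructor <;> linarith [hr.2]

/-- A smooth function between `0` and `1` which is `1` near `[-1, 1]` and has its support in a given
neighbourhood. -/
theorem exists_cutoff {ε : ℝ} (hε : 0 < ε) : ∃ χ : ℝ → ℝ, ContDiff ℝ ∞ χ ∧
    (∀ r, χ r ∈ Icc (0 : ℝ) 1) ∧ (∃ η > 0, ∀ r ∈ Icc (-1 - η) (1 + η), χ r = 1) ∧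
      tsupport χ ⊆ Icc (-1 - ε) (1 + ε) := by
  let b : ContDiffBump (0 : ℝ) := ⟨1 + ε / 2, 1 + ε, by positivity, by linarith⟩
  refine ⟨b, b.contDiff, fun r => ⟨b.nonneg, b.le_one⟩, ⟨ε / 2, by positivity, fun r hr => ?_⟩, ?_⟩
  · refine b.one_of_mem_closedBall ?_
    rw [mem_closedBall_zero_iff, Real.norm_eq_abs, abs_le]
    exact ⟨by change -(1 + ε / 2) ≤ r; linarith [hr.1], hr.2⟩
  · rw [b.tsupport_eq]
    intro r hr
    rw [mem_closedBall_zero_iff, Real.norm_eq_abs, abs_le] at hr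
    exact ⟨by have : -(1 + ε) ≤ r := hr.1; linarith, hr.2⟩

theorem contDiff_cutoff_mul {χ g : ℝ → ℝ} (hχ : ContDiff ℝ ∞ χ)
    (hg : ∀ r ∈ tsupport χ, ContDiffAt ℝ ∞ g r) : ContDiff ℝ ∞ (fun r => χ r * g r) := by
  rw [contDiff_iff_contDiffAt]
  intro r
  by_cases hr : r ∈ tsupport χ
  · exact hχ.contDiffAt.mul (hg r hr)
  · refine (contDiffAt_const (c := (0 : ℝ))).congr_of_eventuallyEq ?_
    filter_upwards [notMem_tsupport_iff_eventuallyEq.1 hr] with s hs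
    simp [hs]

/-- A function analytic near `[-1, 1]` agrees there with a smooth function on the line. -/
theorem exists_contDiff_eq {V : ℝ → ℝ} (hV : AnalyticOnNhd ℝ V (Icc (-1) 1)) :
    ∃ V' : ℝ → ℝ, ContDiff ℝ ∞ V' ∧ ∀ r ∈ Icc (-1 : ℝ) 1, V' r = V r := by
  obtain ⟨ε, hε, h⟩ := exists_Icc_subset_of_nhds (P := fun s => AnalyticAt ℝ V s)
    fun r hr => (hV r hr).eventually_analyticAt
  obtain ⟨χ, hχ, -, ⟨η, hη, hχ1⟩, hsupp⟩ := exists_cutoff hε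
  refine ⟨fun r => χ r * V r, contDiff_cutoff_mul hχ fun r hr => (h r (hsupp hr)).contDiffAt,
    fun r hr => ?_⟩
  simp only
  rw [hχ1 r ⟨by linarith [hr.1], by linarith [hr.2]⟩, one_mul]

theorem profile_pos {f : ℝ → ℝ} (hf : IsConvexProfile f) {r : ℝ} (hr : r ∈ Ioo (-1 : ℝ) 1) :
    0 < f r := by
  have h : StrictConcaveOn ℝ (Icc (-1) 1) f := strictConcaveOn_of_deriv2_neg (convex_Icc _ _)
    hf.continuousOn (by rw [interior_Icc]; exact hf.concave)
  have := h.2 (show (-1 : ℝ) ∈ Icc (-1) 1 by norm_num) (show (1 : ℝ) ∈ Icc (-1) 1 by norm_num)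
    (by norm_num) (show 0 < (1 - r) / 2 by linarith [hr.2])
    (show 0 < (1 + r) / 2 by linarith [hr.1]) (by ring)
  simp only [hf.left_zero, hf.right_zero, smul_eq_mul, mul_zero, add_zero] at this
  rwa [show (1 - r) / 2 * -1 + (1 + r) / 2 * 1 = r by ring] at this

/-- The weight `w` describes the surface of revolution with profile `f`. As `F = f ^ 2` gives
`F' / 2 = f f'`, the second condition says that `ρ ^ 2 = f ^ 2 (1 + f' ^ 2)`. -/
structure PolarWeight.Models (w : PolarWeight) (f : ℝ → ℝ) : Prop where
  F_eq : ∀ r ∈ Icc (-1 : ℝ) 1, w.F r = f r ^ 2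
  ρ_sq : ∀ r ∈ Ioo (-1 : ℝ) 1, w.ρ r ^ 2 = w.F r + (deriv w.F r / 2) ^ 2
  pos : ∀ r ∈ Ioo (-1 : ℝ) 1, 0 < f r

/-- The square of a profile has a simple zero at each pole `p`, with a sign change: as it is
positive on the side of the surface, it is negative on the other side. -/
theorem eventually_neg_of_simple_zero {F : ℝ → ℝ} {p : ℝ} (hd : DifferentiableAt ℝ F p)
    (h0 : F p = 0) (hne : deriv F p ≠ 0) {σ : ℝ} (hσ : σ = 1 ∨ σ = -1)
    (hpos : ∃ᶠ s in 𝓝[≠] p, 0 ≤ F s ∧ 0 < σ * (s - p)) :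
    ∀ᶠ s in 𝓝 p, σ * (s - p) < 0 → F s < 0 := by
  have ht : Tendsto (slope F p) (𝓝[≠] p) (𝓝 (deriv F p)) :=
    hasDerivAt_iff_tendsto_slope.1 hd.hasDerivAt
  have hs : ∀ s, s ≠ p → F s = slope F p s * (s - p) := by
    intro s hsp
    rw [slope_def_field, h0, sub_zero, div_mul_cancel₀ _ (sub_ne_zero.2 hsp)]
  have hsign : 0 < σ * deriv F p := by
    by_contra hcon
    have h1 : σ * deriv F p < 0 := by
      refine lt_of_le_of_ne (not_lt.1 hcon) (mul_ne_zero ?_ hne)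
      rcases hσ with rfl | rfl <;> norm_num
    have h2 := (ht.const_mul σ).eventually (gt_mem_nhds h1)
    obtain ⟨s, ⟨h3, h4⟩, h5, h6⟩ := (hpos.and_eventually
      (h2.and self_mem_nhdsWithin)).exists
    rw [hs s h6] at h3
    rcases hσ with rfl | rfl <;> nlinarith
  have h2 := (ht.const_mul σ).eventually (lt_mem_nhds hsign)
  rw [eventually_nhdsWithin_iff] at h2
  filter_upwards [h2] with s h3 h4
  have hsp : s ≠ p := by rintro rfl; simp at h4
  have h5 := h3 hsp
  rw [hs s hsp]
  rcases hσ with rfl | rfl <;> nlinarith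

/-- Beyond the poles the analytic continuation of `f ^ 2` is negative, and so are its interpolations
with `1 - r ^ 2`: cutting off creates no further zeros. The area density
`√(F + (F' / 2) ^ 2)` is smooth across the poles because `F' ≠ 0` there. -/
theorem exists_models {f : ℝ → ℝ} (hf : IsConvexProfile f) : ∃ w : PolarWeight, w.Models f := by
  obtain ⟨F, hF, hFf, hl, hr⟩ := hf.analytic_poles
  have hF1 : F (-1) = 0 := by rw [hFf _ (by norm_num), hf.left_zero]; norm_num
  have hF2 : F 1 = 0 := by rw [hFf _ (by norm_num), hf.right_zero]; norm_num
  have hFpos : ∀ r ∈ Ioo (-1 : ℝ) 1, 0 < F r := fun r hr => by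
    rw [hFf r (Ioo_subset_Icc_self hr)]
    exact pow_pos (profile_pos hf hr) 2
  obtain ⟨ε, hε, hU⟩ := exists_Icc_subset_of_nhds
    (P := fun s => AnalyticAt ℝ F s ∧ 0 < F s + (deriv F s / 2) ^ 2 ∧
      (s < -1 → F s < 0) ∧ (1 < s → F s < 0)) fun r hr' => by
    have hd : ContinuousAt (deriv F) r := (hF r hr').deriv.continuousAt
    have hFc : ContinuousAt F r := (hF r hr').continuousAt
    have h1 : 0 < F r + (deriv F r / 2) ^ 2 := by
      rcases hr'.1.eq_or_lt with h | h
      · rw [← h, hF1]; positivity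
      rcases hr'.2.eq_or_lt with h' | h'
      · rw [h', hF2]; positivity
      · have := hFpos r ⟨h, h'⟩; positivity
    have h2 : ∀ᶠ s in 𝓝 r, 0 < F s + (deriv F s / 2) ^ 2 :=
      (hFc.add ((hd.div_const 2).pow 2)).eventually (lt_mem_nhds h1)
    have h3 : ∀ᶠ s in 𝓝 r, s < -1 → F s < 0 := by
      rcases hr'.1.eq_or_lt with h | h
      · rw [← h]
        have := eventually_neg_of_simple_zero (p := -1) (hF (-1) (by norm_num)).differentiableAt hF1
          hl (σ := 1) (Or.inl rfl) (by
            have : ∃ᶠ s in 𝓝[>] (-1 : ℝ), 0 ≤ F s ∧ 0 < 1 * (s - -1) := by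
              refine Eventually.frequently ?_
              filter_upwards [Ioo_mem_nhdsGT (show (-1 : ℝ) < 1 by norm_num)] with s hs
              exact ⟨(hFpos s hs).le, by linarith [hs.1]⟩
            exact this.filter_mono (nhdsWithin_mono _ fun s hs => ne_of_gt hs))
        filter_upwards [this] with s hs hs'
        exact hs (by linarith)
      · filter_upwards [Ioi_mem_nhds h] with s hs hs'
        exact absurd hs' (not_lt.2 (le_of_lt hs))
    have h4 : ∀ᶠ s in 𝓝 r, 1 < s → F s < 0 := by
      rcases hr'.2.eq_or_lt with h | h
      · rw [h]
        have := eventually_neg_of_simple_zero (p := 1) (hF 1 (by norm_num)).differentiableAt hF2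
          hr (σ := -1) (Or.inr rfl) (by
            have : ∃ᶠ s in 𝓝[<] (1 : ℝ), 0 ≤ F s ∧ 0 < -1 * (s - 1) := by
              refine Eventually.frequently ?_
              filter_upwards [Ioo_mem_nhdsLT (show (-1 : ℝ) < 1 by norm_num)] with s hs
              exact ⟨(hFpos s hs).le, by linarith [hs.2]⟩
            exact this.filter_mono (nhdsWithin_mono _ fun s hs => ne_of_lt hs))
        filter_upwards [this] with s hs hs'
        exact hs (by linarith)
      · filter_upwards [Iio_mem_nhds h] with s hs hs'
        exact absurd hs' (not_lt.2 (le_of_lt hs))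
    filter_upwards [(hF r hr').eventually_analyticAt, h2, h3, h4] with s a b c d
    exact ⟨a, b, c, d⟩
  obtain ⟨χ, hχ, hχ01, ⟨η, hη, hχ1⟩, hsupp⟩ := exists_cutoff hε
  have hzero : ∀ r, r ∉ Icc (-1 - ε) (1 + ε) → χ r = 0 := fun r hr =>
    image_eq_zero_of_notMem_tsupport fun h => hr (hsupp h)
  -- continue `F` by `1 - r ^ 2` and the area density by `1`
  set F' : ℝ → ℝ := fun r => χ r * F r + (1 - χ r) * (1 - r ^ 2) with hF'
  set ρ' : ℝ → ℝ := fun r => χ r * √(F r + (deriv F r / 2) ^ 2) + (1 - χ r) with hρ'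
  have heq : ∀ r ∈ Icc (-1 - η) (1 + η), F' r = F r := fun r hr => by
    simp only [hF', hχ1 r hr]; ring
  have hev : ∀ r ∈ Icc (-1 : ℝ) 1, F' =ᶠ[𝓝 r] F := fun r hr => by
    filter_upwards [Ioo_mem_nhds (show -1 - η < r by linarith [hr.1])
      (show r < 1 + η by linarith [hr.2])] with s hs using heq s (Ioo_subset_Icc_self hs)
  have hout : ∀ r, r ∉ Icc (-1 : ℝ) 1 → F' r < 0 := by
    intro r hr
    have h1 : 1 - r ^ 2 < 0 := by
      rw [mem_Icc, not_and_or, not_le, not_le] at hr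
      rcases hr with h | h <;> nlinarith
    by_cases hr' : r ∈ Icc (-1 - ε) (1 + ε)
    · have h2 : F r < 0 := by
        rw [mem_Icc, not_and_or, not_le, not_le] at hr
        rcases hr with h | h
        · exact (hU r hr').2.2.1 h
        · exact (hU r hr').2.2.2 h
      obtain ⟨c0, c1⟩ := hχ01 r
      simp only [hF']
      rcases c0.eq_or_lt with h | h
      · rw [← h]; linarith
      · nlinarith [mul_neg_of_pos_of_neg h h2, mul_nonneg (sub_nonneg.2 c1) (neg_pos.2 h1).le]
    · simp only [hF', hzero r hr']; linarith
  have hin : ∀ r ∈ Ioo (-1 : ℝ) 1, 0 < F' r := fun r hr => by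
    rw [heq r ⟨by linarith [hr.1], by linarith [hr.2]⟩]
    exact hFpos r hr
  have hz1 : F' (-1) = 0 := by rw [(hev (-1) (by norm_num)).eq_of_nhds, hF1]
  have hz2 : F' 1 = 0 := by rw [(hev 1 (by norm_num)).eq_of_nhds, hF2]
  have hiff : ∀ r, F' r = 0 ↔ r = -1 ∨ r = 1 := by
    intro r
    constructor
    · intro h
      by_contra hcon
      push Not at hcon
      by_cases hr : r ∈ Icc (-1 : ℝ) 1
      · exact (hin r ⟨lt_of_le_of_ne hr.1 hcon.1.symm, lt_of_le_of_ne hr.2 hcon.2⟩).ne' h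
      · exact (hout r hr).ne h
    · rintro (rfl | rfl) <;> assumption
  refine ⟨⟨F', ρ', ?_, ?_, ?_, hin, hiff, ?_⟩, ⟨?_, ?_, fun r hr => profile_pos hf hr⟩⟩
  · exact (contDiff_cutoff_mul hχ fun r hr => (hU r (hsupp hr)).1.contDiffAt).add
      ((contDiff_const.sub hχ).mul (by fun_prop))
  · refine (contDiff_cutoff_mul hχ fun r hr => ?_).add (contDiff_const.sub hχ)
    have h := hU r (hsupp hr)
    have h1 : ContDiffAt ℝ ∞ (fun r => F r + (deriv F r / 2) ^ 2) r :=
      h.1.contDiffAt.add ((h.1.deriv.contDiffAt.div_const 2).pow 2)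
    exact h1.sqrt h.2.1.ne'
  · intro r
    obtain ⟨c0, c1⟩ := hχ01 r
    simp only [hρ']
    by_cases hr' : r ∈ Icc (-1 - ε) (1 + ε)
    · have h := Real.sqrt_pos.2 (hU r hr').2.1
      rcases c0.eq_or_lt with h' | h'
      · rw [← h']; norm_num
      · nlinarith [mul_pos h' h]
    · rw [hzero r hr']; norm_num
  · intro r h
    rcases (hiff r).1 h with rfl | rfl
    · rwa [(hev (-1) (by norm_num)).deriv_eq]
    · rwa [(hev 1 (by norm_num)).deriv_eq]
  · intro r hr
    rw [← hFf r hr]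
    exact (hev r hr).eq_of_nhds
  · intro r hr
    have hr' := Ioo_subset_Icc_self hr
    have h1 : ρ' r = √(F r + (deriv F r / 2) ^ 2) := by
      simp only [hρ', hχ1 r ⟨by linarith [hr.1], by linarith [hr.2]⟩]; ring
    change ρ' r ^ 2 = F' r + (deriv F' r / 2) ^ 2
    rw [h1, Real.sq_sqrt (hU r ⟨by linarith [hr.1], by linarith [hr.2]⟩).2.1.le,
      (hev r hr').eq_of_nhds, (hev r hr').deriv_eq]

namespace PolarWeight

/-! ### Separation of variables -/

variable {w : PolarWeight} {f : ℝ → ℝ} {m : ℕ}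

theorem Models.eqOn_sqrt (hw : w.Models f) {r : ℝ} (hr : r ∈ Ioo (-1 : ℝ) 1) : f r = √(w.F r) := by
  rw [hw.F_eq r (Ioo_subset_Icc_self hr), Real.sqrt_sq (hw.pos r hr).le]

theorem Models.eventuallyEq_sqrt (hw : w.Models f) {r : ℝ} (hr : r ∈ Ioo (-1 : ℝ) 1) :
    f =ᶠ[𝓝 r] fun s => √(w.F s) := by
  filter_upwards [Ioo_mem_nhds hr.1 hr.2] with s hs using hw.eqOn_sqrt hs

theorem Models.contDiffAt (hw : w.Models f) {r : ℝ} (hr : r ∈ Ioo (-1 : ℝ) 1) :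
    ContDiffAt ℝ ∞ f r :=
  (w.contDiff_F.contDiffAt.sqrt (w.F_pos r hr).ne').congr_of_eventuallyEq
    (hw.eventuallyEq_sqrt hr)

theorem Models.hasDerivAt (hw : w.Models f) {r : ℝ} (hr : r ∈ Ioo (-1 : ℝ) 1) :
    HasDerivAt f (deriv w.F r / (2 * f r)) r := by
  rw [hw.eqOn_sqrt hr]
  exact ((w.hasDerivAt_F r).sqrt (w.F_pos r hr).ne').congr_of_eventuallyEq
    (hw.eventuallyEq_sqrt hr)

theorem Models.speed_mul (hw : w.Models f) {r : ℝ} (hr : r ∈ Ioo (-1 : ℝ) 1) :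
    profileSpeed f r * f r = w.ρ r := by
  have hf := hw.pos r hr
  have h1 : 0 ≤ profileSpeed f r * f r := mul_nonneg (Real.sqrt_nonneg _) hf.le
  refine (pow_left_inj₀ h1 (w.ρ_pos r).le two_ne_zero).1 ?_
  rw [mul_pow, profileSpeed, Real.sq_sqrt (by positivity), hw.ρ_sq r hr, (hw.hasDerivAt hr).deriv,
    hw.F_eq r (Ioo_subset_Icc_self hr)]
  field_simp

theorem Models.div_speed (hw : w.Models f) {r : ℝ} (hr : r ∈ Ioo (-1 : ℝ) 1) :
    f r / profileSpeed f r = w.F r / w.ρ r := by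
  have h := hw.speed_mul hr
  have hf := (hw.pos r hr).ne'
  have hρ := (w.ρ_pos r).ne'
  have hs : profileSpeed f r ≠ 0 := by
    intro h0
    rw [h0, zero_mul] at h
    exact hρ h.symm
  rw [← h, hw.F_eq r (Ioo_subset_Icc_self hr)]
  field_simp

/-- The potential that appears when the factor `f ^ m` is split off from a function of angular
momentum `m`. -/
noncomputable def polarPotential (w : PolarWeight) (m : ℕ) (r : ℝ) : ℝ :=
  m ^ 2 / w.ρ r ^ 2 - m / 2 * deriv (fun s => deriv w.F s / w.ρ s) r / w.ρ r

theorem contDiff_deriv_F_div_ρ (w : PolarWeight) : ContDiff ℝ ∞ fun s => deriv w.F s / w.ρ s :=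
  w.contDiff_deriv_F.div w.contDiff_ρ fun s => (w.ρ_pos s).ne'

theorem contDiff_polarPotential (w : PolarWeight) (m : ℕ) : ContDiff ℝ ∞ (w.polarPotential m) := by
  have h1 := (contDiff_infty_iff_deriv.1 w.contDiff_deriv_F_div_ρ).2
  exact (contDiff_const.div (w.contDiff_ρ.pow 2) fun s => pow_ne_zero _ (w.ρ_pos s).ne').sub
    ((contDiff_const.mul h1).div w.contDiff_ρ fun s => (w.ρ_pos s).ne')

theorem Models.hasDerivAt_pow (hw : w.Models f) {r : ℝ} (hr : r ∈ Ioo (-1 : ℝ) 1) :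
    HasDerivAt (fun s => f s ^ m) (m * (deriv w.F r / (2 * w.F r)) * f r ^ m) r := by
  have hf := (hw.pos r hr).ne'
  refine (HasDerivAt.fun_pow (hw.hasDerivAt hr) m).congr_deriv ?_
  rw [hw.F_eq r (Ioo_subset_Icc_self hr)]
  rcases m with _ | m
  · simp
  · simp only [Nat.add_sub_cancel]
    field_simp
    ring

theorem Models.hasDerivAt_pow_mul (hw : w.Models f) {r : ℝ} (hr : r ∈ Ioo (-1 : ℝ) 1)
    {G : ℝ → ℝ} {G' : ℝ} (hG : HasDerivAt G G' r) :
    HasDerivAt (fun s => f s ^ m * G s)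
      (f r ^ m * (G' + m * (deriv w.F r / (2 * w.F r)) * G r)) r :=
  ((hw.hasDerivAt_pow hr).mul hG).congr_deriv (by ring)

theorem Models.flux_pow_mul (hw : w.Models f) {r : ℝ} (hr : r ∈ Ioo (-1 : ℝ) 1)
    {G : ℝ → ℝ} {G' : ℝ} (hG : HasDerivAt G G' r) :
    w.F r / w.ρ r * deriv (fun s => f s ^ m * G s) r =
      w.F r ^ (m + 1) / w.ρ r * G' * (f r ^ m)⁻¹ +
        m / 2 * (deriv w.F r / w.ρ r) * (f r ^ m * G r) := by
  have hf := (hw.pos r hr).ne'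
  have hρ := (w.ρ_pos r).ne'
  rw [(hw.hasDerivAt_pow_mul hr hG).deriv, hw.F_eq r (Ioo_subset_Icc_self hr)]
  field_simp
  ring

/-- With `v = f ^ m * G`, the operator `ρ⁻¹ (F ρ⁻¹ v')'` becomes the singular Sturm-Liouville
operator for `G`, up to terms of order zero. -/
theorem Models.hasDerivAt_flux_pow_mul (hw : w.Models f) {r : ℝ} (hr : r ∈ Ioo (-1 : ℝ) 1)
    {G : ℝ → ℝ} {g : ℝ} (hG : ∀ s ∈ Ioo (-1 : ℝ) 1, HasDerivAt G (deriv G s) s)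
    (hg : HasDerivAt (fun s => w.F s ^ (m + 1) / w.ρ s * deriv G s) (w.ρ r * w.F r ^ m * g) r) :
    HasDerivAt (fun s => w.F s / w.ρ s * deriv (fun t => f t ^ m * G t) s)
      (w.ρ r * f r ^ m * (g - w.polarPotential m r * G r + m ^ 2 / w.F r * G r)) r := by
  have hf := (hw.pos r hr).ne'
  have hF := (w.F_pos r hr).ne'
  have hρ := (w.ρ_pos r).ne'
  have h1 := (hw.hasDerivAt_pow (m := m) hr).fun_inv (pow_ne_zero m hf)
  have h2 : HasDerivAt (fun s => deriv w.F s / w.ρ s)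
      (deriv (fun s => deriv w.F s / w.ρ s) r) r :=
    (w.contDiff_deriv_F_div_ρ.differentiable (by simp)).differentiableAt.hasDerivAt
  have h3 := (hg.mul h1).add ((h2.const_mul ((m : ℝ) / 2)).mul
    (hw.hasDerivAt_pow_mul (m := m) hr (hG r hr)))
  have h4 : (fun s => w.F s / w.ρ s * deriv (fun t => f t ^ m * G t) s) =ᶠ[𝓝 r]
      fun s => w.F s ^ (m + 1) / w.ρ s * deriv G s * (f s ^ m)⁻¹ +
        m / 2 * (deriv w.F s / w.ρ s) * (f s ^ m * G s) := by
    filter_upwards [Ioo_mem_nhds hr.1 hr.2] with s hs using hw.flux_pow_mul hs (hG s hs)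
  refine (h3.congr_of_eventuallyEq h4).congr_deriv ?_
  have e := hw.ρ_sq r hr
  have e2 : w.F r ^ m = f r ^ m * f r ^ m := by
    rw [hw.F_eq r (Ioo_subset_Icc_self hr), ← mul_pow, ← pow_two]
  have hfm : f r ^ m ≠ 0 := pow_ne_zero m hf
  rw [polarPotential]
  generalize deriv (fun s => deriv w.F s / w.ρ s) r = P at *
  rw [pow_succ, e2]
  generalize f r ^ m = A at *
  have e3 : (deriv w.F r) ^ 2 = 4 * (w.ρ r ^ 2 - w.F r) := by rw [e]; ring
  generalize deriv w.F r = d at *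
  generalize w.ρ r = R at *
  generalize w.F r = Φ at *
  field_simp
  ring_nf
  linear_combination (m : ℝ) ^ 2 * G r * e3

/-- The Laplacian of a function of angular momentum `m`. -/
theorem Models.laplaceBeltrami_eq (hw : w.Models f) {r : ℝ} (hr : r ∈ Ioo (-1 : ℝ) 1)
    (v : ℝ → ℝ) {v₂ : ℝ}
    (hv : HasDerivAt (fun s => w.F s / w.ρ s * deriv v s) v₂ r) (θ : ℝ) :
    laplaceBeltrami f (fun s t => v s * Real.cos (m * t)) r θ =
      (v₂ / w.ρ r - m ^ 2 / w.F r * v r) * Real.cos (m * θ) := by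
  have h1 : (fun s => f s / profileSpeed f s * deriv (fun t => v t * Real.cos (m * θ)) s) =ᶠ[𝓝 r]
      fun s => w.F s / w.ρ s * deriv v s * Real.cos (m * θ) := by
    filter_upwards [Ioo_mem_nhds hr.1 hr.2] with s hs
    rw [hw.div_speed hs, deriv_mul_const_field, mul_assoc]
  have h2 : deriv (deriv fun t => v r * Real.cos (m * t)) θ =
      -(m ^ 2 * (v r * Real.cos (m * θ))) := by
    have h3 : ∀ t : ℝ, HasDerivAt (fun t : ℝ => (m : ℝ) * t) m t := fun t => by
      simpa using (hasDerivAt_id t).const_mul (m : ℝ)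
    have h4 : (deriv fun t => v r * Real.cos (m * t)) =
        fun t => v r * (-Real.sin (m * t) * m) := by
      ext t
      exact ((h3 t).cos.const_mul _).deriv
    rw [h4, (((h3 θ).sin.fun_neg.mul_const _).const_mul _).deriv]
    ring
  rw [laplaceBeltrami, h1.deriv_eq, deriv_mul_const_field, hv.deriv, h2, hw.speed_mul hr,
    ← hw.F_eq r (Ioo_subset_Icc_self hr)]
  ring

end PolarWeight

/-! ### Functions of given angular momentum on the surface -/

/-- The function `Re ((y + i z) ^ m) G(x)` on three-space. -/
noncomputable def angularFun (m : ℕ) (G : ℝ → ℝ) (p : E3) : ℝ :=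
  (((p 1 : ℂ) + Complex.I * (p 2 : ℂ)) ^ m).re * G (p 0)

theorem angularFun_revPoint (m : ℕ) (G f : ℝ → ℝ) (r θ : ℝ) :
    angularFun m G (revPoint f r θ) = f r ^ m * G r * Real.cos (m * θ) := by
  have h : ((f r * Real.cos θ : ℝ) : ℂ) + Complex.I * ((f r * Real.sin θ : ℝ) : ℂ) =
      (f r : ℂ) * Complex.exp ((θ : ℂ) * Complex.I) := by
    rw [Complex.exp_mul_I]; push_cast; ring
  have h2 : angularFun m G (revPoint f r θ) = ((((f r * Real.cos θ : ℝ) : ℂ) +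
      Complex.I * ((f r * Real.sin θ : ℝ) : ℂ)) ^ m).re * G r := by
    simp [angularFun, revPoint]
  rw [h2, h, mul_pow, ← Complex.exp_nat_mul,
    show (m : ℂ) * ((θ : ℂ) * Complex.I) = ((m * θ : ℝ) : ℂ) * Complex.I by push_cast; ring,
    ← Complex.ofReal_pow, Complex.re_ofReal_mul, Complex.exp_ofReal_mul_I_re]
  ring

theorem angularFun_revPoint_eq_re (m : ℕ) (G f : ℝ → ℝ) (r θ : ℝ) :
    angularFun m G (revPoint f r θ) =
      (Complex.exp (Complex.I * ((m * θ : ℝ) : ℂ)) * ((f r ^ m * G r : ℝ) : ℂ)).re := by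
  rw [angularFun_revPoint, mul_comm Complex.I, Complex.re_mul_ofReal, Complex.exp_ofReal_mul_I_re]
  ring

theorem contDiffAt_angularFun {m : ℕ} {G : ℝ → ℝ} {p : E3} (hG : ContDiffAt ℝ ∞ G (p 0)) :
    ContDiffAt ℝ ∞ (angularFun m G) p := by
  have hc : ∀ i : Fin 3, ContDiff ℝ ∞ fun p : E3 => p i := fun i =>
    (EuclideanSpace.proj i : E3 →L[ℝ] ℝ).contDiff
  have h1 : ContDiffAt ℝ ∞ (fun p : E3 => (((p 1 : ℂ) + Complex.I * (p 2 : ℂ)) ^ m).re) p := by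
    have h2 : ∀ i : Fin 3, ContDiff ℝ ∞ fun p : E3 => (p i : ℂ) := fun i =>
      Complex.ofRealCLM.contDiff.comp (hc i)
    exact (Complex.reCLM.contDiff.comp
      (((h2 1).add (contDiff_const.mul (h2 2))).pow m)).contDiffAt
  exact h1.mul (ContDiffAt.comp p hG (hc 0).contDiffAt)

namespace PolarWeight

variable {w : PolarWeight} {f : ℝ → ℝ} {m : ℕ}

/-! ### Quasimodes -/

/-- A smooth function with support between the poles is a regular solution. -/
theorem isSol_of_tsupport {ξ g : ℝ → ℝ} (hξ : ContDiff ℝ ∞ ξ)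
    (hsupp : tsupport ξ ⊆ Ioo (-1) 1) (hg : Continuous g)
    (hode : ∀ r, HasDerivAt (fun s => w.F s ^ (m + 1) / w.ρ s * deriv ξ s)
      (w.ρ r * w.F r ^ m * g r) r) (hg0 : ∀ r, w.F r = 0 → g r = 0) : w.IsSol m ξ g := by
  have hflux : ∀ r, w.flux m g r = w.F r ^ (m + 1) / w.ρ r * deriv ξ r := by
    intro r
    rw [flux, intervalIntegral.integral_eq_sub_of_hasDerivAt (fun x _ => hode x)
      (((w.continuous_weight m).mul hg).intervalIntegrable _ _), w.F_neg_one]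
    simp
  have h0 : w.total m g = 0 := by
    change w.flux m g 1 = 0
    rw [hflux, w.F_one]
    simp
  have hd : ∀ r, w.dprim m g r = deriv ξ r := by
    intro r
    by_cases hF : w.F r = 0
    · have h1 : r ∉ tsupport ξ := fun h => (w.F_pos r (hsupp h)).ne' hF
      have h2 : deriv ξ r = 0 := by
        rw [(notMem_tsupport_iff_eventuallyEq.1 h1).deriv_eq]
        simp
      have h3 : w.slope m r g r = 0 := by
        rw [slope, radialMean_self, hg0 r hF]
        simp
      rw [h2]
      rcases (w.F_eq_zero r).1 hF with rfl | rfl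
      · rw [w.dprim_eq_left m hg h0 (by norm_num), h3]
      · rw [w.dprim_eq_right m hg h0 (by norm_num), h3]
    · have h1 := w.pow_mul_dprim m hg h0 r
      have hρ := (w.ρ_pos r).ne'
      rw [hflux] at h1
      refine mul_left_cancel₀ (pow_ne_zero (m + 1) hF) ?_
      rw [h1]
      field_simp
  refine ⟨hg, h0, fun r _ => ?_⟩
  have h1 : ∀ s, HasDerivAt (fun s => ξ s - w.prim m g s) 0 s := fun s => by
    have := ((hξ.differentiable (by simp)).differentiableAt (x := s)).hasDerivAt.sub
      (w.hasDerivAt_prim m hg h0 s)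
    rwa [hd, sub_self] at this
  have h2 := is_const_of_deriv_eq_zero (fun s => (h1 s).differentiableAt) (fun s => (h1 s).deriv) r 0
  simp only [w.prim_zero, sub_zero] at h2
  linarith

/-- The equation satisfied by the factor `G` of `v = f ^ m * G`: in terms of `v`, it reads
`-ρ⁻¹ (F ρ⁻¹ v')' + (m² / F + U) v = lam v`. The function `G` is smooth across the poles, and
normalized. -/
structure IsMode (w : PolarWeight) (m : ℕ) (U : ℝ → ℝ) (lam : ℝ) (G : ℝ → ℝ) : Prop where
  contDiffOn : ContDiffOn ℝ ∞ G (Ioo (-2) 2)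
  ode : ∀ r ∈ Ioo (-2 : ℝ) 2, HasDerivAt (fun s => w.F s ^ (m + 1) / w.ρ s * deriv G s)
    (w.ρ r * w.F r ^ m * ((U r + w.polarPotential m r - lam) * G r)) r
  normalized : Real.pi * w.total m (fun s => G s * G s) = 1

/-- A quasimode `ψ` for the radial equation of `v`, supported between the poles, yields a mode: the
factor `f ^ m` may be divided out on the support, and turns the norms of `ψ` and of its error, which
is at most `h ^ 2 |ρ⁻¹ (F ρ⁻¹ ψ')'| + κ |ψ|`, into weighted norms. -/
theorem exists_isMode_of_quasimode (hw : w.Models f) {V : ℝ → ℝ} (hV : ContDiff ℝ ∞ V)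
    {h E κ δ : ℝ} (hh : 0 < h) (hδ : 0 < δ) {ψ : ℝ → ℝ} (hψ : ContDiff ℝ ∞ ψ)
    (hsupp : tsupport ψ ⊆ Ioo (-1) 1)
    (hκ : ∀ r ∈ tsupport ψ, |(m * h) ^ 2 / w.F r + V r - E| ≤ κ)
    (hlt : 2 * h ^ 4 * (∫ r in (-1 : ℝ)..1, deriv (fun s => w.F s / w.ρ s * deriv ψ s) r ^ 2 / w.ρ r)
      + 2 * κ ^ 2 * (∫ r in (-1 : ℝ)..1, w.ρ r * ψ r ^ 2) <
      δ ^ 2 * ∫ r in (-1 : ℝ)..1, w.ρ r * ψ r ^ 2) :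
    ∃ e, |e - E| < δ ∧ ∃ G, w.IsMode m (fun r => V r / h ^ 2) (e / h ^ 2) G := by
  have hρ0 : ∀ r, w.ρ r ≠ 0 := fun r => (w.ρ_pos r).ne'
  have hψ' : ContDiff ℝ ∞ (deriv ψ) := (contDiff_infty_iff_deriv.1 hψ).2
  have hFρ : ContDiff ℝ ∞ fun s => w.F s / w.ρ s * deriv ψ s :=
    (w.contDiff_F.div w.contDiff_ρ hρ0).mul hψ'
  set D : ℝ → ℝ := deriv (fun s => w.F s / w.ρ s * deriv ψ s) with hD
  have hDc : Continuous D := (contDiff_infty_iff_deriv.1 hFρ).2.continuous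
  -- divide by `f ^ m`
  set χ : ℝ → ℝ := fun r => ψ r * (f r ^ m)⁻¹ with hχdef
  have hχ : ContDiff ℝ ∞ χ := contDiff_cutoff_mul hψ fun r hr =>
    ((hw.contDiffAt (hsupp hr)).pow m).inv (pow_ne_zero _ (hw.pos r (hsupp hr)).ne')
  have hχsupp : tsupport χ ⊆ tsupport ψ := closure_mono fun r hr hr' => hr (by simp [hχdef, hr'])
  have hχ' : ContDiff ℝ ∞ (deriv χ) := (contDiff_infty_iff_deriv.1 hχ).2
  have hΦ : ContDiff ℝ ∞ fun s => w.F s ^ (m + 1) / w.ρ s * deriv χ s :=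
    ((w.contDiff_F.pow _).div w.contDiff_ρ hρ0).mul hχ'
  set D₁ : ℝ → ℝ := deriv (fun s => w.F s ^ (m + 1) / w.ρ s * deriv χ s) with hD₁
  have hD₁c : ContDiff ℝ ∞ D₁ := (contDiff_infty_iff_deriv.1 hΦ).2
  have hD₁z : ∀ r, r ∉ tsupport χ → D₁ r = 0 := by
    intro r hr
    have h1 : (fun s => w.F s ^ (m + 1) / w.ρ s * deriv χ s) =ᶠ[𝓝 r] fun _ => 0 := by
      filter_upwards [(notMem_tsupport_iff_eventuallyEq.1 hr).eventuallyEq_nhds] with s hs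
      rw [hs.deriv_eq]
      simp
    rw [hD₁, h1.deriv_eq, deriv_const]
  have hD₁supp : tsupport D₁ ⊆ tsupport χ :=
    closure_minimal (fun r hr => by_contra fun h => hr (hD₁z r h)) (isClosed_tsupport χ)
  set g : ℝ → ℝ := fun r => D₁ r * (w.ρ r * w.F r ^ m)⁻¹ with hgdef
  have hg : Continuous g := (contDiff_cutoff_mul hD₁c fun r hr =>
    ((w.contDiff_ρ.contDiffAt.mul (w.contDiff_F.contDiffAt.pow m)).inv (mul_ne_zero (hρ0 r)
      (pow_ne_zero _ (w.F_pos r (hsupp (hχsupp (hD₁supp hr)))).ne')))).continuous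
  have hgz : ∀ r, r ∉ tsupport χ → g r = 0 := fun r hr => by
    simp only [hgdef, hD₁z r hr, zero_mul]
  have hode : ∀ r, HasDerivAt (fun s => w.F s ^ (m + 1) / w.ρ s * deriv χ s)
      (w.ρ r * w.F r ^ m * g r) r := by
    intro r
    have h1 : HasDerivAt (fun s => w.F s ^ (m + 1) / w.ρ s * deriv χ s) (D₁ r) r :=
      ((hΦ.differentiable (by simp)).differentiableAt).hasDerivAt
    refine h1.congr_deriv ?_
    by_cases hr : r ∈ tsupport χ
    · have h2 : w.ρ r * w.F r ^ m ≠ 0 :=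
        mul_ne_zero (hρ0 r) (pow_ne_zero _ (w.F_pos r (hsupp (hχsupp hr))).ne')
      rw [hgdef, mul_left_comm, mul_inv_cancel₀ h2, mul_one]
    · rw [hD₁z r hr, hgz r hr, mul_zero]
  have hsol : w.IsSol m χ g := isSol_of_tsupport hχ (hχsupp.trans hsupp) hg hode fun r hF =>
    hgz r fun h => (w.F_pos r (hsupp (hχsupp h))).ne' hF
  -- on the support of `χ`, the error is that of `ψ` divided by `f ^ m`
  have hfχ : ∀ s ∈ Ioo (-1 : ℝ) 1, f s ^ m * χ s = ψ s := by
    intro s hs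
    have := pow_ne_zero m (hw.pos s hs).ne'
    simp only [hχdef]
    field_simp
  have hDeq : ∀ r ∈ Ioo (-1 : ℝ) 1,
      D r = w.ρ r * f r ^ m * (g r - w.polarPotential m r * χ r + m ^ 2 / w.F r * χ r) := by
    intro r hr
    have h1 := hw.hasDerivAt_flux_pow_mul hr (G := χ) (fun s _ =>
      ((hχ.differentiable (by simp)).differentiableAt).hasDerivAt) (hode r)
    have h2 : (fun s => w.F s / w.ρ s * deriv (fun t => f t ^ m * χ t) s) =ᶠ[𝓝 r]
        fun s => w.F s / w.ρ s * deriv ψ s := by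
      filter_upwards [Ioo_mem_nhds hr.1 hr.2] with s hs
      have h3 : (fun t => f t ^ m * χ t) =ᶠ[𝓝 s] ψ := by
        filter_upwards [Ioo_mem_nhds hs.1 hs.2] with t ht using hfχ t ht
      rw [h3.deriv_eq]
    rw [hD, ← h2.deriv_eq, h1.deriv]
  set q : ℝ → ℝ := fun r => V r / h ^ 2 + w.polarPotential m r with hqdef
  have hq : ContDiff ℝ ∞ q := (hV.div_const _).add (w.contDiff_polarPotential m)
  set y : ℝ → ℝ := fun r => g r - (q r - E / h ^ 2) * χ r with hydef
  have hy : Continuous y := hg.sub ((hq.continuous.sub continuous_const).mul hχ.continuous)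
  have hyz : ∀ r, r ∉ tsupport χ → y r = 0 := fun r hr => by
    simp only [hydef, hgz r hr, image_eq_zero_of_notMem_tsupport hr, mul_zero, sub_zero]
  have hpt : ∀ r ∈ Icc (-1 : ℝ) 1, h ^ 4 * (w.ρ r * w.F r ^ m * (y r * y r)) ≤
      2 * h ^ 4 * (D r ^ 2 / w.ρ r) + 2 * κ ^ 2 * (w.ρ r * ψ r ^ 2) := by
    intro r _
    have hρ := w.ρ_pos r
    by_cases hr : r ∈ tsupport χ
    · have hrψ := hχsupp hr
      have hri := hsupp hrψ
      have hF := (w.F_pos r hri).ne'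
      have hk := hκ r hrψ
      have e1 : h ^ 2 * (f r ^ m * y r) = h ^ 2 * D r / w.ρ r -
          ((m * h) ^ 2 / w.F r + V r - E) * ψ r := by
        rw [hDeq r hri, ← hfχ r hri]
        simp only [hydef, hqdef]
        field_simp
        ring
      have e2 : h ^ 4 * (w.ρ r * w.F r ^ m * (y r * y r)) =
          w.ρ r * (h ^ 2 * (f r ^ m * y r)) ^ 2 := by
        rw [hw.F_eq r (Ioo_subset_Icc_self hri)]
        ring
      have e3 : ((m * h) ^ 2 / w.F r + V r - E) ^ 2 ≤ κ ^ 2 := by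
        rw [← sq_abs ((m * h) ^ 2 / w.F r + V r - E)]
        exact pow_le_pow_left₀ (abs_nonneg _) hk 2
      rw [e2, e1]
      generalize (m * h) ^ 2 / w.F r + V r - E = z at *
      have e4 : (h ^ 2 * D r / w.ρ r - z * ψ r) ^ 2 ≤
          2 * (h ^ 2 * D r / w.ρ r) ^ 2 + 2 * (z ^ 2 * ψ r ^ 2) := by
        nlinarith [sq_nonneg (h ^ 2 * D r / w.ρ r + z * ψ r)]
      have e5 : z ^ 2 * ψ r ^ 2 ≤ κ ^ 2 * ψ r ^ 2 := mul_le_mul_of_nonneg_right e3 (sq_nonneg _)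
      calc w.ρ r * (h ^ 2 * D r / w.ρ r - z * ψ r) ^ 2
          ≤ w.ρ r * (2 * (h ^ 2 * D r / w.ρ r) ^ 2 + 2 * (κ ^ 2 * ψ r ^ 2)) :=
            mul_le_mul_of_nonneg_left (by linarith) hρ.le
        _ = _ := by field_simp
    · rw [hyz r hr]
      simp only [mul_zero]
      positivity
  have hρc := w.contDiff_ρ.continuous
  have hψc := hψ.continuous
  have i1 : Continuous fun r => D r ^ 2 / w.ρ r := (hDc.pow 2).div hρc hρ0
  have i2 : Continuous fun r => w.ρ r * ψ r ^ 2 := by fun_prop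
  have hχtot : w.total m (fun s => χ s * χ s) = ∫ r in (-1 : ℝ)..1, w.ρ r * ψ r ^ 2 := by
    refine intervalIntegral.integral_congr fun r hr => ?_
    rw [uIcc_of_le (by norm_num)] at hr
    by_cases hr' : r ∈ Ioo (-1 : ℝ) 1
    · simp only [hw.F_eq r hr, ← hfχ r hr']
      ring
    · have h1 : ψ r = 0 := image_eq_zero_of_notMem_tsupport fun h => hr' (hsupp h)
      simp [hχdef, h1]
  have hytot : h ^ 4 * w.total m (fun s => y s * y s) ≤
      2 * h ^ 4 * (∫ r in (-1 : ℝ)..1, D r ^ 2 / w.ρ r)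
        + 2 * κ ^ 2 * (∫ r in (-1 : ℝ)..1, w.ρ r * ψ r ^ 2) := by
    rw [total, ← intervalIntegral.integral_const_mul, ← intervalIntegral.integral_const_mul,
      ← intervalIntegral.integral_const_mul, ← intervalIntegral.integral_add
        ((i1.const_mul _).intervalIntegrable _ _) ((i2.const_mul _).intervalIntegrable _ _)]
    refine intervalIntegral.integral_mono_on (by norm_num) ?_ ?_ hpt
    · exact (((w.continuous_weight m).mul (hy.mul hy)).const_mul _).intervalIntegrable _ _
    · exact ((i1.const_mul _).add (i2.const_mul _)).intervalIntegrable _ _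
  obtain ⟨lam, hlam, G, hG1, hG2, hG3⟩ := exists_eigenfunction (m := m) hq (lam₀ := E / h ^ 2)
    (δ := δ / h ^ 2) (by positivity) hχ.continuous hy
    (by
      have : (fun r => (q r - E / h ^ 2) * χ r + y r) = g := by
        ext r; simp only [hydef]; ring
      rw [this]; exact hsol)
    (by
      rw [hχtot, div_pow, div_mul_eq_mul_div, lt_div_iff₀ (by positivity)]
      calc _ = h ^ 4 * w.total m (fun s => y s * y s) := by ring
        _ < _ := hytot.trans_lt hlt)
  refine ⟨lam * h ^ 2, ?_, fun r => (√(Real.pi * w.total m (fun s => G s * G s)))⁻¹ * G r,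
    contDiffOn_const.mul hG1, fun r hr => ?_, ?_⟩
  · have h1 : lam * h ^ 2 - E = (lam - E / h ^ 2) * h ^ 2 := by field_simp
    rw [h1, abs_mul, abs_of_pos (by positivity : 0 < h ^ 2)]
    rwa [lt_div_iff₀ (by positivity)] at hlam
  · have h1 := (hG2 r hr).const_mul (√(Real.pi * w.total m (fun s => G s * G s)))⁻¹
    have h2 : lam * h ^ 2 / h ^ 2 = lam := by field_simp
    simp only [deriv_const_mul_field]
    rw [h2]
    refine (h1.congr_of_eventuallyEq (Eventually.of_forall fun s => ?_)).congr_deriv ?_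
    · simp only []; ring
    · simp only [hqdef]; ring
  · have hpos : 0 < Real.pi * w.total m (fun s => G s * G s) := mul_pos Real.pi_pos hG3
    have h1 : w.total m (fun s => (√(Real.pi * w.total m (fun s => G s * G s)))⁻¹ * G s *
        ((√(Real.pi * w.total m (fun s => G s * G s)))⁻¹ * G s)) =
        w.total m (fun s => (Real.pi * w.total m (fun s => G s * G s))⁻¹ * (G s * G s)) := by
      refine w.total_congr m fun r _ => ?_
      conv_rhs => rw [← Real.sq_sqrt hpos.le]
      ring
    rw [h1, total_const_mul, mul_left_comm, inv_mul_cancel₀ hpos.ne']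

/-- Where the effective potential `(m h)² / F + V` takes the value `E`, a bump function is a
quasimode of energy `E`: so for `h → 0` with `m h` fixed there are eigenvalues close to `E`. -/
theorem exists_isMode_near (hw : w.Models f) {V : ℝ → ℝ} (hV : ContDiff ℝ ∞ V) {c E r₁ : ℝ}
    (hr₁ : r₁ ∈ Ioo (-1 : ℝ) 1) (hE : c ^ 2 / w.F r₁ + V r₁ = E) {δ : ℝ} (hδ : 0 < δ) :
    (∃ h₀ > 0, ∀ h, 0 < h → h < h₀ → ∀ m : ℕ, m * h = c →
      ∃ e, |e - E| < δ ∧ ∃ G, w.IsMode m (fun r => V r / h ^ 2) (e / h ^ 2) G) ∧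
    ∀ h, 0 < h → ∀ m : ℕ, m * h = c → ∃ e G, w.IsMode m (fun r => V r / h ^ 2) (e / h ^ 2) G := by
  have hFr := (w.F_pos r₁ hr₁).ne'
  have hc : ContinuousAt (fun r => |c ^ 2 / w.F r + V r - E|) r₁ :=
    (((continuousAt_const.div w.contDiff_F.continuous.continuousAt hFr).add
      hV.continuous.continuousAt).sub continuousAt_const).abs
  have hev : ∀ᶠ r in 𝓝 r₁, |c ^ 2 / w.F r + V r - E| < δ / 2 := by
    refine hc.eventually (gt_mem_nhds ?_)
    simp only [hE, sub_self, abs_zero]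
    positivity
  obtain ⟨ε, hε, hball⟩ := Metric.nhds_basis_closedBall.mem_iff.1
    (hev.and (Ioo_mem_nhds hr₁.1 hr₁.2))
  let b : ContDiffBump r₁ := ⟨ε / 2, ε, by positivity, by linarith⟩
  have hsupp : tsupport b ⊆ Metric.closedBall r₁ ε := by rw [b.tsupport_eq]
  have hκ : ∀ r ∈ tsupport b, |c ^ 2 / w.F r + V r - E| ≤ δ / 2 :=
    fun r hr => (hball (hsupp hr)).1.le
  set A := ∫ r in (-1 : ℝ)..1, deriv (fun s => w.F s / w.ρ s * deriv b s) r ^ 2 / w.ρ r with hA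
  set B := ∫ r in (-1 : ℝ)..1, w.ρ r * b r ^ 2 with hB
  have hA0 : 0 ≤ A := intervalIntegral.integral_nonneg (by norm_num) fun r _ =>
    div_nonneg (sq_nonneg _) (w.ρ_pos r).le
  have hB0 : 0 < B := by
    have hbc : Continuous fun r => w.ρ r * b r ^ 2 :=
      w.contDiff_ρ.continuous.mul (b.continuous.pow 2)
    refine intervalIntegral.integral_pos (by norm_num) hbc.continuousOn
      (fun r _ => mul_nonneg (w.ρ_pos r).le (sq_nonneg _)) ⟨r₁, Ioo_subset_Icc_self hr₁, ?_⟩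
    have : b r₁ = 1 := b.one_of_mem_closedBall (Metric.mem_closedBall_self b.rIn_pos.le)
    rw [this]
    simpa using w.ρ_pos r₁
  have key : ∀ h, 0 < h → ∀ m : ℕ, m * h = c → ∀ δ', 0 < δ' →
      2 * h ^ 4 * A + 2 * (δ / 2) ^ 2 * B < δ' ^ 2 * B →
      ∃ e, |e - E| < δ' ∧ ∃ G, w.IsMode m (fun r => V r / h ^ 2) (e / h ^ 2) G := by
    intro h hh m hm δ' hδ' hlt
    exact exists_isMode_of_quasimode hw hV hh hδ' b.contDiff
      (fun r hr => (hball (hsupp hr)).2) (κ := δ / 2) (by rw [hm]; exact hκ) hlt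
  constructor
  · refine ⟨min 1 (δ ^ 2 * B / (4 * (A + 1))), lt_min one_pos (by positivity),
      fun h hh hlt m hm => key h hh m hm δ hδ ?_⟩
    have h1 : h < 1 := hlt.trans_le (min_le_left _ _)
    have h2 : h * (4 * (A + 1)) < δ ^ 2 * B :=
      (lt_div_iff₀ (by positivity)).1 (hlt.trans_le (min_le_right _ _))
    have h3 : h ^ 4 ≤ h := by
      calc h ^ 4 ≤ h ^ 1 := pow_le_pow_of_le_one hh.le h1.le (by norm_num)
        _ = h := pow_one h
    nlinarith [mul_le_mul_of_nonneg_right h3 hA0]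
  · intro h hh m hm
    obtain ⟨e, -, G, hG⟩ := key h hh m hm
      (1 + (2 * h ^ 4 * A + 2 * (δ / 2) ^ 2 * B) / B) (by positivity) (by
        set t := (2 * h ^ 4 * A + 2 * (δ / 2) ^ 2 * B) / B with ht
        have ht0 : 0 ≤ t := by positivity
        have h1 : 2 * h ^ 4 * A + 2 * (δ / 2) ^ 2 * B = t * B := by rw [ht]; field_simp
        rw [h1]
        exact mul_lt_mul_of_pos_right (by nlinarith) hB0)
    exact ⟨e, G, hG⟩

/-! ### Eigenfunctions from modes -/

theorem integral_cos_sq_nat_mul {m : ℕ} (hm : m ≠ 0) :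
    ∫ θ in (0 : ℝ)..(2 * Real.pi), Real.cos (m * θ) ^ 2 = Real.pi := by
  have hm' : (m : ℝ) ≠ 0 := Nat.cast_ne_zero.2 hm
  have h := intervalIntegral.integral_comp_mul_left (a := 0) (b := 2 * Real.pi)
    (fun x => Real.cos x ^ 2) hm'
  rw [h, integral_cos_sq]
  have h1 : Real.sin (m * (2 * Real.pi)) = 0 := by
    have := Real.sin_nat_mul_pi (m * 2)
    rwa [Nat.cast_mul, Nat.cast_ofNat, mul_assoc] at this
  rw [h1, smul_eq_mul]
  simp only [mul_zero, Real.sin_zero, sub_zero, zero_add]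
  field_simp

theorem IsMode.hasDerivAt {U : ℝ → ℝ} {lam : ℝ} {G : ℝ → ℝ} (hG : w.IsMode m U lam G) {r : ℝ}
    (hr : r ∈ Ioo (-1 : ℝ) 1) : HasDerivAt G (deriv G r) r :=
  ((hG.contDiffOn.contDiffAt (Ioo_mem_nhds (by linarith [hr.1]) (by linarith [hr.2]))
    ).differentiableAt (by simp)).hasDerivAt

/-- The function `v = f ^ m * G` satisfies the radial equation. -/
theorem IsMode.hasDerivAt_flux (hw : w.Models f) {U : ℝ → ℝ} {lam : ℝ} {G : ℝ → ℝ}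
    (hG : w.IsMode m U lam G) {r : ℝ} (hr : r ∈ Ioo (-1 : ℝ) 1) :
    HasDerivAt (fun s => w.F s / w.ρ s * deriv (fun t => f t ^ m * G t) s)
      (w.ρ r * (m ^ 2 / w.F r + U r - lam) * (f r ^ m * G r)) r :=
  (hw.hasDerivAt_flux_pow_mul hr (fun s hs => hG.hasDerivAt hs)
    (hG.ode r ⟨by linarith [hr.1], by linarith [hr.2]⟩)).congr_deriv (by ring)

theorem IsMode.isNormalizedEigenfunction (hw : w.Models f) (hm : m ≠ 0) {V V' : ℝ → ℝ}
    (hV : ∀ r ∈ Icc (-1 : ℝ) 1, V' r = V r) {h e : ℝ} (hh : 0 < h) {G : ℝ → ℝ}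
    (hG : w.IsMode m (fun r => V' r / h ^ 2) (e / h ^ 2) G) :
    IsNormalizedEigenfunction f V h e (angularFun m G) where
  smooth := by
    rintro p ⟨r, hr, θ, rfl⟩
    refine contDiffAt_angularFun (hG.contDiffOn.contDiffAt ?_)
    have : revPoint f r θ 0 = r := by simp [revPoint]
    rw [this]
    exact Ioo_mem_nhds (by linarith [hr.1]) (by linarith [hr.2])
  equation := by
    intro r hr θ
    have h1 : (fun s t => angularFun m G (revPoint f s t)) =
        fun s t => f s ^ m * G s * Real.cos (m * t) := by
      ext s t
      exact angularFun_revPoint m G f s t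
    have hρ := (w.ρ_pos r).ne'
    rw [h1, angularFun_revPoint, hw.laplaceBeltrami_eq hr (fun s => f s ^ m * G s)
      (hG.hasDerivAt_flux hw hr), hV r (Ioo_subset_Icc_self hr)]
    field_simp
    ring
  normalized := by
    refine Eq.trans ?_ hG.normalized
    rw [total, ← intervalIntegral.integral_const_mul]
    refine intervalIntegral.integral_congr_Ioo_of_le (μ := MeasureTheory.volume)
      (by norm_num : (-1 : ℝ) ≤ 1) fun r hr => ?_
    simp only [angularFun_revPoint]
    have h1 : ∀ θ : ℝ, (f r ^ m * G r * Real.cos (m * θ)) ^ 2 * (f r * profileSpeed f r) =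
        w.ρ r * w.F r ^ m * (G r * G r) * Real.cos (m * θ) ^ 2 := by
      intro θ
      rw [mul_comm (f r) (profileSpeed f r), hw.speed_mul hr, hw.F_eq r (Ioo_subset_Icc_self hr)]
      ring
    simp only [h1]
    rw [intervalIntegral.integral_const_mul, integral_cos_sq_nat_mul hm, mul_comm]

/-! ### Nonvanishing in the forbidden region -/

/-- Uniqueness for the Cauchy problem: a mode does not vanish on an interval. -/
theorem IsMode.not_eqOn_zero {U : ℝ → ℝ} (hU : Continuous U) {lam : ℝ} {G : ℝ → ℝ}
    (hG : w.IsMode m U lam G) {a b : ℝ} (hab : a < b) (ha : -1 ≤ a) (hb : b ≤ 1)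
    (h0 : ∀ r ∈ Ioo a b, G r = 0) : False := by
  have hall : ∀ r ∈ Ioo (-1 : ℝ) 1, G r = 0 := by
    intro r hr
    set t := (a + b) / 2 with ht
    have htab : t ∈ Ioo a b := ⟨by linarith, by linarith⟩
    obtain ⟨c, d, hcd, htc, hrc⟩ := exists_Icc_subset_Ioo
      (show t ∈ Ioo (-1 : ℝ) 1 from ⟨by linarith [htab.1], by linarith [htab.2]⟩) hr
    have hFc := w.contDiff_F.continuous
    have hρc := w.contDiff_ρ.continuous
    have hpc := (w.contDiff_polarPotential m).continuous
    set α : ℝ → ℝ := fun s => w.ρ s / w.F s ^ (m + 1) with hα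
    set β : ℝ → ℝ := fun s => w.ρ s * w.F s ^ m * (U s + w.polarPotential m s - lam) with hβ
    have hFne : ∀ s ∈ Ioo (-1 : ℝ) 1, w.F s ^ (m + 1) ≠ 0 := fun s hs =>
      pow_ne_zero _ (w.F_pos s hs).ne'
    obtain ⟨K₁, hK₁⟩ := (isCompact_Icc (a := c) (b := d)).exists_bound_of_continuousOn (f := α)
      (hρc.continuousOn.div (hFc.pow _).continuousOn fun s hs => hFne s (hcd hs))
    obtain ⟨K₂, hK₂⟩ := (isCompact_Icc (a := c) (b := d)).exists_bound_of_continuousOn (f := β)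
      (by fun_prop)
    have hK₁0 : 0 ≤ K₁ := (norm_nonneg _).trans (hK₁ t (Ioo_subset_Icc_self htc))
    set K : NNReal := ⟨max K₁ K₂, le_max_of_le_left hK₁0⟩ with hK
    let field : ℝ → ℝ × ℝ → ℝ × ℝ := fun s y => (α s * y.2, β s * y.1)
    have hlip : ∀ s ∈ Ioo c d, LipschitzOnWith K (field s) univ := by
      intro s hs
      refine LipschitzOnWith.of_dist_le_mul fun y _ y' _ => ?_
      have hs' := Ioo_subset_Icc_self hs
      have e1 : dist (α s * y.2) (α s * y'.2) ≤ max K₁ K₂ * dist y y' := by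
        rw [Real.dist_eq, ← mul_sub, abs_mul]
        exact mul_le_mul ((hK₁ s hs').trans (le_max_left _ _)) (le_max_right _ _) (abs_nonneg _)
          (le_max_of_le_left hK₁0)
      have e2 : dist (β s * y.1) (β s * y'.1) ≤ max K₁ K₂ * dist y y' := by
        rw [Real.dist_eq, ← mul_sub, abs_mul]
        exact mul_le_mul ((hK₂ s hs').trans (le_max_right _ _)) (le_max_left _ _) (abs_nonneg _)
          (le_max_of_le_left hK₁0)
      exact max_le e1 e2
    let sol : ℝ → ℝ × ℝ := fun s => (G s, w.F s ^ (m + 1) / w.ρ s * deriv G s)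
    have hsol : ∀ s ∈ Ioo c d, HasDerivAt sol (field s (sol s)) s ∧ sol s ∈ univ := by
      intro s hs
      have hs' := hcd (Ioo_subset_Icc_self hs)
      have e1 := hG.hasDerivAt hs'
      have e2 := hG.ode s ⟨by linarith [hs'.1], by linarith [hs'.2]⟩
      refine ⟨(e1.prodMk e2).congr_deriv ?_, mem_univ _⟩
      have hρ := (w.ρ_pos s).ne'
      have hF := hFne s hs'
      refine Prod.ext ?_ ?_
      · simp only [field, sol, hα]
        field_simp
      · simp only [field, sol, hβ]
        ring
    have hzero : ∀ s ∈ Ioo c d, HasDerivAt (fun _ => (0 : ℝ × ℝ)) (field s 0) s ∧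
        (0 : ℝ × ℝ) ∈ univ := by
      intro s _
      have : field s 0 = 0 := by simp [field]
      rw [this]
      exact ⟨hasDerivAt_const _ _, mem_univ _⟩
    have h00 : G =ᶠ[𝓝 t] fun _ => 0 := by
      filter_upwards [Ioo_mem_nhds htab.1 htab.2] with s hs using h0 s hs
    have heq : sol t = 0 := by
      refine Prod.ext (h0 t htab) ?_
      simp only [sol, h00.deriv_eq, deriv_const, mul_zero, Prod.snd_zero]
    exact congrArg Prod.fst (ODE_solution_unique_of_mem_Ioo hlip htc hsol hzero heq hrc)
  have h1 : w.total m (fun s => G s * G s) = 0 := by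
    have : w.total m (fun s => G s * G s) = ∫ _ in (-1 : ℝ)..1, (0 : ℝ) :=
      intervalIntegral.integral_congr_Ioo_of_le (by norm_num) fun r hr => by
        simp only [hall r hr, mul_zero]
    rw [this, intervalIntegral.integral_zero]
  have h2 := hG.normalized
  rw [h1, mul_zero] at h2
  exact zero_ne_one h2

/-- The product of a radial function `v = f ^ m * G` and its flux `F ρ⁻¹ v'`, in terms of `G`. -/
noncomputable def massFlux (w : PolarWeight) (m : ℕ) (G : ℝ → ℝ) (r : ℝ) : ℝ :=
  w.F r ^ (m + 1) / w.ρ r * deriv G r * G r + m / 2 * (deriv w.F r / w.ρ r) * (w.F r ^ m * G r ^ 2)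

/-- A maximum principle: `v = f ^ m * G` and its flux `N` satisfy
`(v N)' = F ρ⁻¹ v' ^ 2 + ρ (m ^ 2 / F + U - lam) v ^ 2`, which is positive where `v ≠ 0` and
`U > lam`. So `v N` cannot have two zeros at the ends of an interval where `U > lam`. Poles are
zeros of `v N`. -/
theorem IsMode.false_of_forbidden (hw : w.Models f) (hm : m ≠ 0) {U : ℝ → ℝ}
    (hU : Continuous U) {lam : ℝ} {G : ℝ → ℝ} (hG : w.IsMode m U lam G) {a b : ℝ} (hab : a < b)
    (ha : -1 ≤ a) (hb : b ≤ 1) (hlam : ∀ r ∈ Ioo a b, lam < U r)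
    (ha0 : a = -1 ∨ G a = 0) (hb0 : b = 1 ∨ G b = 0) : False := by
  have hz : ∀ r, (r = -1 ∨ r = 1) ∨ G r = 0 → w.massFlux m G r = 0 := by
    rintro r (h | h)
    · simp [massFlux, (w.F_eq_zero r).2 h, hm]
    · simp [massFlux, h]
  have ha1 : w.massFlux m G a = 0 := hz a (ha0.imp_left Or.inl)
  have hb1 : w.massFlux m G b = 0 := hz b (hb0.imp_left Or.inr)
  have hsub : Icc a b ⊆ Ioo (-2) 2 := fun r hr => ⟨by linarith [hr.1], by linarith [hr.2]⟩
  have hsub' : Ioo a b ⊆ Ioo (-1) 1 := fun r hr => ⟨by linarith [hr.1], by linarith [hr.2]⟩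
  have hcont : ContinuousOn (w.massFlux m G) (Icc a b) := by
    have h1 : ContinuousOn G (Icc a b) := hG.contDiffOn.continuousOn.mono hsub
    have h2 : ContinuousOn (deriv G) (Icc a b) :=
      ((contDiffOn_infty_iff_deriv_of_isOpen isOpen_Ioo).1 hG.contDiffOn).2.continuousOn.mono hsub
    have h3 := w.contDiff_F.continuous
    have h4 := w.contDiff_deriv_F_div_ρ.continuous
    have h5 : Continuous fun s => w.F s ^ (m + 1) / w.ρ s :=
      (h3.pow _).div w.contDiff_ρ.continuous fun s => (w.ρ_pos s).ne'
    exact ((h5.continuousOn.mul h2).mul h1).add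
      ((continuousOn_const.mul h4.continuousOn).mul ((h3.pow m).continuousOn.mul (h1.pow 2)))
  have hder : ∀ r ∈ Ioo a b, HasDerivAt (w.massFlux m G)
      (w.F r / w.ρ r * deriv (fun t => f t ^ m * G t) r ^ 2 +
        w.ρ r * (m ^ 2 / w.F r + U r - lam) * (f r ^ m * G r) ^ 2) r := by
    intro r hr
    have hr' := hsub' hr
    have h1 := hw.hasDerivAt_pow_mul (m := m) hr' (hG.hasDerivAt hr')
    have h2 := hG.hasDerivAt_flux hw hr'
    refine ((h1.mul h2).congr_of_eventuallyEq ?_).congr_deriv ?_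
    · filter_upwards [Ioo_mem_nhds hr'.1 hr'.2] with s hs
      have hf := pow_ne_zero m (hw.pos s hs).ne'
      simp only [Pi.mul_apply]
      rw [hw.flux_pow_mul hs (hG.hasDerivAt hs), massFlux]
      have e : w.F s ^ m = f s ^ m * f s ^ m := by
        rw [hw.F_eq s (Ioo_subset_Icc_self hs), ← mul_pow, ← pow_two]
      rw [e]
      field_simp
    · rw [← h1.deriv]
      ring
  have hpos : ∀ r ∈ Ioo a b, G r ≠ 0 → 0 < w.F r / w.ρ r * deriv (fun t => f t ^ m * G t) r ^ 2 +
      w.ρ r * (m ^ 2 / w.F r + U r - lam) * (f r ^ m * G r) ^ 2 := by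
    intro r hr h
    have hF := w.F_pos r (hsub' hr)
    have hρ := w.ρ_pos r
    have h1 : 0 < m ^ 2 / w.F r + U r - lam := by
      have : (0 : ℝ) ≤ m ^ 2 / w.F r := by positivity
      linarith [hlam r hr]
    have h2 : f r ^ m * G r ≠ 0 := mul_ne_zero (pow_ne_zero m (hw.pos r (hsub' hr)).ne') h
    positivity
  have hmono : MonotoneOn (w.massFlux m G) (Icc a b) := by
    refine monotoneOn_of_deriv_nonneg (convex_Icc _ _) hcont ?_ ?_
    · rw [interior_Icc]
      exact fun r hr => (hder r hr).differentiableAt.differentiableWithinAt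
    · rw [interior_Icc]
      intro r hr
      rw [(hder r hr).deriv]
      by_cases h : G r = 0
      · have := w.F_pos r (hsub' hr)
        have := w.ρ_pos r
        rw [h]
        simp only [mul_zero, ne_eq, OfNat.ofNat_ne_zero, not_false_eq_true, zero_pow, add_zero]
        positivity
      · exact (hpos r hr h).le
  have hconst : ∀ r ∈ Icc a b, w.massFlux m G r = 0 := fun r hr => by
    have h1 := hmono (left_mem_Icc.2 hab.le) hr hr.1
    have h2 := hmono hr (right_mem_Icc.2 hab.le) hr.2
    rw [ha1] at h1
    rw [hb1] at h2
    exact le_antisymm h2 h1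
  refine hG.not_eqOn_zero hU hab ha hb fun r hr => by_contra fun h => ?_
  have h1 : w.massFlux m G =ᶠ[𝓝 r] fun _ => 0 := by
    filter_upwards [Ioo_mem_nhds hr.1 hr.2] with s hs using hconst s (Ioo_subset_Icc_self hs)
  have h2 := (hder r hr).deriv
  rw [h1.deriv_eq, deriv_const] at h2
  exact (hpos r hr h).ne h2

end PolarWeight

/-! ### Zeros on a parallel -/

/-- The angles of the zeros of `cos (m θ)`. -/
noncomputable def nodalAngle (m j : ℕ) : ℝ := (2 * j + 1) * Real.pi / (2 * m)

theorem revPoint_eq_iff {f : ℝ → ℝ} {r θ θ' : ℝ} (hf : f r ≠ 0) :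
    revPoint f r θ = revPoint f r θ' ↔ Real.cos θ = Real.cos θ' ∧ Real.sin θ = Real.sin θ' := by
  constructor
  · intro h
    have h1 := congrArg (fun p : E3 => p 1) h
    have h2 := congrArg (fun p : E3 => p 2) h
    simp only [revPoint] at h1 h2
    exact ⟨mul_left_cancel₀ hf (by simpa using h1), mul_left_cancel₀ hf (by simpa using h2)⟩
  · rintro ⟨h1, h2⟩
    rw [revPoint, revPoint, h1, h2]

theorem injOn_nodal {f : ℝ → ℝ} {r : ℝ} (hf : f r ≠ 0) {m : ℕ} (hm : m ≠ 0) :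
    InjOn (fun j => revPoint f r (nodalAngle m j)) (Finset.range (2 * m) : Set ℕ) := by
  intro i hi j hj hij
  rw [revPoint_eq_iff hf] at hij
  have h1 := Real.Angle.cos_sin_inj hij.1 hij.2
  rw [Real.Angle.angle_eq_iff_two_pi_dvd_sub] at h1
  obtain ⟨k, hk⟩ := h1
  have hm' : (m : ℝ) ≠ 0 := Nat.cast_ne_zero.2 hm
  simp only [nodalAngle] at hk
  have h2 : (i : ℝ) - j = 2 * m * k := by
    field_simp at hk
    linarith
  have h3 : (i : ℤ) - j = 2 * m * k := by exact_mod_cast h2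
  simp only [Finset.coe_range, mem_Iio] at hi hj
  have h4 : k = 0 := by
    by_contra hk0
    rcases lt_or_gt_of_ne hk0 with h | h
    · have : 2 * (m : ℤ) * k ≤ -(2 * m) := by nlinarith
      omega
    · have : 2 * (m : ℤ) ≤ 2 * m * k := by nlinarith
      omega
  rw [h4, mul_zero] at h3
  omega

theorem encard_nodal {f : ℝ → ℝ} {r : ℝ} (hf : f r ≠ 0) {m : ℕ} (hm : m ≠ 0) :
    ((fun j => revPoint f r (nodalAngle m j)) '' (Finset.range (2 * m) : Set ℕ)).encard =
      ((2 * m : ℕ) : ℕ∞) := by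
  rw [(injOn_nodal hf hm).encard_image, encard_coe_eq_coe_finsetCard, Finset.card_range]

theorem nodal_subset {f : ℝ → ℝ} {r : ℝ} {m : ℕ} (hm : m ≠ 0) (G : ℝ → ℝ) :
    (fun j => revPoint f r (nodalAngle m j)) '' (Finset.range (2 * m) : Set ℕ) ⊆
      parallel f r ∩ {p | angularFun m G p = 0} := by
  rintro _ ⟨j, -, rfl⟩
  refine ⟨⟨_, rfl⟩, ?_⟩
  have hm' : (m : ℝ) ≠ 0 := Nat.cast_ne_zero.2 hm
  have h : Real.cos (m * nodalAngle m j) = 0 := by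
    rw [Real.cos_eq_zero_iff]
    refine ⟨j, ?_⟩
    rw [nodalAngle]
    push_cast
    field_simp
  simp only [mem_ofPred_eq, angularFun_revPoint, h, mul_zero]

theorem subset_nodal {f : ℝ → ℝ} {r : ℝ} (hf : f r ≠ 0) {m : ℕ} (hm : m ≠ 0) {G : ℝ → ℝ}
    (hG : G r ≠ 0) : parallel f r ∩ {p | angularFun m G p = 0} ⊆
      (fun j => revPoint f r (nodalAngle m j)) '' (Finset.range (2 * m) : Set ℕ) := by
  rintro _ ⟨⟨θ, rfl⟩, h⟩
  rw [mem_ofPred_eq, angularFun_revPoint] at h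
  have h1 := (mul_eq_zero.1 h).resolve_left (mul_ne_zero (pow_ne_zero m hf) hG)
  obtain ⟨k, hk⟩ := Real.cos_eq_zero_iff.1 h1
  have hm' : (m : ℝ) ≠ 0 := Nat.cast_ne_zero.2 hm
  have hm2 : (0 : ℤ) < 2 * m := by have := Nat.pos_of_ne_zero hm; omega
  have h2 := Int.emod_add_mul_ediv k (2 * m)
  have h3 := Int.emod_nonneg k hm2.ne'
  have h4 := Int.emod_lt_of_pos k hm2
  set d := k / (2 * m) with hd
  obtain ⟨j, hj⟩ := Int.eq_ofNat_of_zero_le h3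
  rw [hj] at h2 h4
  refine ⟨j, ?_, ?_⟩
  · simp only [Finset.coe_range, mem_Iio]
    omega
  · have h5 : θ = nodalAngle m j + d * (2 * Real.pi) := by
      have h6 : (k : ℝ) = j + 2 * m * d := by exact_mod_cast h2.symm
      rw [nodalAngle]
      field_simp
      rw [h6] at hk
      linarith
    simp only
    rw [revPoint_eq_iff hf, h5, Real.cos_add_int_mul_two_pi, Real.sin_add_int_mul_two_pi]
    exact ⟨rfl, rfl⟩

theorem le_zerosOnParallel {f : ℝ → ℝ} {r : ℝ} (hf : f r ≠ 0) {m : ℕ} (hm : m ≠ 0) (G : ℝ → ℝ) :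
    ((2 * m : ℕ) : ENNReal) ≤ zerosOnParallel f r (angularFun m G) := by
  have h := encard_le_encard (nodal_subset (f := f) (r := r) hm G)
  rw [encard_nodal hf hm] at h
  have := ENat.toENNReal_le.2 h
  rwa [ENat.toENNReal_coe] at this

theorem zerosOnParallel_eq {f : ℝ → ℝ} {r : ℝ} (hf : f r ≠ 0) {m : ℕ} (hm : m ≠ 0) {G : ℝ → ℝ}
    (hG : G r ≠ 0) : zerosOnParallel f r (angularFun m G) = ((2 * m : ℕ) : ENNReal) := by
  have h := (subset_nodal hf hm hG).antisymm (nodal_subset hm G)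
  rw [zerosOnParallel, h, encard_nodal hf hm, ENat.toENNReal_coe]

/-! ### Sequences of eigenfunctions -/

/-- If the sets `S k` are nonempty and eventually meet each neighbourhood of `E`, then points of
`S k` can be chosen that converge to `E`. -/
theorem exists_tendsto_of_eventually_near {S : ℕ → Set ℝ} {E : ℝ} (hne : ∀ k, (S k).Nonempty)
    (hnear : ∀ δ > 0, ∀ᶠ k in atTop, ∃ e ∈ S k, |e - E| < δ) :
    ∃ e : ℕ → ℝ, (∀ k, e k ∈ S k) ∧ Tendsto e atTop (𝓝 E) := by
  have hpos : ∀ k : ℕ, (0 : ℝ) < 1 / (k + 1) := fun k => by positivity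
  have hch : ∀ k, ∃ e ∈ S k, Metric.infDist E (S k) + 1 / (k + 1) > dist E e := fun k =>
    (Metric.infDist_lt_iff (hne k)).1 (lt_add_of_pos_right _ (hpos k))
  choose e he hlt using hch
  refine ⟨e, he, ?_⟩
  rw [Metric.tendsto_atTop']
  intro ε hε
  have h1 := hnear (ε / 2) (by positivity)
  have h2 : ∀ᶠ k : ℕ in atTop, 1 / ((k : ℝ) + 1) < ε / 2 :=
    tendsto_one_div_add_atTop_nhds_zero_nat.eventually (gt_mem_nhds (by positivity))
  obtain ⟨N, hN⟩ := eventually_atTop.1 (h1.and h2)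
  refine ⟨N, fun k hk => ?_⟩
  obtain ⟨⟨e', he', hd⟩, h3⟩ := hN k hk.le
  have h4 : Metric.infDist E (S k) ≤ dist E e' := Metric.infDist_le_dist_of_mem he'
  rw [dist_comm E e', Real.dist_eq] at h4
  rw [dist_comm]
  linarith [hlt k]

theorem exists_isGreatest_sqrt {f V : ℝ → ℝ} {E : ℝ} (hf : IsConvexProfile f)
    (hV : AnalyticOnNhd ℝ V (Icc (-1) 1)) (hE : ∃ r ∈ Icc (-1 : ℝ) 1, V r < E) :
    ∃ c₀ : ℝ, 0 < c₀ ∧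
      IsGreatest ((fun r => f r ^ 2 * (E - V r)) '' Icc (-1 : ℝ) 1) (c₀ ^ 2) := by
  have hVc : ContinuousOn V (Icc (-1) 1) := hV.continuousOn
  have hc : ContinuousOn (fun r => f r ^ 2 * (E - V r)) (Icc (-1) 1) :=
    (hf.continuousOn.pow 2).mul (continuousOn_const.sub hVc)
  obtain ⟨r₁, hr₁, hmax⟩ := isCompact_Icc.exists_isMaxOn (nonempty_Icc.2 (by norm_num)) hc
  have hgr : IsGreatest ((fun r => f r ^ 2 * (E - V r)) '' Icc (-1 : ℝ) 1)
      (f r₁ ^ 2 * (E - V r₁)) := ⟨⟨r₁, hr₁, rfl⟩, by rintro _ ⟨r, hr, rfl⟩; exact hmax hr⟩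
  -- the function is positive at points of the allowed region other than the poles
  have hpos : 0 < f r₁ ^ 2 * (E - V r₁) := by
    obtain ⟨r, hr, hrE⟩ := hE
    obtain ⟨s, hs, hsE⟩ : ∃ s ∈ Ioo (-1 : ℝ) 1, V s < E := by
      have h1 : ∀ᶠ s in 𝓝 r, V s < E := (hV r hr).continuousAt.eventually (gt_mem_nhds hrE)
      have h2 : r ∈ closure (Ioo (-1 : ℝ) 1) := by rwa [closure_Ioo (by norm_num)]
      obtain ⟨s, hs, hs'⟩ := mem_closure_iff_nhds.1 h2 _ h1
      exact ⟨s, hs', hs⟩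
    have := hgr.2 ⟨s, Ioo_subset_Icc_self hs, rfl⟩
    have h3 : 0 < f s ^ 2 * (E - V s) :=
      mul_pos (pow_pos (profile_pos hf hs) 2) (sub_pos.2 hsE)
    exact h3.trans_le this
  refine ⟨√(f r₁ ^ 2 * (E - V r₁)), Real.sqrt_pos.2 hpos, ?_⟩
  rwa [Real.sq_sqrt hpos.le]

/-- For `0 < c ≤ c₀` the effective potential `c ^ 2 / f ^ 2 + V` takes the value `E`. -/
theorem exists_effective_eq {f V : ℝ → ℝ} {E c c₀ : ℝ} (hf : IsConvexProfile f)
    (hV : AnalyticOnNhd ℝ V (Icc (-1) 1)) (hc : 0 < c) (hcc : c ≤ c₀)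
    (hgr : IsGreatest ((fun r => f r ^ 2 * (E - V r)) '' Icc (-1 : ℝ) 1) (c₀ ^ 2)) :
    ∃ r ∈ Ioo (-1 : ℝ) 1, c ^ 2 / f r ^ 2 + V r = E := by
  obtain ⟨r₁, hr₁, h₁⟩ := hgr.1
  have hcont : ContinuousOn (fun r => f r ^ 2 * (E - V r)) (Icc (-1) r₁) :=
    ((hf.continuousOn.pow 2).mul (continuousOn_const.sub hV.continuousOn)).mono
      (Icc_subset_Icc_right hr₁.2)
  obtain ⟨r, hr, hrc⟩ := intermediate_value_Icc hr₁.1 hcont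
    (show c ^ 2 ∈ Icc _ _ from ⟨by
      simp only [hf.left_zero]
      norm_num
      positivity, by
      simp only at h₁ ⊢
      rw [h₁]
      exact pow_le_pow_left₀ hc.le hcc 2⟩)
  simp only at hrc
  have hc2 : 0 < c ^ 2 := by positivity
  have hr1 : r ≠ -1 := by
    rintro rfl
    rw [hf.left_zero] at hrc
    norm_num at hrc
    exact hc2.ne hrc
  have hr2 : r ≠ 1 := by
    rintro rfl
    rw [hf.right_zero] at hrc
    norm_num at hrc
    exact hc2.ne hrc
  have hrI : r ∈ Ioo (-1 : ℝ) 1 :=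
    ⟨lt_of_le_of_ne hr.1 hr1.symm, lt_of_le_of_ne (hr.2.trans hr₁.2) hr2⟩
  refine ⟨r, hrI, ?_⟩
  have := (profile_pos hf hrI).ne'
  rw [← hrc]
  field_simp
  ring

/-- The eigenfunctions of angular momentum `c / h k`, and the number of their zeros on a parallel.
The number of zeros is infinite when the radial factor vanishes there, hence the inequality. -/
theorem exists_eigenfunctions {f V : ℝ → ℝ} {E c c₀ : ℝ} (hf : IsConvexProfile f)
    (hV : AnalyticOnNhd ℝ V (Icc (-1) 1)) (hc : 0 < c) (hcc : c ≤ c₀)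
    (hgr : IsGreatest ((fun r => f r ^ 2 * (E - V r)) '' Icc (-1 : ℝ) 1) (c₀ ^ 2))
    {h : ℕ → ℝ} (hh : ∀ k, 0 < h k) (hlim : Tendsto h atTop (𝓝 0))
    (hint : ∀ k, ∃ m : ℕ, c / h k = m) :
    ∃ (e : ℕ → ℝ) (v : ℕ → ℝ → ℝ) (φ : ℕ → E3 → ℝ),
      Tendsto e atTop (𝓝 E) ∧
      (∀ k, IsNormalizedEigenfunction f V (h k) (e k) (φ k)) ∧
      (∀ k, ∀ r ∈ Icc (-1 : ℝ) 1, ∀ θ : ℝ,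
        φ k (revPoint f r θ) =
          (Complex.exp (Complex.I * ((c * θ / h k : ℝ) : ℂ)) * (v k r : ℂ)).re) ∧
      (∀ k, ∀ r₀ ∈ Ioo (-1 : ℝ) 1,
        ENNReal.ofReal (2 * c / h k) ≤ zerosOnParallel f r₀ (φ k)) ∧
      (∀ r₀ ∈ Ioo (-1 : ℝ) 1,
        ((∀ r ∈ Icc (-1) r₀, E < V r) ∨ (∀ r ∈ Icc r₀ 1, E < V r)) →
        ∀ᶠ k in atTop, zerosOnParallel f r₀ (φ k) = ENNReal.ofReal (2 * c / h k)) := by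
  obtain ⟨w, hw⟩ := exists_models hf
  obtain ⟨V', hV', hVV'⟩ := exists_contDiff_eq hV
  obtain ⟨r₁, hr₁, hE₁⟩ := exists_effective_eq hf hV hc hcc hgr
  rw [← hw.F_eq r₁ (Ioo_subset_Icc_self hr₁), ← hVV' r₁ (Ioo_subset_Icc_self hr₁)] at hE₁
  choose m hm using hint
  have hmh : ∀ k, (m k : ℝ) * h k = c := fun k => by
    rw [← hm k, div_mul_cancel₀ _ (hh k).ne']
  have hm0 : ∀ k, m k ≠ 0 := fun k h0 => by
    have := hmh k
    rw [h0, Nat.cast_zero, zero_mul] at this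
    exact hc.ne this
  obtain ⟨e, he, hlime⟩ := exists_tendsto_of_eventually_near (E := E)
    (S := fun k => {e | ∃ G, w.IsMode (m k) (fun r => V' r / h k ^ 2) (e / h k ^ 2) G})
    (fun k => (PolarWeight.exists_isMode_near hw hV' hr₁ hE₁ one_pos).2 (h k) (hh k) (m k) (hmh k))
    (fun δ hδ => by
      obtain ⟨h₀, hh₀, H⟩ := (PolarWeight.exists_isMode_near hw hV' hr₁ hE₁ hδ).1
      filter_upwards [hlim.eventually (gt_mem_nhds hh₀)] with k hk
      obtain ⟨e, he, hG⟩ := H (h k) (hh k) hk (m k) (hmh k)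
      exact ⟨e, hG, he⟩)
  choose G hG using he
  have hcount : ∀ k, ENNReal.ofReal (2 * c / h k) = ((2 * m k : ℕ) : ENNReal) := fun k => by
    rw [mul_div_assoc, hm k, ← ENNReal.ofReal_natCast]
    push_cast
    rfl
  refine ⟨e, fun k r => f r ^ m k * G k r, fun k => angularFun (m k) (G k), hlime,
    fun k => (hG k).isNormalizedEigenfunction hw (hm0 k) hVV' (hh k), fun k r _ θ => ?_,
    fun k r₀ hr₀ => ?_, fun r₀ hr₀ hcap => ?_⟩
  · simp only
    rw [angularFun_revPoint_eq_re, mul_div_right_comm, hm k]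
  · rw [hcount]
    exact le_zerosOnParallel (hw.pos r₀ hr₀).ne' (hm0 k) _
  · -- a cap `[a, b]` bounded by the parallel, on which `V` exceeds `E` by a fixed amount
    obtain ⟨a, b, hab, ha, hb, hV0, hends⟩ : ∃ a b : ℝ, a < b ∧ -1 ≤ a ∧ b ≤ 1 ∧
        (∀ r ∈ Icc a b, E < V r) ∧ ∀ G : ℝ → ℝ, G r₀ = 0 →
          (a = -1 ∨ G a = 0) ∧ (b = 1 ∨ G b = 0) := by
      rcases hcap with hcap | hcap
      · exact ⟨-1, r₀, hr₀.1, le_rfl, hr₀.2.le, hcap, fun G h => ⟨Or.inl rfl, Or.inr h⟩⟩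
      · exact ⟨r₀, 1, hr₀.2, hr₀.1.le, le_rfl, hcap, fun G h => ⟨Or.inr h, Or.inl rfl⟩⟩
    have hsub : Icc a b ⊆ Icc (-1) 1 := Icc_subset_Icc ha hb
    obtain ⟨r₂, hr₂, hmin⟩ := isCompact_Icc.exists_isMinOn (nonempty_Icc.2 hab.le)
      (hV.continuousOn.mono hsub)
    filter_upwards [hlime.eventually (gt_mem_nhds (hV0 r₂ hr₂))] with k hk
    rw [hcount]
    refine zerosOnParallel_eq (hw.pos r₀ hr₀).ne' (hm0 k) fun hzero => ?_
    refine (hG k).false_of_forbidden hw (hm0 k) (hV'.continuous.div_const _) hab ha hb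
      (fun r hr => ?_) (hends _ hzero).1 (hends _ hzero).2
    have hr' := Ioo_subset_Icc_self hr
    have h1 : V r₂ ≤ V r := hmin hr'
    rw [hVV' r (hsub hr')]
    have := hh k
    exact div_lt_div_of_pos_right (hk.trans_le h1) (by positivity)

/-! ### The round sphere with a linear potential -/

theorem sphere_radicand_pos {r : ℝ} (hr : r ∈ Ioo (-1 : ℝ) 1) : 0 < 1 - r ^ 2 := by
  nlinarith [hr.1, hr.2]

theorem hasDerivAt_sphere_profile {r : ℝ} (hr : r ∈ Ioo (-1 : ℝ) 1) :
    HasDerivAt (fun r : ℝ => √(1 - r ^ 2)) (-r / √(1 - r ^ 2)) r := by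
  have h := ((hasDerivAt_pow 2 r).const_sub 1).sqrt (sphere_radicand_pos hr).ne'
  convert h using 1
  have := (Real.sqrt_pos.2 (sphere_radicand_pos hr)).ne'
  field_simp
  push_cast
  ring

theorem isConvexProfile_sphere : IsConvexProfile fun r => √(1 - r ^ 2) where
  continuousOn := by fun_prop
  left_zero := by norm_num
  right_zero := by norm_num
  analytic := fun r hr => by
    have h1 : ContDiffAt ℝ ω (fun r : ℝ => 1 - r ^ 2) r := by fun_prop
    exact (h1.sqrt (sphere_radicand_pos hr).ne').analyticAt
  concave := fun r hr => by
    have h1 : deriv (fun r : ℝ => √(1 - r ^ 2)) =ᶠ[𝓝 r] fun r => -r / √(1 - r ^ 2) := by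
      filter_upwards [Ioo_mem_nhds hr.1 hr.2] with s hs
      exact (hasDerivAt_sphere_profile hs).deriv
    have hpos := sphere_radicand_pos hr
    have hs := Real.sqrt_pos.2 hpos
    have h2 := (hasDerivAt_id r).neg.div (hasDerivAt_sphere_profile hr) hs.ne'
    rw [h1.deriv_eq]
    refine h2.deriv.trans_lt ?_
    refine div_neg_of_neg_of_pos ?_ (by positivity)
    have h3 : -id r * (-r / √(1 - r ^ 2)) = r ^ 2 / √(1 - r ^ 2) := by
      simp only [id]
      ring
    simp only [Pi.neg_apply, h3]
    have h4 : 0 ≤ r ^ 2 / √(1 - r ^ 2) := by positivity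
    linarith
  analytic_poles := by
    refine ⟨fun r => 1 - r ^ 2, fun r _ => ?_, fun r hr => ?_, ?_, ?_⟩
    · have h1 : ContDiffAt ℝ ω (fun r : ℝ => 1 - r ^ 2) r := by fun_prop
      exact h1.analyticAt
    · rw [Real.sq_sqrt]
      nlinarith [hr.1, hr.2]
    · rw [((hasDerivAt_pow 2 (-1 : ℝ)).const_sub 1).deriv]
      norm_num
    · rw [((hasDerivAt_pow 2 (1 : ℝ)).const_sub 1).deriv]
      norm_num

theorem isRegularEnergy_sphere :
    IsRegularEnergy (fun r => √(1 - r ^ 2)) (fun r => 3 * r) 0 := by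
  rintro ⟨x, ξ⟩ ⟨γ, hγ, hγ0, hγd⟩ hq
  simp only [totalEnergy] at hq hγ0 hγd
  by_cases hξ : ξ = 0
  · -- over the equator the energy varies along a meridian
    subst hξ
    obtain ⟨r, hr, θ, hx⟩ := hγ 0
    have hr0 : r = 0 := by
      rw [← hγ0, hx] at hq
      simpa [revPoint] using hq
    subst hr0
    refine ⟨fun t => (revPoint (fun r => √(1 - r ^ 2)) (Real.sin t) θ, 0), fun t => ?_, ?_, ?_, ?_⟩
    · exact ⟨fun _ => revPoint _ (Real.sin t) θ,
        fun _ => ⟨_, ⟨Real.neg_one_le_sin t, Real.sin_le_one t⟩, θ, rfl⟩, rfl,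
        hasDerivAt_const _ _⟩
    · rw [← hγ0, hx]
      simp
    · have h1 : DifferentiableAt ℝ (fun t => √(1 - Real.sin t ^ 2)) 0 :=
        DifferentiableAt.sqrt (by fun_prop) (by simp)
      refine DifferentiableAt.prodMk (differentiableAt_euclidean.2 fun i => ?_)
        (differentiableAt_const _)
      fin_cases i
      · simp [revPoint]
      · simpa [revPoint] using h1.mul_const (Real.cos θ)
      · simpa [revPoint] using h1.mul_const (Real.sin θ)
    · have h1 : (fun t => totalEnergy (fun r => 3 * r)
          (revPoint (fun r => √(1 - r ^ 2)) (Real.sin t) θ, (0 : E3))) =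
          fun t => 3 * Real.sin t := by
        ext t
        simp [totalEnergy, revPoint]
      rw [h1, ((Real.hasDerivAt_sin 0).const_mul 3).deriv]
      simp
  · -- rescaling a nonzero velocity changes the kinetic energy
    refine ⟨fun t => (x, (1 + t) • ξ), fun t => ?_, by simp, by fun_prop, ?_⟩
    · refine ⟨fun s => γ ((1 + t) * s), fun s => hγ _, by simpa using hγ0, ?_⟩
      have h1 : HasDerivAt (fun s : ℝ => (1 + t) * s) (1 + t) 0 := by
        simpa using (hasDerivAt_id (0 : ℝ)).const_mul (1 + t)
      exact HasDerivAt.scomp (h := fun s : ℝ => (1 + t) * s) (0 : ℝ) (by simpa using hγd) h1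
    · have h1 : (fun t : ℝ => totalEnergy (fun r => 3 * r) (x, (1 + t) • ξ)) =
          fun t => (1 + t) ^ 2 * ‖ξ‖ ^ 2 + 3 * x 0 := by
        ext t
        simp [totalEnergy, norm_smul, mul_pow]
      have h2 : HasDerivAt (fun t : ℝ => (1 + t) ^ 2 * ‖ξ‖ ^ 2 + 3 * x 0) (2 * ‖ξ‖ ^ 2) 0 := by
        have := ((((hasDerivAt_id (0 : ℝ)).const_add 1).pow 2).mul_const (‖ξ‖ ^ 2)).add_const
          (3 * x 0)
        simpa using this
      rw [h1, h2.deriv]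
      have := norm_pos_iff.2 hξ
      positivity

/-- On the unit sphere with potential `3 r`, energy `0` and frequency `c = 1`, the eigenfunctions
for a tail of the sequence `1 / (k + 1)` have finitely many zeros on the parallel at height
`1 / 2`, which bounds the cap `r ≥ 1 / 2` in the forbidden region. -/
theorem exists_sharp_eigenfunctions :
    ∃ (h e : ℕ → ℝ) (v : ℕ → ℝ → ℝ) (φ : ℕ → E3 → ℝ),
      (∀ k, 0 < h k) ∧ StrictAnti h ∧ Tendsto h atTop (𝓝 0) ∧ Tendsto e atTop (𝓝 0) ∧
      ∀ k, IsNormalizedEigenfunction (fun r => √(1 - r ^ 2)) (fun r => 3 * r) (h k) (e k) (φ k) ∧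
        (∀ r ∈ Icc (-1 : ℝ) 1, ∀ θ : ℝ,
          φ k (revPoint (fun r => √(1 - r ^ 2)) r θ) =
            (Complex.exp (Complex.I * ((θ / h k : ℝ) : ℂ)) * (v k r : ℂ)).re) ∧
        ENNReal.ofReal (2 / h k) ≤ zerosOnParallel (fun r => √(1 - r ^ 2)) (1 / 2) (φ k) ∧
        zerosOnParallel (fun r => √(1 - r ^ 2)) (1 / 2) (φ k) < ⊤ := by
  have hV : AnalyticOnNhd ℝ (fun r : ℝ => 3 * r) (Icc (-1) 1) := fun r _ => by
    have h1 : ContDiffAt ℝ ω (fun r : ℝ => 3 * r) r := by fun_prop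
    exact h1.analyticAt
  obtain ⟨c₀, hc₀, hgr⟩ := exists_isGreatest_sqrt (E := 0) isConvexProfile_sphere hV
    ⟨-1, by norm_num, by norm_num⟩
  have hc : 1 ≤ c₀ := by
    -- at `r = -1 / 2` the function maximized by `c₀ ^ 2` takes the value `9 / 8`
    have h1 := hgr.2 ⟨-1 / 2, by norm_num, rfl⟩
    simp only at h1
    rw [Real.sq_sqrt (by norm_num)] at h1
    nlinarith
  obtain ⟨e, v, φ, he, heig, hform, hle, heq⟩ := exists_eigenfunctions isConvexProfile_sphere hV
    one_pos hc hgr (h := fun k : ℕ => 1 / ((k : ℝ) + 1)) (fun k => by positivity)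
    tendsto_one_div_add_atTop_nhds_zero_nat (fun k => ⟨k + 1, by simp⟩)
  obtain ⟨N, hN⟩ := eventually_atTop.1 (heq (1 / 2) (by norm_num)
    (Or.inr fun r hr => by linarith [hr.1]))
  refine ⟨fun k => 1 / (((k + N : ℕ) : ℝ) + 1), fun k => e (k + N), fun k => v (k + N),
    fun k => φ (k + N), fun k => by positivity, fun k l hkl => ?_,
    tendsto_one_div_add_atTop_nhds_zero_nat.comp (tendsto_add_atTop_nat N),
    he.comp (tendsto_add_atTop_nat N), fun k => ⟨heig _, fun r hr θ => ?_, ?_, ?_⟩⟩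
  · refine one_div_lt_one_div_of_lt (by positivity) ?_
    push_cast
    have : (k : ℝ) < l := by exact_mod_cast hkl
    linarith
  · simpa only [one_mul] using hform (k + N) r hr θ
  · simpa only [mul_one] using hle (k + N) (1 / 2) (by norm_num)
  · rw [hN (k + N) (by omega)]
    exact ENNReal.ofReal_lt_top

end RevolutionSurface

open RevolutionSurface in
theorem mainTheorem7 :
    -- every strictly convex analytic surface of revolution
    (∀ (f V : ℝ → ℝ) (E : ℝ), IsConvexProfile f → AnalyticOnNhd ℝ V (Icc (-1) 1) →
      IsRegularEnergy f V E →
      (∃ r ∈ Icc (-1 : ℝ) 1, V r < E) → (∃ r ∈ Icc (-1 : ℝ) 1, E < V r) →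
      ∃ c₀ : ℝ, 0 < c₀ ∧
        IsGreatest ((fun r => f r ^ 2 * (E - V r)) '' Icc (-1 : ℝ) 1) (c₀ ^ 2) ∧
        ∀ c : ℝ, 0 < c → c ≤ c₀ →
        ∀ h : ℕ → ℝ, (∀ k, 0 < h k) → Tendsto h atTop (𝓝 0) →
          (∀ k, ∃ m : ℕ, c / h k = m) →
        ∃ (e : ℕ → ℝ) (v : ℕ → ℝ → ℝ) (φ : ℕ → E3 → ℝ),
          Tendsto e atTop (𝓝 E) ∧
          (∀ k, IsNormalizedEigenfunction f V (h k) (e k) (φ k)) ∧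
          (∀ k, ∀ r ∈ Icc (-1 : ℝ) 1, ∀ θ : ℝ,
            φ k (revPoint f r θ) =
              (Complex.exp (Complex.I * ((c * θ / h k : ℝ) : ℂ)) * (v k r : ℂ)).re) ∧
          (∀ k, ∀ r₀ ∈ Ioo (-1 : ℝ) 1, E < V r₀ →
            ENNReal.ofReal (2 * c / h k) ≤ zerosOnParallel f r₀ (φ k)) ∧
          (∀ r₀ ∈ Ioo (-1 : ℝ) 1,
            ((∀ r ∈ Icc (-1) r₀, E < V r) ∨ (∀ r ∈ Icc r₀ 1, E < V r)) →
            ∀ᶠ k in atTop, zerosOnParallel f r₀ (φ k) = ENNReal.ofReal (2 * c / h k))) ∧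
    -- sharpness on a parallel that bounds a cap inside the forbidden region
    (∃ (f V : ℝ → ℝ) (E r₀ : ℝ), IsConvexProfile f ∧ AnalyticOnNhd ℝ V (Icc (-1) 1) ∧
      IsRegularEnergy f V E ∧ (∃ r ∈ Icc (-1 : ℝ) 1, V r < E) ∧
      r₀ ∈ Ioo (-1 : ℝ) 1 ∧ (∀ r ∈ Icc r₀ 1, E < V r) ∧
      ∃ (h e : ℕ → ℝ) (v : ℕ → ℝ → ℝ) (φ : ℕ → E3 → ℝ),
        (∀ k, 0 < h k) ∧ StrictAnti h ∧ Tendsto h atTop (𝓝 0) ∧ Tendsto e atTop (𝓝 E) ∧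
        ∀ k, IsNormalizedEigenfunction f V (h k) (e k) (φ k) ∧
          (∀ r ∈ Icc (-1 : ℝ) 1, ∀ θ : ℝ,
            φ k (revPoint f r θ) =
              (Complex.exp (Complex.I * ((θ / h k : ℝ) : ℂ)) * (v k r : ℂ)).re) ∧
          ENNReal.ofReal (2 / h k) ≤ zerosOnParallel f r₀ (φ k) ∧
          zerosOnParallel f r₀ (φ k) < ⊤) := by
  constructor
  · intro f V E hf hV _ hlt _
    obtain ⟨c₀, hc₀, hgr⟩ := exists_isGreatest_sqrt hf hV hlt
    refine ⟨c₀, hc₀, hgr, fun c hc hcc h hh hlim hint => ?_⟩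
    obtain ⟨e, v, φ, he, heig, hform, hle, heq⟩ :=
      exists_eigenfunctions hf hV hc hcc hgr hh hlim hint
    exact ⟨e, v, φ, he, heig, hform, fun k r₀ hr₀ _ => hle k r₀ hr₀, heq⟩
  · refine ⟨fun r => √(1 - r ^ 2), fun r => 3 * r, 0, 1 / 2, isConvexProfile_sphere,
      fun r _ => ?_, isRegularEnergy_sphere, ⟨-1, by norm_num, by norm_num⟩, by norm_num,
      fun r hr => by linarith [hr.1], exists_sharp_eigenfunctions⟩
    have h1 : ContDiffAt ℝ ω (fun r : ℝ => 3 * r) r := by fun_prop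
    exact h1.analyticAt
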